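/- **Conventions.** Let $X$ be a Noetherian scheme and $Z\subset X$ a closed, nowhere dense subscheme. A finite morphism $p:Y\to X$ such that no associated point of $Y$ lies in $p^{-1}(Z)$ is called a *finite modification of $X$ centered at $Z$* if $p: Y\setminus p^{-1}(Z)\to X\setminus Z$ is an isomorphism, and a *finite topological modification of $X$ centered at $Z$* if $p: Y\setminus p^{-1}(Z)\to X\setminus Z$ is a universal homeomorphism (that is, every base change of it is a homeomorphism). The pair $Z\subset X$ is *topologically normal* if every finite modification of $X$ centered at $Z$ is a universal homeomorphism. A *semilocal scheme* $(x,X)$ is the spectrum of a ring with finitely many maximal ideals, $x$ being its set of closed points; if $x$ is nowhere dense, a finite modification of $X$ centered at $x$ is called a *punctual modification* of $(x,X)$, and a punctual modification $p:Y\to X$ is called topologically normal if the pair $p^{-1}(x)\subset Y$ is topologically normal. **Theorem.** (1) Let $X$ be a Noetherian scheme, $Z\subset X$ a closed, nowhere dense subscheme and $g:Y\to X$ a finite topological modification centered at $Z$. Then $g$ can be factored as $$Y\xrightarrow{\;g'\;}X'\xrightarrow{\;\pi\;}X,$$ where $g'$ is a finite universal homeomorphism and $\pi$ is a finite modification centered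 at $Z$. (2) Let $(x,X)$ be a semilocal Noetherian scheme whose set $x$ of closed points is nowhere dense. Then there is a punctual modification $\pi:X^{\rm ptn}\to X$, unique up to a unique isomorphism over $X$, such that $\pi$ is unramified and $\pi$ is the smallest topologically normal punctual modification of $(x,X)$; that is, $\pi$ is topologically normal, and every topologically normal punctual modification $q:W\to X$ factors as $W\to X^{\rm ptn}\xrightarrow{\pi}X$. -/

import Mathlib

open CategoryTheory AlgebraicGeometry TopologicalSpace

universe u

noncomputable section

/-- A morphism of schemes is a universal homeomorphism if every base change of it is a
homeomorphism on underlying topological spaces. -/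
def IsUniversalHomeomorphism {X Y : Scheme.{u}} (f : X ⟶ Y) : Prop :=
  (topologically @IsHomeomorph).universally f

/-- The associated points of a (locally Noetherian) scheme: the points `y` such that the maximal
ideal of the local ring at `y` is an associated prime of that local ring. -/
def associatedPoints (Y : Scheme.{u}) : Set Y :=
  {y | IsLocalRing.maximalIdeal (Y.presheaf.stalk y) ∈
    associatedPrimes (Y.presheaf.stalk y) (Y.presheaf.stalk y)}

/-- The preimage of a closed subset under a morphism of schemes. -/
def closedPreimage {X Y : Scheme.{u}} (p : Y ⟶ X) (Z : Closeds X) : Closeds Y :=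
  Z.preimage p.continuous

/-- `p : Y ⟶ X` is a finite modification of `X` centered at `Z`: it is finite, no associated point
of `Y` lies over `Z`, and it is an isomorphism over `X ∖ Z`. The notion depends only on the
underlying closed set of a closed subscheme `Z`, which is always taken nowhere dense below. -/
structure IsFiniteModification {X Y : Scheme.{u}} (p : Y ⟶ X) (Z : Closeds X) : Prop where
  isFinite : IsFinite p
  not_mem_of_associated : ∀ y ∈ associatedPoints Y, y ∉ closedPreimage p Z
  isIso_compl : IsIso (p ∣_ Z.compl)

/-- `p : Y ⟶ X` is a finite topological modification of `X` centered at `Z`: it is finite, no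
associated point of `Y` lies over `Z`, and it is a universal homeomorphism over `X ∖ Z`. -/
structure IsFiniteTopologicalModification {X Y : Scheme.{u}} (p : Y ⟶ X) (Z : Closeds X) :
    Prop where
  isFinite : IsFinite p
  not_mem_of_associated : ∀ y ∈ associatedPoints Y, y ∉ closedPreimage p Z
  universalHomeomorphism_compl : IsUniversalHomeomorphism (p ∣_ Z.compl)

/-- The pair `Z ⊂ X` is topologically normal: every finite modification of `X` centered at `Z` is
a universal homeomorphism. -/
def IsTopologicallyNormalPair (X : Scheme.{u}) (Z : Closeds X) : Prop :=
  ∀ (Y : Scheme.{u}) (p : Y ⟶ X), IsFiniteModification p Z → IsUniversalHomeomorphism p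

/-- A semilocal scheme: an affine scheme with finitely many closed points, that is, the spectrum
of a ring with finitely many maximal ideals. -/
structure IsSemilocalScheme (X : Scheme.{u}) : Prop where
  isAffine : IsAffine X
  finite_closedPoints : (closedPoints X).Finite

/-- The closed subset of a semilocal scheme consisting of all its closed points. -/
def IsSemilocalScheme.center {X : Scheme.{u}} (hX : IsSemilocalScheme X) : Closeds X where
  carrier := closedPoints X
  isClosed' := by
    rw [← Set.biUnion_of_singleton (closedPoints X)]
    exact hX.finite_closedPoints.isClosed_biUnion fun x hx => hx

/-- A punctual modification of a semilocal scheme: a finite modification centered at the set of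
closed points. -/
def IsPunctualModification {X Y : Scheme.{u}} (hX : IsSemilocalScheme X) (p : Y ⟶ X) : Prop :=
  IsFiniteModification p hX.center

/-- `p : Y ⟶ X` is a punctual modification of the semilocal scheme `X` for which the pair
`p⁻¹(x) ⊂ Y` is topologically normal, where `x` is the set of closed points of `X`. -/
structure IsTopologicallyNormalPunctualModification {X Y : Scheme.{u}}
    (hX : IsSemilocalScheme X) (p : Y ⟶ X) : Prop where
  isPunctualModification : IsPunctualModification hX p
  isTopologicallyNormalPair : IsTopologicallyNormalPair Y (closedPreimage p hX.center)

/-- `p : Y ⟶ X` is the smallest topologically normal punctual modification of `X`: it is one, and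
every other one factors through it over `X`. -/
structure IsSmallestTopologicallyNormalPunctualModification {X Y : Scheme.{u}}
    (hX : IsSemilocalScheme X) (p : Y ⟶ X) : Prop where
  isTopologicallyNormal : IsTopologicallyNormalPunctualModification hX p
  exists_factor : ∀ (W : Scheme.{u}) (q : W ⟶ X),
    IsTopologicallyNormalPunctualModification hX q → ∃ h : W ⟶ Y, h ≫ p = q

end

/-! The argument has two independent halves, one for each part of the theorem.

Factorization of topological modifications. Let `I` be the ideal of `Z`. Over an affine open of `X`
consider the pairs `(t, b)`, where `t` is a section of `X` off `Z`, `b` is a section of `Y`, the two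
agree over `Y` off the preimage of `Z`, and `I ^ N` carries `t` into sections of `X`. The algebra
generated by these pairs is finite (`finite_patchSubring`) and compatible with localization
(`coequifibered_toPatchFunctor`), so it has a relative spectrum `X'` (`exists_patchScheme`), through
which `g` factors and which agrees with `X` off `Z`. For large `N` its image in the sections of `Y`
consists of all sections whose restriction to the complement of the centre descends to `X`. Since
`g` is a universal homeomorphism over that complement, idempotents in étale localizations descend
there, so the image contains the étale idempotents of the sections of `Y`
(`Subalgebra.containsEtaleIdempotents_of_isHomeomorph`), and an extension with this property is
radicial (`Subalgebra.ContainsEtaleIdempotents.isRadicial`). Together with nilpotency of the kernel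
this makes `Y ⟶ X'` integral, surjective and universally injective, that is, a universal
homeomorphism.

The smallest topologically normal modification. The lengths of the closed fibres of all modifications
of a semilocal Noetherian ring are bounded (`exists_length_quotient_le`). An unramified modification
`S` whose closed fibre has maximal length is not enlarged by a further unramified modification
(`exists_maximal_unramified`). A Newton iteration shows that every finite
modification of such an `S` is radicial (`isRadicial_of_forall_surjective`), hence a universal
homeomorphism. If `W` is any topologically normal modification, the compositum of `S` and `W` is a
modification of `W` that is both radicial and unramified, so it is trivial
(`RingHom.IsRadicial.surjective`), which gives the factorization through `S`
(`exists_smallest_modification`). Morphisms between modifications are determined off the centre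
because the centre contains no associated point (`IsFiniteModification.hom_ext`); this yields
uniqueness. -/


/-! ### Modifications of rings -/

section RingModifications

open Polynomial

/-- A ring homomorphism is radicial if homomorphisms from its target to a field are determined by
their restriction to the source. -/
def RingHom.IsRadicial {R S : Type u} [CommRing R] [CommRing S] (φ : R →+* S) : Prop :=
  ∀ (K : Type u) [Field K] (f g : S →+* K), f.comp φ = g.comp φ → f = g

/-- The ring-theoretic form of a finite modification of `Spec R` centered at `V(I)`: the
homomorphism is finite, its target has no `I`-torsion, and its kernel and cokernel are killed by
powers of `I`. -/
structure RingHom.IsModification {R S : Type u} [CommRing R] [CommRing S] (I : Ideal R)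
    (φ : R →+* S) : Prop where
  finite : φ.Finite
  eq_zero_of_mul : ∀ s : S, (∀ i ∈ I, φ i * s = 0) → s = 0
  exists_mul_mem_range : ∃ N, ∀ x ∈ I ^ N, ∀ s, φ x * s ∈ φ.range
  exists_mul_eq_zero : ∀ r, φ r = 0 → ∃ N, ∀ x ∈ I ^ N, x * r = 0

/-- The zero locus of `J` is the set of closed points of `Spec R`. In a Noetherian ring such an
ideal exists exactly if the ring is semilocal. -/
def Ideal.DefinesClosedPoints {R : Type u} [CommRing R] (J : Ideal R) : Prop :=
  ∀ p : Ideal R, p.IsPrime → (J ≤ p ↔ p.IsMaximal)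

variable {R S : Type u} [CommRing R] [CommRing S] [Algebra R S]

theorem Ideal.DefinesClosedPoints.map [Algebra.IsIntegral R S] {J : Ideal R}
    (hJ : J.DefinesClosedPoints) : (J.map (algebraMap R S)).DefinesClosedPoints := by
  intro P hP
  rw [Ideal.map_le_iff_le_comap, hJ _ (hP.comap _)]
  exact ⟨fun h => Ideal.isMaximal_of_isIntegral_of_isMaximal_comap P h,
    fun h => Ideal.isMaximal_comap_of_isIntegral_of_isMaximal P⟩

theorem Ideal.DefinesClosedPoints.finite_maximalSpectrum [IsNoetherianRing R] {J : Ideal R}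
    (hJ : J.DefinesClosedPoints) : Finite (MaximalSpectrum R) := by
  have hfin : J.minimalPrimes.Finite := Ideal.finite_minimalPrimes_of_isNoetherianRing R J
  have := hfin.to_subtype
  refine Finite.of_injective
    (fun m : MaximalSpectrum R => (⟨m.asIdeal, ?_⟩ : J.minimalPrimes)) ?_
  · refine ⟨⟨m.isMaximal.isPrime, (hJ _ m.isMaximal.isPrime).2 m.isMaximal⟩, ?_⟩
    rintro q ⟨hq, hJq⟩ hqm
    exact (((hJ q hq).1 hJq).eq_of_le m.isMaximal.ne_top hqm).ge
  · intro a b h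
    exact MaximalSpectrum.ext (congrArg Subtype.val h)

theorem Ideal.DefinesClosedPoints.jacobson_le_radical {J : Ideal R}
    (hJ : J.DefinesClosedPoints) : Ring.jacobson R ≤ J.radical := by
  rw [Ideal.radical_eq_sInf]
  refine le_sInf ?_
  rintro p ⟨hJp, hp⟩
  have : p.IsMaximal := (hJ p hp).1 hJp
  exact Ring.jacobson_le_of_isMaximal p

theorem Ideal.DefinesClosedPoints.le_jacobson {J : Ideal R}
    (hJ : J.DefinesClosedPoints) : J ≤ Ring.jacobson R := by
  rw [Ring.jacobson_eq_sInf_isMaximal]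
  exact le_sInf fun m (hm : m.IsMaximal) => (hJ m hm.isPrime).2 hm

theorem mem_jacobson_iff_forall_maximal {x : R} :
    x ∈ Ring.jacobson R ↔ ∀ m : Ideal R, m.IsMaximal → x ∈ m := by
  rw [Ring.jacobson_eq_sInf_isMaximal, Submodule.mem_sInf]; rfl

theorem isUnit_iff_forall_maximal {x : R} :
    IsUnit x ↔ ∀ m : Ideal R, m.IsMaximal → x ∉ m := by
  refine ⟨fun h m hm hx => hm.ne_top (Ideal.eq_top_of_isUnit_mem _ hx h), fun h => ?_⟩
  by_contra hx
  obtain ⟨m, hm, hxm⟩ := exists_max_ideal_of_mem_nonunits hx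
  exact h m hm hxm

/-- An algebra generated by a simple root of a polynomial is unramified. -/
theorem formallyUnramified_adjoin_singleton [Algebra.IsIntegral R S] {b : S} (f : R[X])
    (hf : aeval b f = 0) (hf' : IsUnit (aeval b (derivative f))) :
    Algebra.FormallyUnramified R (Algebra.adjoin R {b}) := by
  have hbmem : b ∈ Algebra.adjoin R {b} := Algebra.self_mem_adjoin_singleton R b
  set β : Algebra.adjoin R {b} := ⟨b, hbmem⟩ with hβ
  have hval : ∀ p : R[X], (algebraMap (Algebra.adjoin R {b}) S) (aeval β p) = aeval b p := by
    intro p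
    rw [← aeval_algebraMap_apply]; rfl
  have hgen : Algebra.adjoin R {β} = ⊤ := by
    have := Algebra.adjoin_adjoin_coe_preimage (R := R) (s := ({b} : Set S))
    convert this using 2
    ext x
    simp [hβ, Subtype.ext_iff]
  have h0 : aeval β f = 0 := by
    apply Subtype.val_injective
    exact (hval f).trans hf
  have h1 : IsUnit (aeval β (derivative f)) := by
    have : Algebra.IsIntegral (Algebra.adjoin R {b}) S := Algebra.IsIntegral.tower_top R
    have : IsLocalHom (algebraMap (Algebra.adjoin R {b}) S) :=
      Algebra.IsIntegral.isLocalHom _ _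
    rw [← hval] at hf'
    exact isUnit_of_map_unit _ _ hf'
  rw [Algebra.FormallyUnramified.iff_comp_injective]
  intro B _ _ I hI g₁ g₂ hg
  refine AlgHom.ext_of_adjoin_eq_top hgen ?_
  rintro x rfl
  have hd : g₁ β - g₂ β ∈ I := by
    rw [← Ideal.Quotient.eq]
    exact DFunLike.congr_fun hg β
  have hsq : (g₁ β - g₂ β) ^ 2 = 0 := by
    have := Ideal.pow_mem_pow hd 2
    rwa [hI, Ideal.mem_bot] at this
  have h3 := aeval_add_of_sq_eq_zero f (g₂ β) (g₁ β - g₂ β) hsq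
  rw [add_sub_cancel, aeval_algHom_apply, aeval_algHom_apply, aeval_algHom_apply, h0, map_zero,
    map_zero, zero_add] at h3
  have := (h1.map g₂).mul_right_eq_zero.1 h3.symm
  exact sub_eq_zero.1 this

/-- Newton iteration over a semilocal base: an approximate simple root modulo the Jacobson radical
lifts to a simple root modulo any power of `J`. -/
theorem exists_root_mod_pow [IsNoetherianRing R] [Module.Finite R S] {J : Ideal R}
    (hJ : J.DefinesClosedPoints) (f : R[X]) (b₀ : S) (h₀ : aeval b₀ f ∈ Ring.jacobson S)
    (h₁ : IsUnit (aeval b₀ (derivative f))) (N : ℕ) :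
    ∃ b : S, b - b₀ ∈ Ring.jacobson S ∧ aeval b f ∈ (J.map (algebraMap R S)) ^ N ∧
      IsUnit (aeval b (derivative f)) := by
  have hJS := hJ.map (S := S)
  have : IsNoetherianRing S := IsNoetherianRing.of_finite R S
  set 𝔞 := (J.map (algebraMap R S)) ^ N with h𝔞
  have hrad : Ring.jacobson S ≤ 𝔞.radical := by
    refine hJS.jacobson_le_radical.trans ?_
    rw [h𝔞]
    rcases Nat.eq_zero_or_pos N with rfl | hN
    · simp [Ideal.radical_top]
    · rw [Ideal.radical_pow _ hN.ne']
  let π := IsScalarTower.toAlgHom R S (S ⧸ 𝔞)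
  have hπ : ∀ x, π x = Ideal.Quotient.mk 𝔞 x := fun x => rfl
  have hnil : IsNilpotent (aeval (π b₀) f) := by
    obtain ⟨k, hk⟩ := hrad h₀
    refine ⟨k, ?_⟩
    rw [aeval_algHom_apply, ← map_pow, hπ]
    exact Ideal.Quotient.eq_zero_iff_mem.2 hk
  have hunit : IsUnit (aeval (π b₀) (derivative f)) := by
    rw [aeval_algHom_apply]
    exact h₁.map π
  obtain ⟨r, ⟨hr, hr0⟩, -⟩ := existsUnique_nilpotent_sub_and_aeval_eq_zero hnil hunit
  obtain ⟨c, rfl⟩ : ∃ c, π c = r := Ideal.Quotient.mk_surjective r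
  by_cases hN : N = 0
  · exact ⟨b₀, by simp, by simp [h𝔞, hN], h₁⟩
  have hcb : c - b₀ ∈ Ring.jacobson S := by
    rw [mem_jacobson_iff_forall_maximal]
    intro m hm
    obtain ⟨k, hk⟩ := hr
    rw [← map_sub, ← map_pow, hπ, Ideal.Quotient.eq_zero_iff_mem] at hk
    have h2 : 𝔞 ≤ m := (Ideal.pow_le_self hN).trans ((hJS m hm.isPrime).2 hm)
    have := hm.isPrime.mem_of_pow_mem _ (h2 hk)
    rw [← neg_sub]
    exact m.neg_mem this
  refine ⟨c, hcb, ?_, ?_⟩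
  · rw [aeval_algHom_apply, hπ, Ideal.Quotient.eq_zero_iff_mem] at hr0
    exact hr0
  · rw [isUnit_iff_forall_maximal] at h₁ ⊢
    intro m hm hmem
    refine h₁ m hm ?_
    have h3 : aeval c (derivative f) - aeval b₀ (derivative f) ∈ m := by
      have h4 : c - b₀ ∣ aeval c (derivative f) - aeval b₀ (derivative f) := by
        rw [aeval_def, aeval_def, ← Polynomial.eval_map, ← Polynomial.eval_map]
        exact sub_dvd_eval_sub _ _ _
      exact Ideal.mem_of_dvd _ h4 (mem_jacobson_iff_forall_maximal.1 hcb m hm)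
    simpa using m.sub_mem hmem h3


theorem Ideal.Quotient.aeval_mk_eq_zero_iff {n : Ideal S} {b : S} {p : R[X]} :
    aeval (Ideal.Quotient.mk n b) p = 0 ↔ aeval b p ∈ n := by
  rw [← Ideal.Quotient.eq_zero_iff_mem]
  have := aeval_algHom_apply (IsScalarTower.toAlgHom R S (S ⧸ n)) b p
  exact iff_of_eq (congrArg (· = 0) this)

theorem Ideal.mem_range_of_mem_map {I : Ideal R}
    (hI : ∀ x ∈ I, ∀ s : S, algebraMap R S x * s ∈ (algebraMap R S).range) {y : S}
    (hy : y ∈ I.map (algebraMap R S)) : y ∈ (algebraMap R S).range := by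
  suffices h : ∀ s, s * y ∈ (algebraMap R S).range by simpa using h 1
  induction hy using Submodule.span_induction with
  | mem x hx =>
    obtain ⟨i, hi, rfl⟩ := hx
    intro s
    rw [mul_comm]
    exact hI i hi s
  | zero => intro s; simp [zero_mem]
  | add x y _ _ hx hy => intro s; rw [mul_add]; exact add_mem (hx s) (hy s)
  | smul a x _ hx => intro s; rw [smul_eq_mul, ← mul_assoc]; exact hx _

/-- A simple nonzero root `a` of a polynomial in the residue field at one closed point `n`, extended
by zero to the other closed points, lifts to an element generating an unramified modification. -/
theorem exists_formallyUnramified_adjoin [IsNoetherianRing R] {J : Ideal R}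
    (hJ : J.DefinesClosedPoints) (hS : (algebraMap R S).IsModification J) {n : Ideal S}
    (hn : n.IsMaximal) (a : S) (ha : a ∉ n) (g₀ : R[X]) (hg₀ : aeval a g₀ ∈ n)
    (hg₀' : aeval a (derivative g₀) ∉ n)
    (hg₀0 : g₀.coeff 0 ∉ n.comap (algebraMap R S)) :
    ∃ b : S, Algebra.FormallyUnramified R (Algebra.adjoin R {b}) ∧ b - a ∈ n ∧
      ∀ n' : Ideal S, n'.IsMaximal → n' ≠ n → b ∈ n' := by
  classical
  have : Module.Finite R S := RingHom.finite_algebraMap.1 hS.finite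
  have : IsNoetherianRing S := IsNoetherianRing.of_finite R S
  have := hJ.finite_maximalSpectrum
  have := (hJ.map (S := S)).finite_maximalSpectrum
  set m := n.comap (algebraMap R S) with hm
  have hmmax : m.IsMaximal := Ideal.isMaximal_comap_of_isIntegral_of_isMaximal n
  have cop : ∀ (A : Type u) [CommRing A], Pairwise (Function.onFun IsCoprime
      (fun i : MaximalSpectrum A => i.asIdeal)) := by
    intro A _ i j hij
    exact Ideal.isCoprime_of_isMaximal (fun h => hij (MaximalSpectrum.ext h))
  -- a constant `c` vanishing at `m` that makes the constant term of `g₀ + c` a unit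
  obtain ⟨c, hc⟩ := Ideal.exists_forall_sub_mem_ideal (cop R)
    (fun i => if i.asIdeal = m then 0 else 1 - g₀.coeff 0)
  have hcm : c ∈ m := by simpa using hc ⟨m, hmmax⟩
  have hunit : IsUnit (g₀.coeff 0 + c) := by
    rw [isUnit_iff_forall_maximal]
    intro m' hm' hmem
    by_cases h : m' = m
    · rw [h] at hmem
      exact hg₀0 (by simpa using m.sub_mem hmem hcm)
    · have h1 := hc ⟨m', hm'⟩
      simp only [h, if_false] at h1
      refine hm'.ne_top ((Ideal.eq_top_iff_one _).2 ?_)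
      have := m'.sub_mem hmem h1
      ring_nf at this
      exact this
  obtain ⟨b₀, hb₀⟩ := Ideal.exists_forall_sub_mem_ideal (cop S)
    (fun i => if i.asIdeal = n then a else 0)
  have hb₀n : b₀ - a ∈ n := by simpa using hb₀ ⟨n, hn⟩
  have hb₀n' : ∀ n' : Ideal S, n'.IsMaximal → n' ≠ n → b₀ ∈ n' := by
    intro n' hn' hne
    simpa [hne] using hb₀ ⟨n', hn'⟩
  set f : R[X] := X * (g₀ + C c) with hf
  have hmk : Ideal.Quotient.mk n b₀ = Ideal.Quotient.mk n a := Ideal.Quotient.eq.2 hb₀n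
  have hgn : aeval b₀ (g₀ + C c) ∈ n := by
    rw [← Ideal.Quotient.aeval_mk_eq_zero_iff, hmk, Ideal.Quotient.aeval_mk_eq_zero_iff]
    simpa using n.add_mem hg₀ hcm
  have h₀ : aeval b₀ f ∈ Ring.jacobson S := by
    rw [mem_jacobson_iff_forall_maximal]
    intro n' hn'
    rw [hf, map_mul, aeval_X]
    by_cases h : n' = n
    · subst h; exact n'.mul_mem_left _ hgn
    · exact n'.mul_mem_right _ (hb₀n' n' hn' h)
  have hfd : aeval b₀ (derivative f) = aeval b₀ (g₀ + C c) + b₀ * aeval b₀ (derivative g₀) := by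
    simp [hf]
  have h₁ : IsUnit (aeval b₀ (derivative f)) := by
    rw [isUnit_iff_forall_maximal]
    intro n' hn' hmem
    rw [hfd] at hmem
    by_cases h : n' = n
    · subst h
      rcases hn'.isPrime.mem_or_mem ((n'.add_mem_iff_right hgn).1 hmem) with h1 | h1
      · exact ha (by simpa using n'.sub_mem h1 hb₀n)
      · rw [← Ideal.Quotient.aeval_mk_eq_zero_iff, hmk,
          Ideal.Quotient.aeval_mk_eq_zero_iff] at h1
        exact hg₀' h1
    · have hb := hb₀n' n' hn' h
      have h1 := (n'.add_mem_iff_left (n'.mul_mem_right _ hb)).1 hmem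
      rw [← Ideal.Quotient.aeval_mk_eq_zero_iff, Ideal.Quotient.eq_zero_iff_mem.2 hb,
        ← coeff_zero_eq_aeval_zero'] at h1
      rw [coeff_add, coeff_C_zero] at h1
      exact ((hunit.map (algebraMap R (S ⧸ n'))).ne_zero) h1
  obtain ⟨N, hN⟩ := hS.exists_mul_mem_range
  obtain ⟨b, hbb, hbf, hbu⟩ := exists_root_mod_pow hJ f b₀ h₀ h₁ N
  -- `J ^ N S` is contained in the image of `R`, so `f` can be corrected by a constant
  obtain ⟨j, hj⟩ : ∃ j : R, algebraMap R S j = aeval b f := by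
    rw [← Ideal.map_pow] at hbf
    exact Ideal.mem_range_of_mem_map hN hbf
  refine ⟨b, formallyUnramified_adjoin_singleton (f - C j) (by simp [hj]) (by simpa using hbu),
    ?_, ?_⟩
  · have := mem_jacobson_iff_forall_maximal.1 hbb n hn
    simpa using n.add_mem this hb₀n
  · intro n' hn' hne
    have := mem_jacobson_iff_forall_maximal.1 hbb n' hn'
    simpa using n'.add_mem this (hb₀n' n' hn' hne)

theorem RingHom.IsModification.algebraMap_subalgebra [IsNoetherianRing R] {J : Ideal R}
    (hS : (algebraMap R S).IsModification J) (T : Subalgebra R S) :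
    (algebraMap R T).IsModification J := by
  have : Module.Finite R S := RingHom.finite_algebraMap.1 hS.finite
  have : Module.Finite R T := Module.Finite.of_injective T.val.toLinearMap Subtype.val_injective
  refine ⟨RingHom.finite_algebraMap.2 this, fun s hs => ?_, ?_, fun r hr => ?_⟩
  · apply Subtype.val_injective
    exact hS.eq_zero_of_mul _ fun i hi => congrArg Subtype.val (hs i hi)
  · obtain ⟨N, hN⟩ := hS.exists_mul_mem_range
    refine ⟨N, fun x hx s => ?_⟩
    obtain ⟨r, hr⟩ := hN x hx s
    exact ⟨r, Subtype.val_injective hr⟩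
  · exact hS.exists_mul_eq_zero r (congrArg Subtype.val hr)

/-- If no unramified modification enlarges `R`, then a nonzero simple root in the residue field of
a closed point of a modification comes from `R`. -/
theorem exists_sub_mem_of_simple_root [IsNoetherianRing R] {J : Ideal R}
    (hJ : J.DefinesClosedPoints)
    (hR : ∀ (T : Type u) [CommRing T] [Algebra R T], (algebraMap R T).IsModification J →
      Algebra.FormallyUnramified R T → Function.Surjective (algebraMap R T))
    (hS : (algebraMap R S).IsModification J) {n : Ideal S}
    (hn : n.IsMaximal) (a : S) (ha : a ∉ n) (g₀ : R[X]) (hg₀ : aeval a g₀ ∈ n)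
    (hg₀' : aeval a (derivative g₀) ∉ n)
    (hg₀0 : g₀.coeff 0 ∉ n.comap (algebraMap R S)) :
    ∃ r : R, algebraMap R S r - a ∈ n ∧
      ∀ n' : Ideal S, n'.IsMaximal → n' ≠ n → algebraMap R S r ∈ n' := by
  obtain ⟨b, hb, h⟩ := exists_formallyUnramified_adjoin hJ hS hn a ha g₀ hg₀ hg₀' hg₀0
  obtain ⟨r, hr⟩ := hR _ (hS.algebraMap_subalgebra _) hb
    ⟨b, Algebra.self_mem_adjoin_singleton R b⟩
  have : algebraMap R S r = b := congrArg Subtype.val hr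
  exact ⟨r, this ▸ h⟩

/-- If no unramified modification enlarges `R`, then every modification of `R` is radicial. -/
theorem isRadicial_of_forall_surjective [IsNoetherianRing R] {J : Ideal R}
    (hJ : J.DefinesClosedPoints)
    (hR : ∀ (T : Type u) [CommRing T] [Algebra R T], (algebraMap R T).IsModification J →
      Algebra.FormallyUnramified R T → Function.Surjective (algebraMap R T))
    (hS : (algebraMap R S).IsModification J) : (algebraMap R S).IsRadicial := by
  have hfin : Module.Finite R S := RingHom.finite_algebraMap.1 hS.finite
  intro K _ φ ψ h
  have hr : ∀ r, φ (algebraMap R S r) = ψ (algebraMap R S r) := RingHom.congr_fun h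
  by_cases hJK : J ≤ RingHom.ker (φ.comp (algebraMap R S))
  swap
  · -- off the closed points the modification is an isomorphism
    obtain ⟨x, hxJ, hx⟩ := SetLike.not_le_iff_exists.1 hJK
    obtain ⟨N, hN⟩ := hS.exists_mul_mem_range
    ext s
    obtain ⟨r, h1⟩ := hN _ (Ideal.pow_mem_pow hxJ N) s
    have h2 := hr r
    rw [h1, map_mul, map_mul, ← hr] at h2
    refine mul_left_cancel₀ ?_ h2
    rw [map_pow, map_pow]
    exact pow_ne_zero _ hx
  have hmax : ∀ χ : S →+* K, χ.comp (algebraMap R S) = φ.comp (algebraMap R S) →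
      (RingHom.ker χ).IsMaximal := by
    intro χ hχ
    have hp : (RingHom.ker χ).IsPrime := RingHom.ker_isPrime χ
    rw [← hJ.map (S := S) _ hp, Ideal.map_le_iff_le_comap, RingHom.comap_ker, hχ]
    exact hJK
  have hφ := hmax φ rfl
  have hψ := hmax ψ h.symm
  -- the two closed points agree: otherwise `1` at one of them extended by zero comes from `R`
  have hker : RingHom.ker φ = RingHom.ker ψ := by
    by_contra hne
    obtain ⟨r, hr1, hr2⟩ := exists_sub_mem_of_simple_root hJ hR hS hφ 1
      ((Ideal.ne_top_iff_one _).1 hφ.ne_top) (X - 1) (by simp) (by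
        simp) (by
        rw [coeff_sub, coeff_X_zero, coeff_one_zero, zero_sub, neg_mem_iff, Ideal.mem_comap, map_one]
        exact (Ideal.ne_top_iff_one _).1 hφ.ne_top)
    have h1 := hr2 _ hψ (Ne.symm hne)
    rw [RingHom.mem_ker, ← hr] at h1
    rw [RingHom.mem_ker, map_sub, h1, map_one, zero_sub, neg_eq_zero] at hr1
    exact one_ne_zero hr1
  -- the residue field extension is purely inseparable
  set n := RingHom.ker φ with hn
  set m := n.comap (algebraMap R S) with hm
  have hmmax : m.IsMaximal := Ideal.isMaximal_comap_of_isIntegral_of_isMaximal n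
  have hover : n.LiesOver m := ⟨rfl⟩
  let _ : Field (R ⧸ m) := Ideal.Quotient.field m
  let _ : Field (S ⧸ n) := Ideal.Quotient.field n
  have hpi : IsPurelyInseparable (R ⧸ m) (S ⧸ n) := by
    rw [isPurelyInseparable_iff]
    intro α
    have hint : IsIntegral (R ⧸ m) α := by
      have : Algebra.IsIntegral (R ⧸ m) (S ⧸ n) := Algebra.IsIntegral.tower_top R
      exact Algebra.IsIntegral.isIntegral α
    refine ⟨hint, fun hsep => ?_⟩
    by_cases hα : α = 0
    · rw [hα]; exact zero_mem _
    obtain ⟨a, rfl⟩ := Ideal.Quotient.mk_surjective α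
    obtain ⟨g, hg⟩ := Polynomial.map_surjective (algebraMap R (R ⧸ m))
      Ideal.Quotient.mk_surjective (minpoly (R ⧸ m) (Ideal.Quotient.mk n a))
    obtain ⟨r, hr1, -⟩ := exists_sub_mem_of_simple_root hJ hR hS hφ a
      (fun h => hα (Ideal.Quotient.eq_zero_iff_mem.2 h)) g (by
        rw [← Ideal.Quotient.aeval_mk_eq_zero_iff, ← aeval_map_algebraMap (R ⧸ m), hg]
        exact minpoly.aeval _ _) (by
        rw [← Ideal.Quotient.aeval_mk_eq_zero_iff, ← aeval_map_algebraMap (R ⧸ m),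
          ← derivative_map, hg]
        exact Separable.aeval_derivative_ne_zero hsep (minpoly.aeval _ _)) (by
        intro h0
        apply minpoly.coeff_zero_ne_zero hint hα
        rw [← hg, coeff_map]
        exact Ideal.Quotient.eq_zero_iff_mem.2 h0)
    exact ⟨Ideal.Quotient.mk m r, Ideal.Quotient.eq.2 hr1⟩
  have key := IsPurelyInseparable.injective_comp_algebraMap (R ⧸ m) (S ⧸ n) K
    (a₁ := Ideal.Quotient.lift n φ fun _ h => h)
    (a₂ := Ideal.Quotient.lift n ψ fun _ h => (hker.le h :)) (by
      apply Ideal.Quotient.ringHom_ext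
      ext r
      exact hr r)
  ext s
  exact RingHom.congr_fun key (Ideal.Quotient.mk n s)

end RingModifications

/-! ### A bound for the closed fibres of modifications -/

section Length

variable {R : Type u} [CommRing R]

/-- A finite module killed by a power of an ideal defining the closed points has finite length. -/
theorem Ideal.DefinesClosedPoints.length_ne_top [IsNoetherianRing R] {J : Ideal R}
    (hJ : J.DefinesClosedPoints) {M : Type u} [AddCommGroup M] [Module R M] [Module.Finite R M]
    (N : ℕ) (hM : ∀ x ∈ J ^ N, ∀ y : M, x • y = 0) : Module.length R M ≠ ⊤ := by
  have h1 : IsArtinianRing (R ⧸ J ^ N) := by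
    rw [isArtinianRing_iff_isNoetherianRing_krullDimLE_zero]
    refine ⟨inferInstance, ?_⟩
    rw [Ring.krullDimLE_zero_iff]
    intro P hP
    refine Ideal.isMaximal_of_isIntegral_of_isMaximal_comap (R := R) P ?_
    rw [← hJ _ (hP.comap _)]
    refine (hP.comap _).le_of_pow_le (n := N) fun x hx => ?_
    rw [Ideal.mem_comap, Ideal.Quotient.algebraMap_eq, Ideal.Quotient.eq_zero_iff_mem.2 hx]
    exact P.zero_mem
  let : Module (R ⧸ J ^ N) M := Module.IsTorsionBySet.module (I := J ^ N)
    (fun y x => hM x.1 x.2 y)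
  have : IsScalarTower R (R ⧸ J ^ N) M := ⟨fun a b y => by
    obtain ⟨b, rfl⟩ := Ideal.Quotient.mk_surjective b
    rw [Algebra.smul_def, Ideal.Quotient.algebraMap_eq, ← map_mul]
    exact mul_smul a b y⟩
  have : Module.Finite (R ⧸ J ^ N) M := Module.Finite.of_restrictScalars_finite R _ M
  rw [Module.length_eq_of_surjective (S := R) (R := R ⧸ J ^ N) Ideal.Quotient.mk_surjective]
  exact Module.length_ne_top


/-- For an endomorphism of a module of finite length, kernel and cokernel have the same length. -/
theorem LinearMap.length_ker_eq_length_quotient_range {M : Type u} [AddCommGroup M] [Module R M]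
    (hM : Module.length R M ≠ ⊤) (f : M →ₗ[R] M) :
    Module.length R (LinearMap.ker f) = Module.length R (M ⧸ LinearMap.range f) := by
  have h1 := Module.length_eq_add_of_exact (LinearMap.ker f).subtype f.rangeRestrict
    (Submodule.subtype_injective _) f.surjective_rangeRestrict
    (by rw [LinearMap.exact_iff]; simp)
  have h2 := Module.length_eq_add_of_exact (LinearMap.range f).subtype (LinearMap.range f).mkQ
    (Submodule.subtype_injective _) (Submodule.mkQ_surjective _)
    (LinearMap.exact_subtype_mkQ _)
  rw [h1, add_comm] at h2
  refine ENat.add_right_injective_of_ne_top (fun h => hM ?_) h2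
  rw [h1, h, add_top]

/-- Let `Q → M` be an injection of modules whose cokernel `C` has finite length, and let `t` be a
nonzerodivisor on `M`. The `t`-torsion of `C` embeds into `Q / tQ`, and its image is killed by
whatever kills `C`; hence the length of `C / tC` is bounded in terms of `Q` alone. -/
theorem length_quotient_smul_le {Q M : Type u} [AddCommGroup Q] [Module R Q] [AddCommGroup M]
    [Module R M] (i : Q →ₗ[R] M) (hi : Function.Injective i) (t : R)
    (ht : ∀ x : M, t • x = 0 → x = 0) (I : Ideal R)
    (hI : ∀ a ∈ I, ∀ x : M, a • x ∈ LinearMap.range i)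
    (hC : Module.length R (M ⧸ LinearMap.range i) ≠ ⊤)
    (G : Submodule R (Q ⧸ LinearMap.range (LinearMap.lsmul R Q t)))
    (hG : ∀ y, (∀ a ∈ I, a • y = 0) → y ∈ G) :
    Module.length R ((M ⧸ LinearMap.range i) ⧸
      LinearMap.range (LinearMap.lsmul R (M ⧸ LinearMap.range i) t)) ≤ Module.length R G := by
  rw [← LinearMap.length_ker_eq_length_quotient_range hC]
  set P := LinearMap.range i with hP
  set D : Submodule R M := P.comap (LinearMap.lsmul R M t) with hD
  have hPM : ∀ x : D, t • (x : M) ∈ P := fun x => x.2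
  let e : P ≃ₗ[R] Q := (LinearEquiv.ofInjective i hi).symm
  have he : ∀ x : P, i (e x) = x := fun x =>
    congrArg Subtype.val ((LinearEquiv.ofInjective i hi).apply_symm_apply x)
  let f₀ : D →ₗ[R] P := ((LinearMap.lsmul R M t).comp D.subtype).codRestrict P hPM
  let f₂ : D →ₗ[R] Q ⧸ LinearMap.range (LinearMap.lsmul R Q t) :=
    (Submodule.mkQ _).comp (e.toLinearMap.comp f₀)
  let f₁ : D →ₗ[R] LinearMap.ker (LinearMap.lsmul R (M ⧸ P) t) :=
    (P.mkQ.comp D.subtype).codRestrict _ (fun x => by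
      rw [LinearMap.mem_ker]
      change t • P.mkQ (x : M) = 0
      rw [← map_smul, Submodule.mkQ_apply, Submodule.Quotient.mk_eq_zero]
      exact hPM x)
  have hf₁ : Function.Surjective f₁ := by
    rintro ⟨y, hy⟩
    obtain ⟨x, rfl⟩ := Submodule.mkQ_surjective P y
    refine ⟨⟨x, ?_⟩, rfl⟩
    rw [LinearMap.mem_ker] at hy
    change t • P.mkQ x = 0 at hy
    rw [← map_smul, Submodule.mkQ_apply, Submodule.Quotient.mk_eq_zero] at hy
    exact hy
  have hker : LinearMap.ker f₁ = LinearMap.ker f₂ := by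
    ext x
    have h1 : f₁ x = 0 ↔ (x : M) ∈ P := by
      rw [Subtype.ext_iff]
      exact Submodule.Quotient.mk_eq_zero P
    have h2 : f₂ x = 0 ↔ e (f₀ x) ∈ LinearMap.range (LinearMap.lsmul R Q t) :=
      Submodule.Quotient.mk_eq_zero _
    rw [LinearMap.mem_ker, LinearMap.mem_ker, h1, h2]
    constructor
    · rintro ⟨q, hq⟩
      refine ⟨q, hi ?_⟩
      rw [he, LinearMap.lsmul_apply, map_smul, hq]
      rfl
    · rintro ⟨q, hq⟩
      refine ⟨q, ?_⟩
      have h3 : i (t • q) = t • (x : M) := (congrArg i hq).trans (he _)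
      rw [map_smul] at h3
      exact sub_eq_zero.1 (ht _ (by rw [smul_sub, h3, sub_self]))
  have hle : LinearMap.range f₂ ≤ G := by
    rintro _ ⟨x, rfl⟩
    refine hG _ fun a ha => ?_
    obtain ⟨q, hq⟩ := hI a ha x
    rw [← map_smul]
    refine (Submodule.Quotient.mk_eq_zero _).2 ⟨q, hi ?_⟩
    rw [LinearMap.lsmul_apply, map_smul, hq]
    exact (he (f₀ (a • x))).symm
  rw [← (f₁.quotKerEquivOfSurjective hf₁).length_eq,
    (Submodule.quotEquivOfEq _ _ hker).length_eq, f₂.quotKerEquivRange.length_eq]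
  exact Module.length_le_of_injective (Submodule.inclusion hle) (Submodule.inclusion_injective hle)

/-- Some element of `J` is a nonzerodivisor on a finite module without `J`-torsion. -/
theorem exists_mem_smul_eq_zero_imp [IsNoetherianRing R] (J : Ideal R) {Q : Type u}
    [AddCommGroup Q] [Module R Q] [Module.Finite R Q]
    (hQ : ∀ q : Q, (∀ j ∈ J, j • q = 0) → q = 0) : ∃ t ∈ J, ∀ q : Q, t • q = 0 → q = 0 := by
  by_contra! h
  have hsub : (J : Set R) ⊆ ⋃ p ∈ associatedPrimes R Q, p := by
    rw [biUnion_associatedPrimes_eq_zero_divisors]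
    intro t ht
    obtain ⟨q, h1, h2⟩ := h t ht
    exact ⟨q, h2, h1⟩
  obtain ⟨P, hP, hJP⟩ := (J.subset_union_prime_finite (associatedPrimes.finite R Q) (f := id) 0 0
    fun _ h _ _ => h.isPrime).1 hsub
  rw [AssociatedPrimes.mem_iff, isAssociatedPrime_iff] at hP
  obtain ⟨hprime, x, rfl⟩ := hP
  have hx : x = 0 := hQ x fun j hj => by simpa using hJP hj
  subst hx
  exact hprime.ne_top (by ext; simp)

/-- In a Noetherian module the elements killed by some power of `J` are killed by one power. -/
theorem exists_forall_pow_smul_eq_zero (J : Ideal R) (M : Type u) [AddCommGroup M] [Module R M]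
    [IsNoetherian R M] :
    ∃ n : ℕ, ∀ (N : ℕ) (x : M), (∀ a ∈ J ^ N, a • x = 0) → ∀ a ∈ J ^ n, a • x = 0 := by
  obtain ⟨n, hn⟩ := monotone_stabilizes_iff_noetherian.2 ‹IsNoetherian R M›
    ⟨fun N => Submodule.torsionBySet R M (J ^ N : Ideal R),
      fun a b h => Submodule.torsionBySet_le_torsionBySet_pow a b h J⟩
  refine ⟨n, fun N x hx => ?_⟩
  have h1 : x ∈ Submodule.torsionBySet R M (J ^ (max n N) : Ideal R) := by
    refine Submodule.torsionBySet_le_torsionBySet_pow N _ (le_max_right _ _) J ?_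
    rw [Submodule.mem_torsionBySet_iff]
    exact fun a => hx a a.2
  have h2 := hn (max n N) (le_max_left _ _)
  change Submodule.torsionBySet R M (J ^ n : Ideal R) = _ at h2
  have h3 : x ∈ Submodule.torsionBySet R M (J ^ n : Ideal R) := h2 ▸ h1
  rw [Submodule.mem_torsionBySet_iff] at h3
  exact fun a ha => h3 ⟨a, ha⟩

/-- The fibres over the closed points of all modifications of `R` have bounded length. -/
theorem exists_length_quotient_le [IsNoetherianRing R] {J : Ideal R}
    (hJ : J.DefinesClosedPoints) :
    ∃ c : ℕ, ∀ (S : Type u) [CommRing S] [Algebra R S], (algebraMap R S).IsModification J →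
      Module.length R (S ⧸ J.map (algebraMap R S)) ≤ c := by
  obtain ⟨n₀, hn₀⟩ := exists_forall_pow_smul_eq_zero J R
  -- `Q` is the quotient of `R` by its `J`-power torsion, which is the image of `R` in any
  -- modification
  set Γ : Ideal R := Submodule.torsionBySet R R (J ^ n₀ : Ideal R) with hΓ
  have hmemΓ : ∀ x, x ∈ Γ ↔ ∀ a ∈ J ^ n₀, a * x = 0 := by
    intro x; rw [hΓ, Submodule.mem_torsionBySet_iff]; simp
  have hQ : ∀ q : R ⧸ Γ, (∀ j ∈ J, j • q = 0) → q = 0 := by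
    intro q hq
    obtain ⟨x, rfl⟩ := Ideal.Quotient.mk_surjective q
    rw [Ideal.Quotient.eq_zero_iff_mem, hmemΓ]
    refine hn₀ (n₀ + 1) x ?_
    intro a ha
    rw [pow_succ] at ha
    induction ha using Submodule.mul_induction_on' with
    | mem_mul_mem y hy j hj =>
      have h1 : j * x ∈ Γ := Ideal.Quotient.eq_zero_iff_mem.1 (hq j hj)
      rw [smul_eq_mul, mul_assoc]
      exact (hmemΓ _).1 h1 y hy
    | add y _ z _ hy hz => rw [add_smul, hy, hz, add_zero]
  obtain ⟨t, htJ, ht⟩ := exists_mem_smul_eq_zero_imp J hQ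
  set T := (R ⧸ Γ) ⧸ LinearMap.range (LinearMap.lsmul R (R ⧸ Γ) t)
  obtain ⟨n₁, hn₁⟩ := exists_forall_pow_smul_eq_zero J T
  set G : Submodule R T := Submodule.torsionBySet R T (J ^ n₁ : Ideal R) with hG
  have hlG : Module.length R G ≠ ⊤ := hJ.length_ne_top n₁ fun x hx y =>
    Subtype.ext ((Submodule.mem_torsionBySet_iff _ _).1 y.2 ⟨x, hx⟩)
  have hlR : Module.length R (R ⧸ J) ≠ ⊤ := hJ.length_ne_top 1 fun x hx y => by
    obtain ⟨y, rfl⟩ := Ideal.Quotient.mk_surjective y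
    rw [pow_one] at hx
    exact Ideal.Quotient.eq_zero_iff_mem.2 (J.mul_mem_right _ hx)
  refine ⟨(Module.length R (R ⧸ J) + Module.length R G).toNat, fun S _ _ hS => ?_⟩
  rw [ENat.natCast_toNat (by simp [hlR, hlG])]
  have hfin : Module.Finite R S := RingHom.finite_algebraMap.1 hS.finite
  obtain ⟨N, hN⟩ := hS.exists_mul_mem_range
  have hpow : ∀ (k : ℕ) (s : S), (∀ a ∈ J ^ k, algebraMap R S a * s = 0) → s = 0 := by
    intro k
    induction k with
    | zero => intro s hs; simpa using hs 1 (by simp)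
    | succ k ih =>
      intro s hs
      refine hS.eq_zero_of_mul s fun j hj => ih _ fun a ha => ?_
      rw [← mul_assoc, ← map_mul]
      exact hs _ (by rw [pow_succ]; exact Ideal.mul_mem_mul ha hj)
  have hker : ∀ r, r ∈ Γ ↔ algebraMap R S r = 0 := by
    intro r
    constructor
    · intro hr
      refine hpow n₀ _ fun a ha => ?_
      rw [← map_mul, (hmemΓ r).1 hr a ha, map_zero]
    · intro hr
      obtain ⟨k, hk⟩ := hS.exists_mul_eq_zero r hr
      exact (hmemΓ r).2 (hn₀ k r hk)
  let i : (R ⧸ Γ) →ₗ[R] S := (Ideal.Quotient.liftₐ Γ (Algebra.ofId R S)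
    fun a ha => (hker a).1 ha).toLinearMap
  have hi' : ∀ r, i (Ideal.Quotient.mk Γ r) = algebraMap R S r := fun r => rfl
  have hi : Function.Injective i := by
    rw [injective_iff_map_eq_zero]
    intro q hq
    obtain ⟨r, rfl⟩ := Ideal.Quotient.mk_surjective q
    exact Ideal.Quotient.eq_zero_iff_mem.2 ((hker r).2 hq)
  have hrange : ∀ s, s ∈ LinearMap.range i ↔ s ∈ (algebraMap R S).range := by
    intro s
    constructor
    · rintro ⟨q, rfl⟩
      obtain ⟨r, rfl⟩ := Ideal.Quotient.mk_surjective q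
      exact ⟨r, rfl⟩
    · rintro ⟨r, rfl⟩
      exact ⟨Ideal.Quotient.mk Γ r, rfl⟩
  have hI : ∀ a ∈ J ^ N, ∀ s : S, a • s ∈ LinearMap.range i := by
    intro a ha s
    rw [hrange, Algebra.smul_def]
    exact hN a ha s
  have htS : ∀ s : S, t • s = 0 → s = 0 := by
    intro s hs
    refine hpow N s fun a ha => ?_
    obtain ⟨q, hq⟩ := hI a ha s
    rw [← Algebra.smul_def, ← hq, ht q (hi ?_), map_zero]
    rw [map_smul, hq, smul_comm, hs, smul_zero, map_zero]
  have hC : Module.length R (S ⧸ LinearMap.range i) ≠ ⊤ := by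
    refine hJ.length_ne_top N fun a ha y => ?_
    obtain ⟨s, rfl⟩ := Submodule.mkQ_surjective _ y
    rw [← map_smul]
    exact (Submodule.Quotient.mk_eq_zero _).2 (hI a ha s)
  have hbound := length_quotient_smul_le i hi t htS (J ^ N) hI hC G (fun y hy => by
    rw [hG, Submodule.mem_torsionBySet_iff]
    exact fun a => hn₁ N y hy a a.2)
  -- compare the closed fibre of `S` with that of `R` and with the cokernel modulo `t`
  set JS := J.map (algebraMap R S) with hJS
  have hle : J ≤ LinearMap.ker (Algebra.linearMap R (S ⧸ JS)) := by
    intro j hj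
    rw [LinearMap.mem_ker, Algebra.linearMap_apply, IsScalarTower.algebraMap_apply R S,
      Ideal.Quotient.algebraMap_eq, Ideal.Quotient.eq_zero_iff_mem]
    exact Ideal.mem_map_of_mem _ hj
  let u : (R ⧸ J) →ₗ[R] (S ⧸ JS) := Submodule.liftQ J (Algebra.linearMap R (S ⧸ JS)) hle
  have h1 := Module.length_eq_add_of_exact (LinearMap.range u).subtype (LinearMap.range u).mkQ
    (Submodule.subtype_injective _) (Submodule.mkQ_surjective _)
    (LinearMap.exact_subtype_mkQ _)
  rw [h1]
  refine add_le_add (Module.length_le_of_surjective u.rangeRestrict u.surjective_rangeRestrict)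
    (le_trans ?_ hbound)
  let v : S →ₗ[R] (S ⧸ JS) ⧸ LinearMap.range u :=
    (LinearMap.range u).mkQ.comp (IsScalarTower.toAlgHom R S (S ⧸ JS)).toLinearMap
  have hv : Function.Surjective v :=
    (Submodule.mkQ_surjective _).comp Ideal.Quotient.mk_surjective
  have hv1 : LinearMap.range i ≤ LinearMap.ker v := by
    intro s hs
    obtain ⟨r, rfl⟩ := (hrange s).1 hs
    exact (Submodule.Quotient.mk_eq_zero _).2 ⟨Submodule.Quotient.mk r, rfl⟩
  have hv2 : LinearMap.range (LinearMap.lsmul R (S ⧸ LinearMap.range i) t) ≤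
      LinearMap.ker (Submodule.liftQ _ v hv1) := by
    rintro _ ⟨y, rfl⟩
    obtain ⟨s, rfl⟩ := Submodule.mkQ_surjective _ y
    change v (t • s) = 0
    have h2 : (Ideal.Quotient.mk JS) (t • s) = 0 := by
      rw [Ideal.Quotient.eq_zero_iff_mem, Algebra.smul_def]
      exact JS.mul_mem_right _ (Ideal.mem_map_of_mem _ htJ)
    change (LinearMap.range u).mkQ (Ideal.Quotient.mk JS (t • s)) = 0
    rw [h2, map_zero]
  refine Module.length_le_of_surjective (Submodule.liftQ _ (Submodule.liftQ _ v hv1) hv2) ?_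
  intro y
  obtain ⟨s, rfl⟩ := hv y
  exact ⟨Submodule.Quotient.mk (Submodule.Quotient.mk s), rfl⟩

end Length

/-! ### Radicial and unramified homomorphisms -/

section Radicial

theorem universallyInjective_SpecMap_iff {R S : CommRingCat.{u}} (φ : R ⟶ S) :
    UniversallyInjective (Spec.map φ) ↔ φ.hom.IsRadicial := by
  have htfae : UniversallyInjective (Spec.map φ) ↔ ∀ (K : Type u) [Field K],
      Function.Injective (fun g : Spec (.of K) ⟶ Spec S => g ≫ Spec.map φ) :=
    (tfae_universallyInjective (Spec.map φ)).out 0 1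
  rw [htfae]
  constructor
  · intro h K _ f g hfg
    have h1 : Spec.map (CommRingCat.ofHom f) = Spec.map (CommRingCat.ofHom g) := by
      apply h K
      change Spec.map _ ≫ _ = Spec.map _ ≫ _
      rw [← Spec.map_comp, ← Spec.map_comp]
      congr 1
      ext x
      exact RingHom.congr_fun hfg x
    exact congrArg CommRingCat.Hom.hom (Spec.map_injective h1)
  · intro h K _ f g hfg
    obtain ⟨f, rfl⟩ := Spec.map_surjective f
    obtain ⟨g, rfl⟩ := Spec.map_surjective g
    change Spec.map _ ≫ _ = Spec.map _ ≫ _ at hfg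
    rw [← Spec.map_comp, ← Spec.map_comp] at hfg
    congr 1
    ext1
    exact h K f.hom g.hom (congrArg CommRingCat.Hom.hom (Spec.map_injective hfg))

/-- A finite unramified radicial homomorphism is surjective: its spectrum is a finite
monomorphism, hence a closed immersion. -/
theorem RingHom.IsRadicial.surjective {R S : Type u} [CommRing R] [CommRing S] [Algebra R S]
    [Module.Finite R S] [Algebra.FormallyUnramified R S] (h : (algebraMap R S).IsRadicial) :
    Function.Surjective (algebraMap R S) := by
  let φ : CommRingCat.of R ⟶ CommRingCat.of S := CommRingCat.ofHom (algebraMap R S)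
  have h1 : UniversallyInjective (Spec.map φ) := (universallyInjective_SpecMap_iff φ).2 h
  have h2 : IsFinite (Spec.map φ) :=
    (IsFinite.SpecMap_iff φ).2 (RingHom.finite_algebraMap.2 inferInstance)
  have h3 : AlgebraicGeometry.FormallyUnramified (Spec.map φ) := by
    rw [HasRingHomProperty.Spec_iff (P := @AlgebraicGeometry.FormallyUnramified)]
    exact RingHom.formallyUnramified_algebraMap.2 inferInstance
  have h4 : Surjective (Limits.pullback.diagonal (Spec.map φ)) :=
    (UniversallyInjective.iff_diagonal _).1 h1
  have h5 : IsIso (Limits.pullback.diagonal (Spec.map φ)) := by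
    rw [isIso_iff_isOpenImmersion_and_surjective]
    exact ⟨inferInstance, h4⟩
  have h6 : Mono (Spec.map φ) := (Limits.pullback.isIso_diagonal_iff _).1 h5
  have h7 : IsClosedImmersion (Spec.map φ) :=
    (IsClosedImmersion.iff_isFinite_and_mono _).2 ⟨h2, h6⟩
  have h8 := (IsClosedImmersion.isAffine_surjective_of_isAffine (Spec.map φ)).2
  have h9 := Scheme.ΓSpecIso_inv_naturality φ
  have h10 : Function.Surjective (φ ≫ (Scheme.ΓSpecIso (.of S)).inv) := by
    rw [h9]
    exact h8.comp (ConcreteCategory.bijective_of_isIso (Scheme.ΓSpecIso (.of R)).inv).2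
  intro s
  obtain ⟨r, hr⟩ := h10 ((Scheme.ΓSpecIso (.of S)).inv s)
  exact ⟨r, (ConcreteCategory.bijective_of_isIso (Scheme.ΓSpecIso (.of S)).inv).1 hr⟩

end Radicial

/-! ### The largest unramified modification -/

section MaximalUnramified

variable {R S C : Type u} [CommRing R] [CommRing S] [CommRing C] [Algebra R S]

theorem RingHom.IsModification.eq_zero_of_pow_mul {J : Ideal R}
    (hS : (algebraMap R S).IsModification J) (k : ℕ) :
    ∀ s : S, (∀ a ∈ J ^ k, algebraMap R S a * s = 0) → s = 0 := by
  induction k with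
  | zero => intro s hs; simpa using hs 1 (by simp)
  | succ k ih =>
    intro s hs
    refine hS.eq_zero_of_mul s fun j hj => ih _ fun a ha => ?_
    rw [← mul_assoc, ← map_mul]
    exact hs _ (by rw [pow_succ]; exact Ideal.mul_mem_mul ha hj)

theorem RingHom.IsModification.algebraMap_eq_zero_of_pow_mul {J : Ideal R}
    (hS : (algebraMap R S).IsModification J) {k : ℕ} {r : R} (hr : ∀ a ∈ J ^ k, a * r = 0) :
    algebraMap R S r = 0 :=
  hS.eq_zero_of_pow_mul k _ fun a ha => by rw [← map_mul, hr a ha, map_zero]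

theorem Ideal.forall_mem_map_mul_eq_zero_iff {J : Ideal R} [Algebra R C] [Algebra S C] [IsScalarTower R S C]
    {c : C} : (∀ a ∈ J.map (algebraMap R S), algebraMap S C a * c = 0) ↔
      ∀ j ∈ J, algebraMap R C j * c = 0 := by
  constructor
  · intro h j hj
    rw [IsScalarTower.algebraMap_apply R S C]
    exact h _ (Ideal.mem_map_of_mem _ hj)
  · intro h a ha
    induction ha using Submodule.span_induction with
    | mem x hx =>
      obtain ⟨j, hj, rfl⟩ := hx
      rw [← IsScalarTower.algebraMap_apply R S C]
      exact h j hj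
    | zero => simp
    | add x y _ _ hx hy => rw [map_add, add_mul, hx, hy, add_zero]
    | smul a x _ hx => rw [smul_eq_mul, map_mul, mul_assoc, hx, mul_zero]

/-- A modification of a ring without torsion along the centre is injective. -/
theorem RingHom.IsModification.injective_of_eq_zero {I : Ideal R}
    (hS : (algebraMap R S).IsModification I)
    (hI : ∀ r : R, (∀ i ∈ I, i * r = 0) → r = 0) : Function.Injective (algebraMap R S) := by
  rw [injective_iff_map_eq_zero]
  intro r hr
  obtain ⟨N, hN⟩ := hS.exists_mul_eq_zero r hr
  clear hr
  induction N generalizing r with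
  | zero => simpa using hN 1 (by simp)
  | succ k ih =>
    refine hI r fun i hi => ih _ fun a ha => ?_
    rw [← mul_assoc]
    exact hN _ (by rw [pow_succ]; exact Ideal.mul_mem_mul ha hi)

theorem RingHom.IsModification.injective_tower {J : Ideal R}
    (hS : (algebraMap R S).IsModification J) [Algebra S C]
    (hC : (algebraMap S C).IsModification (J.map (algebraMap R S))) :
    Function.Injective (algebraMap S C) :=
  hC.injective_of_eq_zero fun s hs =>
    hS.eq_zero_of_mul s fun _ hj => hs _ (Ideal.mem_map_of_mem _ hj)

/-- A modification of a modification is a modification. -/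
theorem RingHom.IsModification.trans {J : Ideal R} [Algebra R C] [Algebra S C] [IsScalarTower R S C]
    (hS : (algebraMap R S).IsModification J)
    (hC : (algebraMap S C).IsModification (J.map (algebraMap R S))) :
    (algebraMap R C).IsModification J := by
  have hinj := hS.injective_tower hC
  refine ⟨?_, fun c hc => ?_, ?_, fun r hr => ?_⟩
  · rw [IsScalarTower.algebraMap_eq R S C]
    exact hC.finite.comp hS.finite
  · exact hC.eq_zero_of_mul c (Ideal.forall_mem_map_mul_eq_zero_iff.2 hc)
  · obtain ⟨N, hN⟩ := hS.exists_mul_mem_range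
    obtain ⟨M, hM⟩ := hC.exists_mul_mem_range
    refine ⟨N + M, fun x hx c => ?_⟩
    rw [pow_add] at hx
    induction hx using Submodule.mul_induction_on' with
    | mem_mul_mem y hy z hz =>
      obtain ⟨s, hs⟩ := hM (algebraMap R S z)
        (by rw [← Ideal.map_pow]; exact Ideal.mem_map_of_mem _ hz) c
      obtain ⟨r, hr⟩ := hN y hy s
      refine ⟨r, ?_⟩
      rw [map_mul, mul_assoc, IsScalarTower.algebraMap_apply R S C z, ← hs,
        IsScalarTower.algebraMap_apply R S C, hr, map_mul, ← IsScalarTower.algebraMap_apply R S C]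
    | add y _ z _ hy hz => rw [map_add, add_mul]; exact add_mem hy hz
  · rw [IsScalarTower.algebraMap_apply R S C] at hr
    exact hS.exists_mul_eq_zero r (hinj (by rw [hr, map_zero]))

/-- Homomorphisms over `R` from a modification of `R` to an algebra without torsion are unique. -/
theorem RingHom.IsModification.algHom_ext {J : Ideal R} [Algebra R C]
    (hS : (algebraMap R S).IsModification J)
    (hC : (algebraMap R C).IsModification J) (f g : S →ₐ[R] C) : f = g := by
  obtain ⟨N, hN⟩ := hS.exists_mul_mem_range
  ext s
  rw [← sub_eq_zero]
  refine hC.eq_zero_of_pow_mul N _ fun a ha => ?_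
  obtain ⟨r, hr⟩ := hN a ha s
  have h1 : algebraMap R C a * f s = algebraMap R C r := by
    rw [← f.commutes, ← map_mul, ← hr, f.commutes]
  have h2 : algebraMap R C a * g s = algebraMap R C r := by
    rw [← g.commutes, ← map_mul, ← hr, g.commutes]
  rw [mul_sub, h1, h2, sub_self]

/-- Dividing out the torsion along the centre from a finite algebra which is an isomorphism away
from the centre yields a modification. -/
theorem exists_isModification_quotient [IsNoetherianRing R] [Module.Finite R S] {I : Ideal R}
    (h1 : ∃ N, ∀ x ∈ I ^ N, ∀ s : S, algebraMap R S x * s ∈ (algebraMap R S).range)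
    (h2 : ∀ r, algebraMap R S r = 0 → ∃ N, ∀ x ∈ I ^ N, x * r = 0) :
    ∃ Γ : Ideal S, (algebraMap R (S ⧸ Γ)).IsModification I := by
  obtain ⟨n, hn⟩ := exists_forall_pow_smul_eq_zero I S
  let Γ : Ideal S :=
    { carrier := {s | ∀ a ∈ I ^ n, a • s = 0}
      add_mem' := fun hx hy a ha => by rw [smul_add, hx a ha, hy a ha, add_zero]
      zero_mem' := fun a _ => smul_zero a
      smul_mem' := fun c x hx a ha => by
        rw [smul_eq_mul, mul_comm, ← smul_mul_assoc, hx a ha, zero_mul] }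
  have hΓ : ∀ s, s ∈ Γ ↔ ∀ a ∈ I ^ n, a • s = 0 := fun s => Iff.rfl
  refine ⟨Γ, RingHom.finite_algebraMap.2 inferInstance, fun q hq => ?_, ?_, fun r hr => ?_⟩
  · obtain ⟨s, rfl⟩ := Ideal.Quotient.mk_surjective q
    rw [Ideal.Quotient.eq_zero_iff_mem, hΓ]
    refine hn (n + 1) s fun a ha => ?_
    rw [pow_succ] at ha
    induction ha using Submodule.mul_induction_on' with
    | mem_mul_mem y hy j hj =>
      have h3 : j • s ∈ Γ := by
        rw [← Ideal.Quotient.eq_zero_iff_mem, Algebra.smul_def, map_mul]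
        exact hq j hj
      rw [mul_smul]
      exact (hΓ _).1 h3 y hy
    | add y _ z _ hy hz => rw [add_smul, hy, hz, add_zero]
  · obtain ⟨N, hN⟩ := h1
    refine ⟨N, fun x hx q => ?_⟩
    obtain ⟨s, rfl⟩ := Ideal.Quotient.mk_surjective q
    obtain ⟨r, hr⟩ := hN x hx s
    refine ⟨r, ?_⟩
    rw [IsScalarTower.algebraMap_apply R S, Ideal.Quotient.algebraMap_eq, hr, map_mul]
    rfl
  · rw [IsScalarTower.algebraMap_apply R S, Ideal.Quotient.algebraMap_eq,
      Ideal.Quotient.eq_zero_iff_mem, hΓ] at hr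
    -- `I ^ n` is finitely generated, so one power of `I` kills all products
    obtain ⟨k, hk⟩ := exists_forall_pow_smul_eq_zero I R
    refine ⟨k + n, fun x hx => ?_⟩
    rw [pow_add] at hx
    induction hx using Submodule.mul_induction_on' with
    | mem_mul_mem y hy z hz =>
      obtain ⟨N, hN⟩ := h2 (z * r) (by rw [map_mul, ← Algebra.smul_def]; exact hr z hz)
      rw [mul_assoc]
      exact hk N (z * r) hN y hy
    | add y _ z _ hy hz => rw [add_mul, hy, hz, add_zero]

/-- The closed fibre of an unramified algebra is reduced. -/
theorem jacobson_le_map_of_formallyUnramified [IsNoetherianRing R] [Module.Finite R S]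
    [Algebra.FormallyUnramified R S] (hR : (Ring.jacobson R).DefinesClosedPoints) :
    Ring.jacobson S ≤ (Ring.jacobson R).map (algebraMap R S) := by
  classical
  have := hR.finite_maximalSpectrum
  have := Fintype.ofFinite (MaximalSpectrum R)
  have hcop : Pairwise (Function.onFun IsCoprime (fun i : MaximalSpectrum R => i.asIdeal)) :=
    fun i j hij => Ideal.isCoprime_of_isMaximal (fun h => hij (MaximalSpectrum.ext h))
  have h1 : Ring.jacobson R = ∏ i : MaximalSpectrum R, i.asIdeal := by
    rw [Ideal.prod_eq_iInf_of_pairwise_isCoprime fun i _ j _ hij => hcop hij]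
    ext x
    simp only [mem_jacobson_iff_forall_maximal, Finset.mem_univ, iInf_pos, Submodule.mem_iInf]
    exact ⟨fun h i => h _ i.isMaximal, fun h m hm => h ⟨m, hm⟩⟩
  have h2 : (Ring.jacobson R).map (algebraMap R S) =
      ⨅ i ∈ (Finset.univ : Finset (MaximalSpectrum R)), i.asIdeal.map (algebraMap R S) := by
    rw [h1, ← Ideal.mapHom_apply, map_prod]
    simp only [Ideal.mapHom_apply]
    rw [Ideal.prod_eq_iInf_of_pairwise_isCoprime]
    intro i _ j _ hij
    have := hcop hij
    rw [Function.onFun, Ideal.isCoprime_iff_sup_eq] at this ⊢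
    rw [← Ideal.map_sup, this, Ideal.map_top]
  rw [h2]
  refine le_iInf₂ fun i _ s hs => ?_
  set m := i.asIdeal with hm
  have hmax : m.IsMaximal := i.isMaximal
  let _ : Field (R ⧸ m) := Ideal.Quotient.field m
  set P := m.map (algebraMap R S) with hP
  have h3 : Algebra.FormallyUnramified R (S ⧸ P) := inferInstance
  let _ : Algebra (R ⧸ m) (S ⧸ P) := Ideal.Quotient.algebraQuotientOfLEComap Ideal.le_comap_map
  have : IsScalarTower R (R ⧸ m) (S ⧸ P) := IsScalarTower.of_algebraMap_eq' rfl
  have h4 : Algebra.FormallyUnramified (R ⧸ m) (S ⧸ P) :=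
    Algebra.FormallyUnramified.of_restrictScalars R (R ⧸ m) (S ⧸ P)
  have h5 : Module.Finite (R ⧸ m) (S ⧸ P) := Module.Finite.of_restrictScalars_finite R _ _
  have h6 : IsReduced (S ⧸ P) := Algebra.FormallyUnramified.isReduced_of_field (R ⧸ m) (S ⧸ P)
  rw [← Ideal.isRadical_iff_quotient_reduced] at h6
  refine h6 ?_
  rw [Ideal.radical_eq_sInf, Submodule.mem_sInf]
  rintro Q ⟨hPQ, hQ⟩
  refine mem_jacobson_iff_forall_maximal.1 hs Q ?_
  refine Ideal.isMaximal_of_isIntegral_of_isMaximal_comap (R := R) Q ?_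
  rwa [← hmax.eq_of_le (hQ.comap _).ne_top (Ideal.map_le_iff_le_comap.1 hPQ)]

end MaximalUnramified

section SmallestModification

open scoped TensorProduct

variable {R S : Type u} [CommRing R] [CommRing S] [Algebra R S]

/-- Among the unramified modifications of a semilocal ring there is one that admits no further
unramified modification: one whose closed fibre has maximal length. -/
theorem exists_maximal_unramified [IsNoetherianRing R]
    (hR : (Ring.jacobson R).DefinesClosedPoints) :
    ∃ (S : Type u) (_ : CommRing S) (_ : Algebra R S),
      (algebraMap R S).IsModification (Ring.jacobson R) ∧ Algebra.FormallyUnramified R S ∧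
      ∀ (C : Type u) [CommRing C] [Algebra S C],
        (algebraMap S C).IsModification ((Ring.jacobson R).map (algebraMap R S)) →
        Algebra.FormallyUnramified S C → Function.Surjective (algebraMap S C) := by
  classical
  set J := Ring.jacobson R with hJ
  obtain ⟨c, hc⟩ := exists_length_quotient_le hR
  let P : ℕ → Prop := fun n => ∃ (S : Type u) (_ : CommRing S) (_ : Algebra R S),
    (algebraMap R S).IsModification J ∧ Algebra.FormallyUnramified R S ∧
      Module.length R (S ⧸ J.map (algebraMap R S)) = n
  have hP : ∀ n, P n → n ≤ c := by
    rintro n ⟨S, _, _, h1, -, h2⟩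
    have := hc S h1
    rw [h2] at this
    exact_mod_cast this
  have hP0 : ∃ n, P n := by
    obtain ⟨Γ, hΓ⟩ := exists_isModification_quotient (R := R) (S := R) (I := J)
      ⟨0, fun x _ s => ⟨x * s, rfl⟩⟩ (fun r hr => ⟨0, fun x _ => by
        rw [show r = 0 from hr, mul_zero]⟩)
    obtain ⟨n, hn⟩ := ENat.ne_top_iff_exists.1
      (ne_top_of_le_ne_top (ENat.natCast_ne_top c) (hc _ hΓ))
    exact ⟨n, R ⧸ Γ, _, _, hΓ, inferInstance, hn.symm⟩
  obtain ⟨n₀, hn₀⟩ := hP0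
  obtain ⟨S, _, _, hS, hSu, hlen⟩ : P (Nat.findGreatest P c) :=
    Nat.findGreatest_spec (hP n₀ hn₀) hn₀
  refine ⟨S, _, _, hS, hSu, fun C _ _ hC hCu => ?_⟩
  let _ : Algebra R C := ((algebraMap S C).comp (algebraMap R S)).toAlgebra
  have : IsScalarTower R S C := IsScalarTower.of_algebraMap_eq' rfl
  have hRC : (algebraMap R C).IsModification J := hS.trans hC
  have hCu' : Algebra.FormallyUnramified R C := Algebra.FormallyUnramified.comp R S C
  have hfinS : Module.Finite R S := RingHom.finite_algebraMap.1 hS.finite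
  have hfinC : Module.Finite S C := RingHom.finite_algebraMap.1 hC.finite
  have hfinRC : Module.Finite R C := Module.Finite.trans S C
  have hinj := hS.injective_tower hC
  obtain ⟨k, hk⟩ := ENat.ne_top_iff_exists.1
    (ne_top_of_le_ne_top (ENat.natCast_ne_top c) (hc _ hRC))
  have hkle : k ≤ Nat.findGreatest P c := by
    have hPk : P k := ⟨C, _, _, hRC, hCu', hk.symm⟩
    exact Nat.le_findGreatest (hP k hPk) hPk
  set JS := J.map (algebraMap R S) with hJS
  set JC := J.map (algebraMap R C) with hJC
  have hJC' : JC = JS.map (algebraMap S C) := by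
    rw [hJS, Ideal.map_map, ← IsScalarTower.algebraMap_eq]
  -- the map of closed fibres is injective since the closed fibre of `S` is reduced
  have hcomap : JC.comap (algebraMap S C) ≤ JS := by
    intro s hs
    refine jacobson_le_map_of_formallyUnramified hR ?_
    rw [mem_jacobson_iff_forall_maximal]
    intro m hm
    obtain ⟨Q, hQ, rfl⟩ := Ideal.exists_ideal_over_maximal_of_isIntegral (S := C) m
      (by rw [(RingHom.injective_iff_ker_eq_bot _).1 hinj]; exact bot_le)
    refine Ideal.comap_mono ?_ hs
    exact (hR.map (S := C) Q hQ.isPrime).2 hQ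
  let u : (S ⧸ JS) →ₗ[R] (C ⧸ JC) := (Ideal.quotientMapₐ JC (IsScalarTower.toAlgHom R S C)
    (by rw [hJC']; exact Ideal.le_comap_map)).toLinearMap
  have hu : Function.Injective u := by
    rw [injective_iff_map_eq_zero]
    intro q hq
    obtain ⟨s, rfl⟩ := Ideal.Quotient.mk_surjective q
    refine Ideal.Quotient.eq_zero_iff_mem.2 (hcomap ?_)
    exact (Ideal.Quotient.eq_zero_iff_mem (I := JC)).1 hq
  have hexact := Module.length_eq_add_of_exact u (LinearMap.range u).mkQ hu
    (Submodule.mkQ_surjective _) (LinearMap.exact_map_mkQ_range u)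
  rw [hlen, ← hk] at hexact
  have hzero : Module.length R ((C ⧸ JC) ⧸ LinearMap.range u) = 0 := by
    obtain ⟨l, hl⟩ := ENat.ne_top_iff_exists.1 (show
      Module.length R ((C ⧸ JC) ⧸ LinearMap.range u) ≠ ⊤ by
        intro h; rw [h, add_top] at hexact; exact ENat.natCast_ne_top _ hexact)
    rw [← hl] at hexact ⊢
    norm_cast at hexact ⊢
    omega
  have husurj : Function.Surjective u := by
    rw [Module.length_eq_zero_iff, Submodule.Quotient.subsingleton_iff] at hzero
    exact LinearMap.range_eq_top.1 hzero
  have hN : (⊤ : Submodule S C) ≤ LinearMap.range (Algebra.linearMap S C) := by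
    refine Submodule.le_of_le_smul_of_le_jacobson_bot (I := JS) Module.Finite.fg_top ?_ ?_
    · refine (hR.map (S := S)).le_jacobson.trans ?_
      rw [Ring.jacobson_eq_sInf_isMaximal]
      exact le_sInf fun m hm => sInf_le hm.2
    · intro x _
      obtain ⟨q, hq⟩ := husurj (Ideal.Quotient.mk JC x)
      obtain ⟨s, rfl⟩ := Ideal.Quotient.mk_surjective q
      have h1 : x - algebraMap S C s ∈ JC := Ideal.Quotient.eq.1 hq.symm
      have h2 : x - algebraMap S C s ∈ JS • (⊤ : Submodule S C) := by
        rw [Ideal.smul_top_eq_map, ← hJC']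
        exact h1
      rw [← add_sub_cancel (algebraMap S C s) x]
      exact Submodule.add_mem_sup ⟨s, rfl⟩ h2
  intro x
  exact hN (Submodule.mem_top (x := x))

/-- The compositum of two modifications over the base. -/
theorem exists_isModification_tensorProduct [IsNoetherianRing R] {J : Ideal R} {W : Type u}
    [CommRing W] [Algebra R W] (hW : (algebraMap R W).IsModification J)
    (hS : (algebraMap R S).IsModification J) :
    ∃ Γ : Ideal (W ⊗[R] S),
      (algebraMap W ((W ⊗[R] S) ⧸ Γ)).IsModification (J.map (algebraMap R W)) := by
  have : Module.Finite R W := RingHom.finite_algebraMap.1 hW.finite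
  have : Module.Finite R S := RingHom.finite_algebraMap.1 hS.finite
  have : IsNoetherianRing W := IsNoetherianRing.of_finite R W
  obtain ⟨N, hN⟩ := hS.exists_mul_mem_range
  refine exists_isModification_quotient ⟨N, fun x hx t => ?_⟩ fun w hw => ⟨0, fun x _ => ?_⟩
  · induction t using TensorProduct.induction_on with
    | zero => rw [mul_zero]; exact zero_mem _
    | add a b ha hb => rw [mul_add]; exact add_mem ha hb
    | tmul w s =>
      rw [← Ideal.map_pow] at hx
      induction hx using Submodule.span_induction with
      | mem y hy =>
        obtain ⟨a, ha, rfl⟩ := hy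
        obtain ⟨r, hr⟩ := hN a ha s
        refine ⟨r • w, ?_⟩
        have h1 : (1 : W) ⊗ₜ[R] (r • (1 : S)) = 1 ⊗ₜ[R] (a • s) := by
          rw [← Algebra.algebraMap_eq_smul_one, hr, Algebra.smul_def]
        calc (r • w) ⊗ₜ[R] (1 : S) = (w ⊗ₜ[R] (1 : S)) * ((1 : W) ⊗ₜ[R] (r • (1 : S))) := by
              rw [Algebra.TensorProduct.tmul_mul_tmul, mul_one, one_mul, TensorProduct.smul_tmul]
          _ = (algebraMap R W a) ⊗ₜ[R] (1 : S) * (w ⊗ₜ[R] s) := by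
              rw [h1, Algebra.TensorProduct.tmul_mul_tmul, Algebra.TensorProduct.tmul_mul_tmul,
                mul_one, one_mul, one_mul, ← TensorProduct.smul_tmul, Algebra.smul_def]
      | zero => rw [map_zero, zero_mul]; exact zero_mem _
      | add y z _ _ hy hz => rw [map_add, add_mul]; exact add_mem hy hz
      | smul a y _ hy => rw [smul_eq_mul, map_mul, mul_assoc]; exact mul_mem ⟨a, rfl⟩ hy
  · -- multiplication by an element of `J ^ N` maps `S` to the image of `R`, hence to `W`
    suffices hw0 : w = 0 by rw [hw0, mul_zero]
    refine hW.eq_zero_of_pow_mul N w fun a ha => ?_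
    have hker : LinearMap.ker (Algebra.linearMap R S) ≤ LinearMap.ker (Algebra.linearMap R W) := by
      intro r hr
      obtain ⟨k, hk⟩ := hS.exists_mul_eq_zero r hr
      exact hW.algebraMap_eq_zero_of_pow_mul hk
    let f₁ : S →ₗ[R] LinearMap.range (Algebra.linearMap R S) :=
      (LinearMap.lsmul R S a).codRestrict _ fun s => by
        obtain ⟨r, hr⟩ := hN a ha s
        exact ⟨r, hr.trans (Algebra.smul_def a s).symm⟩
    let f₂ : LinearMap.range (Algebra.linearMap R S) →ₗ[R] W :=
      (Submodule.liftQ _ (Algebra.linearMap R W) hker).comp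
        (LinearMap.quotKerEquivRange (Algebra.linearMap R S)).symm.toLinearMap
    have hf : f₂ (f₁ 1) = algebraMap R W a := by
      have h1 : f₁ 1 = LinearMap.quotKerEquivRange (Algebra.linearMap R S)
          (Submodule.Quotient.mk a) := by
        apply Subtype.ext
        change a • (1 : S) = algebraMap R S a
        rw [Algebra.algebraMap_eq_smul_one]
      rw [h1]
      simp only [f₂, LinearMap.comp_apply, LinearEquiv.coe_coe, LinearEquiv.symm_apply_apply]
      rfl
    have h2 : (LinearMap.mul' R W).comp ((f₂.comp f₁).lTensor W) (w ⊗ₜ[R] (1 : S)) = 0 := by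
      rw [show w ⊗ₜ[R] (1 : S) = 0 from hw, map_zero]
    simpa [hf, mul_comm] using h2

/-- A semilocal Noetherian ring has an unramified modification all of whose modifications are
radicial, and it maps to every modification with that property. -/
theorem exists_smallest_modification [IsNoetherianRing R]
    (hR : (Ring.jacobson R).DefinesClosedPoints) :
    ∃ (S : Type u) (_ : CommRing S) (_ : Algebra R S),
      (algebraMap R S).IsModification (Ring.jacobson R) ∧ Algebra.FormallyUnramified R S ∧
      (∀ (C : Type u) [CommRing C] [Algebra S C],
        (algebraMap S C).IsModification ((Ring.jacobson R).map (algebraMap R S)) →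
        (algebraMap S C).IsRadicial) ∧
      ∀ (W : Type u) [CommRing W] [Algebra R W],
        (algebraMap R W).IsModification (Ring.jacobson R) →
        (∀ (C : Type u) [CommRing C] [Algebra W C],
          (algebraMap W C).IsModification ((Ring.jacobson R).map (algebraMap R W)) →
          (algebraMap W C).IsRadicial) → Nonempty (S →ₐ[R] W) := by
  obtain ⟨S, _, _, hS, hSu, hmax⟩ := exists_maximal_unramified hR
  have hfinS : Module.Finite R S := RingHom.finite_algebraMap.1 hS.finite
  have : IsNoetherianRing S := IsNoetherianRing.of_finite R S
  refine ⟨S, _, _, hS, hSu, fun C _ _ hC => ?_, fun W _ _ hW hWr => ?_⟩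
  · exact isRadicial_of_forall_surjective (hR.map (S := S)) (fun T _ _ => hmax T) hC
  · obtain ⟨Γ, hΓ⟩ := exists_isModification_tensorProduct hW hS
    have hfin : Module.Finite W ((W ⊗[R] S) ⧸ Γ) := inferInstance
    have hu : Algebra.FormallyUnramified W ((W ⊗[R] S) ⧸ Γ) := by
      have : Algebra.FormallyUnramified W (W ⊗[R] S) := Algebra.FormallyUnramified.base_change W
      infer_instance
    have hsurj := (hWr _ hΓ).surjective
    let _ : Algebra R ((W ⊗[R] S) ⧸ Γ) := inferInstance
    let e : W ≃ₐ[W] ((W ⊗[R] S) ⧸ Γ) := AlgEquiv.ofBijective (Algebra.ofId _ _)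
      ⟨hW.injective_tower hΓ, hsurj⟩
    have : IsScalarTower R W ((W ⊗[R] S) ⧸ Γ) := inferInstance
    exact ⟨(e.symm.toAlgHom.restrictScalars R).comp
      ((Ideal.Quotient.mkₐ R Γ).comp Algebra.TensorProduct.includeRight)⟩

end SmallestModification

/-! ### Universal homeomorphisms -/

section UniversalHomeomorphism

variable {X Y : Scheme.{u}}

theorem IsUniversalHomeomorphism.universallyInjective {f : X ⟶ Y}
    (hf : IsUniversalHomeomorphism f) : UniversallyInjective f :=
  ⟨MorphismProperty.universally_mono
    (fun _ _ _ (h : IsHomeomorph _) => h.injective) _ hf⟩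

theorem IsUniversalHomeomorphism.isHomeomorph {f : X ⟶ Y}
    (hf : IsUniversalHomeomorphism f) : IsHomeomorph f :=
  MorphismProperty.universally_le _ _ hf

theorem IsUniversalHomeomorphism.of_isPullback {X' Y' : Scheme.{u}} {f : X ⟶ Y} {f' : X' ⟶ Y'}
    {i : X' ⟶ X} {j : Y' ⟶ Y} (h : IsPullback i f' f j) (hf : IsUniversalHomeomorphism f) :
    IsUniversalHomeomorphism f' :=
  MorphismProperty.of_isPullback (P := (topologically @IsHomeomorph).universally) h hf

theorem IsUniversalHomeomorphism.of_isIntegralHom (f : X ⟶ Y) [IsIntegralHom f] [Surjective f]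
    [UniversallyInjective f] : IsUniversalHomeomorphism f := by
  intro X' Y' i j f' h
  have h1 : IsIntegralHom f' := MorphismProperty.of_isPullback h.flip ‹IsIntegralHom f›
  have h2 : Surjective f' := MorphismProperty.of_isPullback h.flip ‹Surjective f›
  have h3 : UniversallyInjective f' :=
    MorphismProperty.of_isPullback h.flip ‹UniversallyInjective f›
  exact isHomeomorph_iff_continuous_isClosedMap_bijective.2
    ⟨f'.continuous, f'.isClosedMap, f'.injective, f'.surjective⟩

end UniversalHomeomorphism

/-! ### Isomorphisms over open subsets -/

section Restrict

variable {X Y : Scheme.{u}} (p : Y ⟶ X)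

theorem isPullback_morphismRestrict_homOfLE {V U : X.Opens} (h : V ≤ U) :
    IsPullback (Y.homOfLE (p.preimage_mono h)) (p ∣_ V) (p ∣_ U) (X.homOfLE h) := by
  refine IsPullback.of_right (h₁₂ := (p ⁻¹ᵁ U).ι) (h₂₂ := U.ι) (v₁₃ := p) ?_ ?_
    (isPullback_morphismRestrict p U).flip
  · simpa using (isPullback_morphismRestrict p V).flip
  · exact (morphismRestrict_homOfLE p V U h).symm

theorem isIso_morphismRestrict_of_le {V U : X.Opens} (h : V ≤ U) [IsIso (p ∣_ U)] :
    IsIso (p ∣_ V) :=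
  MorphismProperty.of_isPullback (P := MorphismProperty.isomorphisms Scheme)
    (isPullback_morphismRestrict_homOfLE p h) ‹_›

theorem isIso_morphismRestrict_of_forall {U : X.Opens}
    (h : ∀ x ∈ U, ∃ V : X.Opens, x ∈ V ∧ V ≤ U ∧ IsIso (p ∣_ V)) : IsIso (p ∣_ U) := by
  refine IsZariskiLocalAtTarget.of_forall_exists_morphismRestrict
    (P := MorphismProperty.isomorphisms Scheme) fun x => ?_
  obtain ⟨V, hxV, hVU, hV⟩ := h x.1 x.2
  refine ⟨U.ι ⁻¹ᵁ V, hxV, ?_⟩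
  have e := morphismRestrictRestrict p U (U.ι ⁻¹ᵁ V)
  have e' := morphismRestrictEq p (U := U.ι ''ᵁ (U.ι ⁻¹ᵁ V)) (V := V) (by
    rw [U.ι.image_preimage_eq_opensRange_inf, Scheme.Opens.opensRange_ι, inf_eq_right]; exact hVU)
  exact ((MorphismProperty.isomorphisms Scheme).arrow_mk_iso_iff (e ≪≫ e')).2 hV

theorem isIso_morphismRestrict_iff_of_isAffineOpen [IsAffineHom p] {V : X.Opens}
    (hV : IsAffineOpen V) : IsIso (p ∣_ V) ↔ Function.Bijective (p.app V).hom := by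
  have : IsAffine V := hV
  have hV' : IsAffine (p ⁻¹ᵁ V) := hV.preimage p
  have h1 := (MorphismProperty.isomorphisms Scheme).arrow_mk_iso_iff
    (arrowIsoSpecΓOfIsAffine (p ∣_ V))
  rw [MorphismProperty.isomorphisms.iff, MorphismProperty.isomorphisms.iff, isIso_SpecMap_iff,
    ← ConcreteCategory.isIso_iff_bijective] at h1
  have h2 : ∀ {V' : X.Opens}, V' = V → (IsIso (p.app V') ↔ IsIso (p.app V)) := by
    rintro _ rfl; rfl
  rw [h1, ← ConcreteCategory.isIso_iff_bijective, ← h2 V.ι_image_top, morphismRestrict_appTop]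
  exact isIso_comp_right_iff (p.app (V.ι ''ᵁ ⊤))
    (Y.presheaf.map (eqToHom (image_morphismRestrict_preimage p V ⊤)).op)


end Restrict

/-! ### Associated points and torsion -/

section AssociatedPoints

variable {Y : Scheme.{u}} {V : Y.Opens}

theorem mem_associatedPoints_iff (hV : IsAffineOpen V) [IsNoetherianRing Γ(Y, V)] (y : V) :
    y.1 ∈ associatedPoints Y ↔
      (hV.primeIdealOf y).asIdeal ∈ associatedPrimes Γ(Y, V) Γ(Y, V) := by
  have hloc := hV.isLocalization_stalk y
  have h := Module.associatedPrimes.preimage_comap_associatedPrimes_eq_associatedPrimes_of_isLocalizedModule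
    (hV.primeIdealOf y).asIdeal.primeCompl (Y.presheaf.stalk y.1)
    (Algebra.linearMap Γ(Y, V) (Y.presheaf.stalk y.1))
  have h2 : (IsLocalRing.maximalIdeal (Y.presheaf.stalk y.1)).comap
      (algebraMap Γ(Y, V) (Y.presheaf.stalk y.1)) = (hV.primeIdealOf y).asIdeal :=
    IsLocalization.AtPrime.under_maximalIdeal (Y.presheaf.stalk y.1) (hV.primeIdealOf y).asIdeal
  rw [associatedPoints, Set.mem_ofPred_eq, ← h, Set.mem_preimage, h2]

theorem mem_zeroLocus_iff_le_primeIdealOf (hV : IsAffineOpen V) (I : Ideal Γ(Y, V)) (y : V) :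
    y.1 ∈ Y.zeroLocus (U := V) I ↔ I ≤ (hV.primeIdealOf y).asIdeal := by
  conv_lhs => rw [← hV.fromSpec_primeIdealOf y]
  exact Set.ext_iff.1 (hV.fromSpec_preimage_zeroLocus I) (hV.primeIdealOf y)

theorem exists_primeIdealOf_eq (hV : IsAffineOpen V) (p : PrimeSpectrum Γ(Y, V)) : ∃ y : V, hV.primeIdealOf y = p :=
  (ConcreteCategory.bijective_of_isIso (C := TopCat) hV.isoSpec.hom.base).2 p

/-- No associated point lies on the zero locus of `I` exactly if there is no `I`-torsion. -/
theorem forall_associatedPoints_notMem_iff (hV : IsAffineOpen V) [IsNoetherianRing Γ(Y, V)]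
    (I : Ideal Γ(Y, V)) :
    (∀ y ∈ associatedPoints Y, y ∈ V → y ∉ Y.zeroLocus (U := V) I) ↔
      ∀ s : Γ(Y, V), (∀ i ∈ I, i * s = 0) → s = 0 := by
  constructor
  · intro h s hs
    by_contra hs0
    obtain ⟨P, hP, hle⟩ := exists_le_isAssociatedPrime_of_isNoetherianRing Γ(Y, V) s hs0
    obtain ⟨y, hy⟩ := exists_primeIdealOf_eq hV ⟨P, hP.isPrime⟩
    refine h y ((mem_associatedPoints_iff hV y).2 (by rw [hy]; exact hP)) y.2
      ((mem_zeroLocus_iff_le_primeIdealOf hV I y).2 ?_)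
    rw [hy]
    refine le_trans (fun i hi => ?_) hle
    rw [Submodule.mem_colon_singleton, Submodule.mem_bot]
    exact hs i hi
  · intro h y hy hyV hyI
    have hy' := (mem_associatedPoints_iff hV ⟨y, hyV⟩).1 hy
    have hle := (mem_zeroLocus_iff_le_primeIdealOf hV I ⟨y, hyV⟩).1 hyI
    obtain ⟨hprime, x, hx⟩ := isAssociatedPrime_iff.1 hy'
    have : x = 0 := h x fun i hi => by
      have := hle hi
      rw [hx, Submodule.mem_colon_singleton, Submodule.mem_bot] at this
      exact this
    subst this
    exact hprime.ne_top (by rw [hx]; simp)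

end AssociatedPoints

/-! ### Modifications of affine schemes -/

section AffineModification

/-- A homomorphism becomes bijective after inverting `f` if and only if its kernel is killed by
powers of `f` and every element of its target is moved into its range by a power of `f`. -/
theorem bijective_localization_away_iff {R S R' S' : Type*} [CommRing R] [CommRing S] [CommRing R']
    [CommRing S'] (φ : R →+* S) (f : R) [Algebra R R'] [Algebra S S'] [IsLocalization.Away f R']
    [IsLocalization.Away (φ f) S'] (φ' : R' →+* S')
    (h : ∀ r, φ' (algebraMap R R' r) = algebraMap S S' (φ r)) :
    Function.Bijective φ' ↔
      (∀ r, φ r = 0 → ∃ n : ℕ, f ^ n * r = 0) ∧ ∀ s, ∃ n : ℕ, φ f ^ n * s ∈ φ.range := by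
  have hu : IsUnit (algebraMap R R' f) := IsLocalization.Away.algebraMap_isUnit f
  have hu' : IsUnit (algebraMap S S' (φ f)) := IsLocalization.Away.algebraMap_isUnit (φ f)
  constructor
  · intro hbij
    refine ⟨fun r hr => ?_, fun s => ?_⟩
    · have : algebraMap R R' r = 0 := hbij.1 (by rw [h, hr, map_zero, map_zero])
      obtain ⟨⟨_, n, rfl⟩, hn⟩ := (IsLocalization.map_eq_zero_iff (Submonoid.powers f) R' r).1 this
      exact ⟨n, hn⟩
    · obtain ⟨x, hx⟩ := hbij.2 (algebraMap S S' s)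
      obtain ⟨n, r, hr⟩ := IsLocalization.Away.surj f x
      have h1 : algebraMap S S' (φ f ^ n * s) = algebraMap S S' (φ r) := by
        rw [← h, ← hr, map_mul, map_mul, map_pow, map_pow, h, hx, mul_comm]
      obtain ⟨⟨_, m, rfl⟩, hm⟩ :=
        (IsLocalization.eq_iff_exists (Submonoid.powers (φ f)) S').1 h1
      refine ⟨m + n, f ^ m * r, ?_⟩
      rw [map_mul, map_pow, pow_add, mul_assoc]
      exact hm.symm
  · rintro ⟨h1, h2⟩
    refine ⟨(injective_iff_map_eq_zero _).2 fun x hx => ?_, fun y => ?_⟩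
    · obtain ⟨n, r, hr⟩ := IsLocalization.Away.surj f x
      have h3 : algebraMap S S' (φ r) = 0 := by rw [← h, ← hr, map_mul, hx, zero_mul]
      obtain ⟨⟨_, m, rfl⟩, hm⟩ :=
        (IsLocalization.map_eq_zero_iff (Submonoid.powers (φ f)) S' _).1 h3
      obtain ⟨k, hk⟩ := h1 (f ^ m * r) (by simpa using hm)
      have h4 : algebraMap R R' f ^ (k + m + n) * x = 0 := by
        have := congrArg (algebraMap R R') hk
        rw [map_mul, map_mul, map_pow, map_pow, ← hr, map_zero] at this
        rw [← this]; ring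
      exact (hu.pow _).mul_right_eq_zero.1 h4
    · obtain ⟨n, s, hs⟩ := IsLocalization.Away.surj (φ f) y
      obtain ⟨m, r, hr⟩ := h2 s
      obtain ⟨v, hv⟩ := (hu.pow (m + n)).exists_left_inv
      refine ⟨v * algebraMap R R' r, ?_⟩
      refine (hu'.pow (m + n)).mul_left_cancel ?_
      have hv' : φ' v * algebraMap S S' (φ f) ^ (m + n) = 1 := by
        rw [← h, ← map_pow, ← map_mul, hv, map_one]
      rw [map_mul, ← mul_assoc, mul_comm (_ ^ _) (φ' _), hv', one_mul, h, hr, map_mul, ← hs,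
        map_pow]
      ring

variable {R S : Type u} [CommRing R] [CommRing S]

/-- For finite homomorphisms of Noetherian rings, being a modification centred at `V(I)` can be
checked one element of `I` at a time. -/
theorem RingHom.isModification_iff [IsNoetherianRing R] (I : Ideal R) (φ : R →+* S) :
    φ.IsModification I ↔ φ.Finite ∧ (∀ s : S, (∀ i ∈ I, φ i * s = 0) → s = 0) ∧
      ∀ f ∈ I, (∀ r, φ r = 0 → ∃ n : ℕ, f ^ n * r = 0) ∧ ∀ s, ∃ n : ℕ, φ f ^ n * s ∈ φ.range := by
  constructor
  · intro h
    refine ⟨h.finite, h.eq_zero_of_mul, fun f hf => ⟨fun r hr => ?_, fun s => ?_⟩⟩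
    · obtain ⟨N, hN⟩ := h.exists_mul_eq_zero r hr
      exact ⟨N, hN _ (Ideal.pow_mem_pow hf N)⟩
    · obtain ⟨N, hN⟩ := h.exists_mul_mem_range
      exact ⟨N, by rw [← map_pow]; exact hN _ (Ideal.pow_mem_pow hf N) s⟩
  · rintro ⟨hfin, htf, h⟩
    refine ⟨hfin, htf, ?_, fun r hr => ?_⟩
    · let _ := φ.toAlgebra
      have : Module.Finite R S := hfin
      -- the conductor of `φ`
      let c : Ideal R := (LinearMap.range (Algebra.linearMap R S)).colon ⊤
      have hc : ∀ x : R, x ∈ c ↔ ∀ s, φ x * s ∈ φ.range := fun x => by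
        rw [Submodule.mem_colon]
        exact ⟨fun h s => by simpa [Algebra.smul_def] using! h s trivial,
          fun h s _ => by simpa [Algebra.smul_def] using! h s⟩
      have hrad : I ≤ c.radical := by
        intro f hf
        obtain ⟨t, ht⟩ := Module.Finite.fg_top (R := R) (M := S)
        choose n hn using (h f hf).2
        refine ⟨t.sup n, (hc _).2 fun s => ?_⟩
        have hs : s ∈ Submodule.span R (t : Set S) := ht ▸ Submodule.mem_top
        induction hs using Submodule.span_induction with
        | mem x hx =>
          obtain ⟨k, hk⟩ := Nat.exists_eq_add_of_le (Finset.le_sup (f := n) hx)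
          rw [hk, add_comm, pow_add, map_mul, mul_assoc, map_pow _ _ (n x)]
          exact φ.range.mul_mem ⟨_, rfl⟩ (hn x)
        | zero => rw [mul_zero]; exact φ.range.zero_mem
        | add x y _ _ hx hy => rw [mul_add]; exact φ.range.add_mem hx hy
        | smul r x _ hx =>
          rw [Algebra.smul_def, mul_left_comm]
          exact φ.range.mul_mem ⟨r, rfl⟩ hx
      obtain ⟨N, hN⟩ := Ideal.exists_pow_le_of_le_radical_of_fg hrad
        (IsNoetherian.noetherian I)
      exact ⟨N, fun x hx => (hc x).1 (hN hx)⟩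
    · let a : Ideal R := (⊥ : Submodule R R).colon {r}
      have hrad : I ≤ a.radical := by
        intro f hf
        obtain ⟨n, hn⟩ := (h f hf).1 r hr
        exact ⟨n, by rw [Submodule.mem_colon_singleton]; exact hn⟩
      obtain ⟨N, hN⟩ := Ideal.exists_pow_le_of_le_radical_of_fg hrad
        (IsNoetherian.noetherian I)
      refine ⟨N, fun x hx => ?_⟩
      have := hN hx
      rwa [Submodule.mem_colon_singleton] at this

end AffineModification

section SchemeDictionary

variable {X Y : Scheme.{u}} (p : Y ⟶ X)

theorem mem_zeroLocus_map_iff {V : X.Opens} (I : Ideal Γ(X, V)) (y : Y) :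
    y ∈ Y.zeroLocus (U := p ⁻¹ᵁ V) (I.map (p.app V).hom) ↔ p y ∈ X.zeroLocus (U := V) I := by
  rw [Ideal.map, Y.zeroLocus_span, Scheme.mem_zeroLocus_iff, Scheme.mem_zeroLocus_iff]
  refine Set.forall_mem_image.trans (forall₂_congr fun i _ => not_congr ?_)
  rw [← Scheme.preimage_basicOpen]
  rfl

theorem forall_associatedPoints_apply_notMem_iff [IsAffineHom p] {V : X.Opens}
    (hV : IsAffineOpen V) [IsNoetherianRing Γ(Y, p ⁻¹ᵁ V)] (I : Ideal Γ(X, V)) :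
    (∀ y ∈ associatedPoints Y, p y ∈ V → p y ∉ X.zeroLocus (U := V) I) ↔
      ∀ s : Γ(Y, p ⁻¹ᵁ V), (∀ i ∈ I, (p.app V).hom i * s = 0) → s = 0 := by
  have h1 := forall_associatedPoints_notMem_iff (hV.preimage p) (I.map (p.app V).hom)
  have h3 : ∀ s, (∀ i ∈ I.map (p.app V).hom, i * s = 0) ↔ ∀ i ∈ I, (p.app V).hom i * s = 0 := by
    refine fun s => ⟨fun h i hi => h _ (Ideal.mem_map_of_mem _ hi), fun h i hi => ?_⟩
    induction hi using Submodule.span_induction with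
    | mem x hx => obtain ⟨i, hi, rfl⟩ := hx; exact h i hi
    | zero => rw [zero_mul]
    | add x y _ _ hx hy => rw [add_mul, hx, hy, add_zero]
    | smul a x _ hx => rw [smul_eq_mul, mul_assoc, hx, mul_zero]
  simp only [mem_zeroLocus_map_iff, h3] at h1
  exact h1

theorem isLocalization_of_eq_basicOpen {V W : Y.Opens} (hV : IsAffineOpen V) (f : Γ(Y, V))
    (hW : W = Y.basicOpen f) (hWV : W ≤ V) :
    @IsLocalization.Away _ _ f Γ(Y, W) _ (Y.presheaf.map (homOfLE hWV).op).hom.toAlgebra := by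
  subst hW
  exact hV.isLocalization_basicOpen f

theorem isIso_morphismRestrict_basicOpen_iff [IsAffineHom p] {V : X.Opens}
    (hV : IsAffineOpen V) (f : Γ(X, V)) :
    IsIso (p ∣_ X.basicOpen f) ↔ (∀ r, (p.app V).hom r = 0 → ∃ n : ℕ, f ^ n * r = 0) ∧
      ∀ s, ∃ n : ℕ, (p.app V).hom f ^ n * s ∈ (p.app V).hom.range := by
  rw [isIso_morphismRestrict_iff_of_isAffineOpen p (hV.basicOpen f)]
  let _ : Algebra Γ(X, V) Γ(X, X.basicOpen f) :=
    (X.presheaf.map (homOfLE (X.basicOpen_le f)).op).hom.toAlgebra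
  let _ : Algebra Γ(Y, p ⁻¹ᵁ V) Γ(Y, p ⁻¹ᵁ X.basicOpen f) :=
    (Y.presheaf.map (homOfLE (p.preimage_mono (X.basicOpen_le f))).op).hom.toAlgebra
  have : IsLocalization.Away f Γ(X, X.basicOpen f) :=
    isLocalization_of_eq_basicOpen hV f rfl (X.basicOpen_le f)
  have : IsLocalization.Away ((p.app V).hom f) Γ(Y, p ⁻¹ᵁ X.basicOpen f) :=
    isLocalization_of_eq_basicOpen (hV.preimage p) _ (Scheme.preimage_basicOpen _ _) _
  refine bijective_localization_away_iff (p.app V).hom f (p.app (X.basicOpen f)).hom fun r => ?_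
  exact congr($(p.naturality (homOfLE (X.basicOpen_le f)).op) r)

/-- A morphism of affine schemes is a finite modification centred at the zero locus of `I` if and
only if the homomorphism on global sections is one. -/
theorem isFiniteModification_iff [IsAffine X] [IsAffine Y] [IsNoetherianRing Γ(X, ⊤)]
    {Z : Closeds X} {I : Ideal Γ(X, ⊤)} (hI : (Z : Set X) = X.zeroLocus (U := ⊤) I) :
    IsFiniteModification p Z ↔ p.appTop.hom.IsModification I := by
  have hT : IsAffineOpen (⊤ : X.Opens) := isAffineOpen_top X
  have h1 : IsFinite p ↔ p.appTop.hom.Finite := by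
    refine ⟨fun h => h.finite_app ⊤ hT, fun h => ?_⟩
    have := (IsFinite.SpecMap_iff p.appTop).2 h
    have hp : p = Y.isoSpec.hom ≫ Spec.map p.appTop ≫ X.isoSpec.inv := by
      rw [← Category.assoc, Scheme.isoSpec_hom_naturality, Category.assoc, Iso.hom_inv_id,
        Category.comp_id]
    rw [hp]
    infer_instance
  have h3 : IsIso (p ∣_ Z.compl) ↔ ∀ f ∈ I, IsIso (p ∣_ X.basicOpen f) := by
    have hle : ∀ f ∈ I, X.basicOpen f ≤ Z.compl := fun f hf x hx hxZ => by
      rw [SetLike.mem_coe, ← SetLike.mem_coe, hI, Scheme.mem_zeroLocus_iff] at hxZ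
      exact hxZ f hf hx
    refine ⟨fun h f hf => isIso_morphismRestrict_of_le p (hle f hf), fun h =>
      isIso_morphismRestrict_of_forall p fun x hx => ?_⟩
    have hx' : x ∉ X.zeroLocus (U := ⊤) I := by rw [← hI]; exact hx
    rw [Scheme.mem_zeroLocus_iff] at hx'
    push Not at hx'
    obtain ⟨f, hf, hxf⟩ := hx'
    exact ⟨X.basicOpen f, hxf, hle f hf, h f hf⟩
  rw [RingHom.isModification_iff]
  have key : p.appTop.hom.Finite → ((∀ y ∈ associatedPoints Y, y ∉ closedPreimage p Z) ↔
      ∀ s : Γ(Y, ⊤), (∀ i ∈ I, p.appTop.hom i * s = 0) → s = 0) := fun hfin => by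
    let _ := p.appTop.hom.toAlgebra
    have : Module.Finite Γ(X, ⊤) Γ(Y, ⊤) := hfin
    have : IsNoetherianRing Γ(Y, ⊤) := IsNoetherianRing.of_finite Γ(X, ⊤) Γ(Y, ⊤)
    have : IsNoetherianRing Γ(Y, p ⁻¹ᵁ ⊤) := this
    refine Iff.trans ?_ (forall_associatedPoints_apply_notMem_iff p hT I)
    refine forall₂_congr fun y _ => ?_
    rw [← hI]
    exact ⟨fun h _ => h, fun h => h trivial⟩
  have h4 : (∀ f ∈ I, IsIso (p ∣_ X.basicOpen f)) ↔
      ∀ f ∈ I, (∀ r, p.appTop.hom r = 0 → ∃ n : ℕ, f ^ n * r = 0) ∧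
        ∀ s, ∃ n : ℕ, p.appTop.hom f ^ n * s ∈ p.appTop.hom.range :=
    forall₂_congr fun f _ => isIso_morphismRestrict_basicOpen_iff p hT f
  constructor
  · rintro ⟨a, b, c⟩
    exact ⟨h1.1 a, (key (h1.1 a)).1 b, h4.1 (h3.1 c)⟩
  · rintro ⟨a, b, c⟩
    exact ⟨h1.2 a, (key a).2 b, h3.2 (h4.2 c)⟩

end SchemeDictionary

/-! ### Topologically normal modifications of semilocal schemes -/

section Transport

variable {R R' S S' : Type u} [CommRing R] [CommRing R'] [CommRing S] [CommRing S']

theorem RingHom.IsModification.equiv_comp {I : Ideal R} {φ : R →+* S} (h : φ.IsModification I)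
    (e : S ≃+* S') : ((e : S →+* S').comp φ).IsModification I := by
  refine ⟨(RingHom.Finite.of_surjective _ e.surjective).comp h.finite, fun s hs => ?_, ?_,
    fun r hr => h.exists_mul_eq_zero r (by simpa using hr)⟩
  · have : e.symm s = 0 := h.eq_zero_of_mul _ fun i hi => e.injective (by simpa using hs i hi)
    simpa using this
  · obtain ⟨N, hN⟩ := h.exists_mul_mem_range
    refine ⟨N, fun x hx s => ?_⟩
    obtain ⟨r, hr⟩ := hN x hx (e.symm s)
    exact ⟨r, by simp [hr]⟩

theorem RingHom.IsModification.comp_equiv {I : Ideal R} (e : R ≃+* R') {φ : R' →+* S}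
    (h : φ.IsModification (I.map (e : R →+* R'))) : (φ.comp (e : R →+* R')).IsModification I := by
  have hpow : ∀ N, ∀ x ∈ I ^ N, e x ∈ (I.map (e : R →+* R')) ^ N := fun N x hx => by
    rw [← Ideal.map_pow]; exact Ideal.mem_map_of_mem (e : R →+* R') hx
  refine ⟨h.finite.comp (RingHom.Finite.of_surjective _ e.surjective), fun s hs =>
    h.eq_zero_of_mul s fun i hi => ?_, ?_, fun r hr => ?_⟩
  · obtain ⟨j, hj, rfl⟩ := (Ideal.mem_map_of_equiv e i).1 hi
    exact hs j hj
  · obtain ⟨N, hN⟩ := h.exists_mul_mem_range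
    refine ⟨N, fun x hx s => ?_⟩
    obtain ⟨r, hr⟩ := hN (e x) (hpow N x hx) s
    exact ⟨e.symm r, by simpa using hr⟩
  · obtain ⟨N, hN⟩ := h.exists_mul_eq_zero (e r) hr
    exact ⟨N, fun x hx => e.injective (by simpa using hN (e x) (hpow N x hx))⟩

end Transport

section SemilocalSchemes

variable {X Y W : Scheme.{u}}

/-- The morphism to an affine scheme given by a homomorphism out of its ring of global sections. -/
noncomputable def specMapToAffine (X : Scheme.{u}) [IsAffine X] {S : Type u} [CommRing S]
    (φ : Γ(X, ⊤) →+* S) : Spec (.of S) ⟶ X :=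
  Spec.map (CommRingCat.ofHom φ) ≫ X.isoSpec.inv

theorem specMapToAffine_appTop [IsAffine X] {S : Type u} [CommRing S] (φ : Γ(X, ⊤) →+* S) :
    (specMapToAffine X φ).appTop.hom =
      ((Scheme.ΓSpecIso (.of S)).symm.commRingCatIsoToRingEquiv : S →+* _).comp φ := by
  have h : (specMapToAffine X φ).appTop = CommRingCat.ofHom φ ≫ (Scheme.ΓSpecIso (.of S)).inv := by
    have h1 : specMapToAffine X φ ≫ X.isoSpec.hom = Spec.map (CommRingCat.ofHom φ) := by
      rw [specMapToAffine, Category.assoc, Iso.inv_hom_id, Category.comp_id]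
    have h2 := congrArg Scheme.Hom.appTop h1
    rw [Scheme.Hom.comp_appTop, Scheme.isoSpec_hom, Scheme.toSpecΓ_appTop] at h2
    rw [Scheme.ΓSpecIso_inv_naturality, ← h2]
    exact ((Scheme.ΓSpecIso Γ(X, ⊤)).inv_hom_id_assoc _).symm
  rw [h]
  rfl

theorem eq_isoSpec_hom_specMapToAffine [IsAffine X] [IsAffine Y] (p : Y ⟶ X) :
    p = Y.isoSpec.hom ≫ specMapToAffine X p.appTop.hom := by
  rw [specMapToAffine, CommRingCat.ofHom_hom, ← Category.assoc, Scheme.isoSpec_hom_naturality,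
    Category.assoc, Iso.hom_inv_id, Category.comp_id]

theorem universallyInjective_iff_isRadicial [IsAffine X] [IsAffine Y] (p : Y ⟶ X) :
    UniversallyInjective p ↔ p.appTop.hom.IsRadicial := by
  have := UniversallyInjective.respectsIso
  rw [← universallyInjective_SpecMap_iff]
  conv_lhs => rw [eq_isoSpec_hom_specMapToAffine p, specMapToAffine]
  rw [MorphismProperty.cancel_left_of_respectsIso (P := @UniversallyInjective),
    MorphismProperty.cancel_right_of_respectsIso (P := @UniversallyInjective)]
  rfl

theorem isUniversalHomeomorphism_of_isRadicial [IsAffine X] [IsAffine Y] (p : Y ⟶ X) [IsFinite p]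
    (hinj : Function.Injective p.appTop.hom) (hrad : p.appTop.hom.IsRadicial) :
    IsUniversalHomeomorphism p := by
  have := (universallyInjective_iff_isRadicial p).2 hrad
  have : Surjective p := by
    have : Surjective (Spec.map p.appTop) :=
      ⟨RingHom.IsIntegral.comap_surjective
        (RingHom.Finite.to_isIntegral (IsFinite.finite_app (f := p) (⊤ : X.Opens) (isAffineOpen_top X))) hinj⟩
    rw [eq_isoSpec_hom_specMapToAffine p, specMapToAffine]
    change Surjective (Y.isoSpec.hom ≫ Spec.map p.appTop ≫ X.isoSpec.inv)
    infer_instance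
  exact .of_isIntegralHom p

/-- Topological normality of a pair of affine schemes without associated points in the centre. -/
theorem isTopologicallyNormalPair_iff [IsAffine Y] [IsNoetherianRing Γ(Y, ⊤)] {Z : Closeds Y}
    {I : Ideal Γ(Y, ⊤)} (hI : (Z : Set Y) = Y.zeroLocus (U := ⊤) I)
    (htf : ∀ s : Γ(Y, ⊤), (∀ i ∈ I, i * s = 0) → s = 0) :
    IsTopologicallyNormalPair Y Z ↔ ∀ (C : Type u) [CommRing C] (φ : Γ(Y, ⊤) →+* C),
      φ.IsModification I → φ.IsRadicial := by
  constructor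
  · intro h C _ φ hφ
    have h1 := (h _ (specMapToAffine Y φ) ((isFiniteModification_iff _ hI).2 (by
      rw [specMapToAffine_appTop]; exact hφ.equiv_comp _))).universallyInjective
    have := UniversallyInjective.respectsIso
    rw [specMapToAffine, MorphismProperty.cancel_right_of_respectsIso (P := @UniversallyInjective),
      universallyInjective_SpecMap_iff] at h1
    exact h1
  · intro h W p hp
    have := hp.isFinite
    have : IsAffine W := isAffine_of_isAffineHom p
    have hm := (isFiniteModification_iff p hI).1 hp
    exact isUniversalHomeomorphism_of_isRadicial p
      (let _ := p.appTop.hom.toAlgebra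
      RingHom.IsModification.injective_of_eq_zero hm htf) (h _ _ hm)

theorem IsFiniteModification.hom_ext [IsAffine X] [IsNoetherianRing Γ(X, ⊤)] {Z : Closeds X}
    {p : Y ⟶ X} {q : W ⟶ X} (hp : IsFiniteModification p Z) (hq : IsFiniteModification q Z)
    {f g : W ⟶ Y} (hf : f ≫ p = q) (hg : g ≫ p = q) : f = g := by
  have := hp.isFinite
  have := hq.isFinite
  have : IsAffine Y := isAffine_of_isAffineHom p
  have : IsAffine W := isAffine_of_isAffineHom q
  obtain ⟨I, hI⟩ := (Scheme.eq_zeroLocus_of_isClosed_of_isAffine X (Z : Set X)).1 Z.isClosed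
  have hp' := (isFiniteModification_iff p hI).1 hp
  have hq' := (isFiniteModification_iff q hI).1 hq
  let _ := p.appTop.hom.toAlgebra
  let _ := q.appTop.hom.toAlgebra
  let f' : Γ(Y, ⊤) →ₐ[Γ(X, ⊤)] Γ(W, ⊤) :=
    { f.appTop.hom with
      commutes' := fun r => by
        have := congr($(congrArg Scheme.Hom.appTop hf) r)
        rw [Scheme.Hom.comp_appTop] at this
        exact this }
  let g' : Γ(Y, ⊤) →ₐ[Γ(X, ⊤)] Γ(W, ⊤) :=
    { g.appTop.hom with
      commutes' := fun r => by
        have := congr($(congrArg Scheme.Hom.appTop hg) r)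
        rw [Scheme.Hom.comp_appTop] at this
        exact this }
  have h : f' = g' := RingHom.IsModification.algHom_ext hp' hq' f' g'
  refine ext_of_isAffine (CommRingCat.hom_ext (RingHom.ext fun x => ?_))
  exact DFunLike.congr_fun h x

theorem IsSemilocalScheme.definesClosedPoints (hX : IsSemilocalScheme X) :
    (Ring.jacobson Γ(X, ⊤)).DefinesClosedPoints ∧
      (hX.center : Set X) = X.zeroLocus (U := ⊤) (Ring.jacobson Γ(X, ⊤)) := by
  have := hX.isAffine
  let e : X ≃ₜ PrimeSpectrum Γ(X, ⊤) := X.isoSpec.hom.homeomorph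
  have hcl : ∀ x, x ∈ closedPoints X ↔ (e x).asIdeal.IsMaximal := fun x => by
    rw [mem_closedPoints_iff, ← PrimeSpectrum.isClosed_singleton_iff_isMaximal,
      ← Set.image_singleton, e.isClosed_image]
  have hfin : Finite (MaximalSpectrum Γ(X, ⊤)) := by
    have := hX.finite_closedPoints.to_subtype
    refine Finite.of_injective (fun m : MaximalSpectrum Γ(X, ⊤) =>
      (⟨e.symm m.toPrimeSpectrum, (hcl _).2 (by rw [e.apply_symm_apply]; exact m.2)⟩ :
        closedPoints X)) fun a b h => ?_
    exact MaximalSpectrum.toPrimeSpectrum_injective (e.symm.injective (congrArg Subtype.val h))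
  have := Fintype.ofFinite (MaximalSpectrum Γ(X, ⊤))
  have hdef : (Ring.jacobson Γ(X, ⊤)).DefinesClosedPoints := by
    refine fun P hP => ⟨fun h => ?_, fun h => Ring.jacobson_le_of_isMaximal P⟩
    have hle : Finset.univ.inf (fun m : MaximalSpectrum Γ(X, ⊤) => m.asIdeal) ≤ P := by
      refine le_trans ?_ h
      rw [← Ideal.jacobson_bot]
      refine le_sInf fun m hm => ?_
      exact Finset.inf_le (f := fun m : MaximalSpectrum Γ(X, ⊤) => m.asIdeal)
        (Finset.mem_univ ⟨m, hm.2⟩)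
    obtain ⟨m, -, hm⟩ := (Ideal.IsPrime.inf_le' hP).1 hle
    have := m.isMaximal.eq_of_le hP.ne_top hm
    exact this ▸ m.isMaximal
  refine ⟨hdef, Set.ext fun x => ?_⟩
  have h1 : X.isoSpec.hom ⁻¹' PrimeSpectrum.zeroLocus (Ring.jacobson Γ(X, ⊤)) = _ :=
    X.toSpecΓ_preimage_zeroLocus _
  rw [← h1]
  exact (hcl x).trans (hdef _ (e x).2).symm

/-- A semilocal Noetherian scheme has an unramified smallest topologically normal punctual
modification. -/
theorem exists_isSmallestTopologicallyNormalPunctualModification [IsNoetherian X]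
    (hX : IsSemilocalScheme X) : ∃ (X' : Scheme.{u}) (π : X' ⟶ X),
      FormallyUnramified π ∧ IsSmallestTopologicallyNormalPunctualModification hX π := by
  have := hX.isAffine
  have : IsNoetherianRing Γ(X, ⊤) := IsLocallyNoetherian.component_noetherian ⟨⊤, isAffineOpen_top X⟩
  obtain ⟨hdef, hcenter⟩ := hX.definesClosedPoints
  have hcl : ∀ {Y : Scheme.{u}} (p : Y ⟶ X), (closedPreimage p hX.center : Set Y) =
      Y.zeroLocus (U := ⊤) ((Ring.jacobson Γ(X, ⊤)).map p.appTop.hom) := fun p => by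
    ext y
    refine Iff.trans ?_ (mem_zeroLocus_map_iff p (V := ⊤) (Ring.jacobson Γ(X, ⊤)) y).symm
    rw [← hcenter]
    rfl
  obtain ⟨S, _, _, hS, hSu, hSn, hSmin⟩ := exists_smallest_modification hdef
  let R := Γ(X, ⊤)
  let J := Ring.jacobson Γ(X, ⊤)
  have hmod : ∀ {Y : Scheme.{u}} {p : Y ⟶ X}, IsFiniteModification p hX.center →
      IsAffine Y ∧ IsNoetherianRing Γ(Y, ⊤) ∧ p.appTop.hom.IsModification J := by
    intro Y p hp
    have := hp.isFinite
    have : IsAffine Y := isAffine_of_isAffineHom p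
    have hm := (isFiniteModification_iff p hcenter).1 hp
    let _ := p.appTop.hom.toAlgebra
    have : Module.Finite Γ(X, ⊤) Γ(Y, ⊤) := hm.finite
    exact ⟨‹_›, IsNoetherianRing.of_finite Γ(X, ⊤) Γ(Y, ⊤), hm⟩
  -- topological normality of a modification, in terms of rings
  have hnorm : ∀ {Y : Scheme.{u}} (p : Y ⟶ X), IsFiniteModification p hX.center →
      (IsTopologicallyNormalPair Y (closedPreimage p hX.center) ↔
        ∀ (C : Type u) [CommRing C] (φ : Γ(Y, ⊤) →+* C),
          φ.IsModification (J.map p.appTop.hom) → φ.IsRadicial) := by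
    intro Y p hp
    obtain ⟨_, _, hm⟩ := hmod hp
    refine isTopologicallyNormalPair_iff (hcl p) fun s hs => hm.eq_zero_of_mul s fun i hi =>
      hs _ (Ideal.mem_map_of_mem _ hi)
  let π := specMapToAffine X (algebraMap _ S)
  let e : S ≃+* Γ(Spec (.of S), ⊤) := (Scheme.ΓSpecIso (.of S)).symm.commRingCatIsoToRingEquiv
  have hπ : π.appTop.hom = (e : S →+* _).comp (algebraMap _ S) := specMapToAffine_appTop _
  have hπm : IsFiniteModification π hX.center :=
    (isFiniteModification_iff π hcenter).2 (by rw [hπ]; exact hS.equiv_comp e)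
  refine ⟨Spec (.of S), π, ?_, ⟨⟨hπm, (hnorm π hπm).2 fun C _ φ hφ => ?_⟩, fun W q hq => ?_⟩⟩
  · have : AlgebraicGeometry.FormallyUnramified
        (Spec.map (CommRingCat.ofHom (algebraMap Γ(X, ⊤) S))) := by
      rw [HasRingHomProperty.Spec_iff (P := @AlgebraicGeometry.FormallyUnramified)]
      exact RingHom.formallyUnramified_algebraMap.2 hSu
    exact MorphismProperty.comp_mem @AlgebraicGeometry.FormallyUnramified _ X.isoSpec.inv this
      inferInstance
  · rw [hπ, ← Ideal.map_map] at hφ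
    let _ := (φ.comp (e : S →+* _)).toAlgebra
    have hrad := hSn C (hφ.comp_equiv e)
    intro K _ f g hfg
    exact hrad K f g (by
      change f.comp (φ.comp _) = g.comp (φ.comp _)
      rw [← RingHom.comp_assoc, hfg, RingHom.comp_assoc])
  · obtain ⟨_, _, hm⟩ := hmod hq.1
    let _ := q.appTop.hom.toAlgebra
    obtain ⟨h⟩ := hSmin Γ(W, ⊤) hm fun C _ _ hC => (hnorm q hq.1).1 hq.2 C _ hC
    refine ⟨W.isoSpec.hom ≫ Spec.map (CommRingCat.ofHom (h : S →+* Γ(W, ⊤))), ?_⟩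
    have hcomp : (h : S →+* Γ(W, ⊤)).comp (algebraMap _ S) = q.appTop.hom := h.comp_algebraMap
    conv_rhs => rw [eq_isoSpec_hom_specMapToAffine q, ← hcomp]
    simp only [π, specMapToAffine, CommRingCat.ofHom_comp, Spec.map_comp, Category.assoc]

/-- Two smallest topologically normal punctual modifications are isomorphic by a unique
isomorphism over the base. -/
theorem IsSmallestTopologicallyNormalPunctualModification.existsUnique_iso [IsNoetherian X]
    {hX : IsSemilocalScheme X} {p : Y ⟶ X} {q : W ⟶ X}
    (hp : IsSmallestTopologicallyNormalPunctualModification hX p)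
    (hq : IsSmallestTopologicallyNormalPunctualModification hX q) :
    ∃! e : W ≅ Y, e.hom ≫ p = q := by
  have := hX.isAffine
  have : IsNoetherianRing Γ(X, ⊤) := IsLocallyNoetherian.component_noetherian ⟨⊤, isAffineOpen_top X⟩
  have hp' : IsFiniteModification p hX.center := hp.1.1
  have hq' : IsFiniteModification q hX.center := hq.1.1
  obtain ⟨a, ha⟩ := hp.exists_factor W q hq.1
  obtain ⟨b, hb⟩ := hq.exists_factor Y p hp.1
  have hab : a ≫ b = 𝟙 W := hq'.hom_ext hq' (by rw [Category.assoc, hb, ha]) (Category.id_comp q)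
  have hba : b ≫ a = 𝟙 Y := hp'.hom_ext hp' (by rw [Category.assoc, ha, hb]) (Category.id_comp p)
  exact ⟨⟨a, b, hab, hba⟩, ha, fun e he => Iso.ext (hp'.hom_ext hq' he ha)⟩

end SemilocalSchemes

/-! ### Radicial homomorphisms from idempotents -/

section RadicialOfIdempotents

open TensorProduct Polynomial

/-- An element of a field `K` that is integral over a ring `R` becomes, after a Frobenius power and
a scaling by `R`, a simple root of a monic polynomial over `R`. -/
theorem exists_monic_simple_root {R K : Type*} [CommRing R] [Field K] (ι : R →+* K) (q : ℕ)
    [ExpChar K q] {α : K} (hα : ι.IsIntegralElem α) :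
    ∃ (n : ℕ) (c : R) (F : R[X]), ι c ≠ 0 ∧ F.Monic ∧ F.eval₂ ι (ι c * α ^ q ^ n) = 0 ∧
      F.derivative.eval₂ ι (ι c * α ^ q ^ n) ≠ 0 := by
  let D := ι.range
  let k := FractionRing D
  let _ : Algebra k K := FractionRing.liftAlgebra D K
  have : IsScalarTower D k K := FractionRing.isScalarTower_liftAlgebra D K
  have : ExpChar k q := (algebraMap k K).expChar (algebraMap k K).injective q
  have hint : IsIntegral k α := by
    obtain ⟨P, hP, hP0⟩ := hα
    refine IsIntegral.tower_top (R := D) ⟨P.map ι.rangeRestrict, hP.map _, ?_⟩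
    rw [Polynomial.eval₂_map]
    exact hP0
  obtain ⟨g, hg, n, hgn⟩ := (minpoly.irreducible hint).hasSeparableContraction q
  have hg0 : aeval (α ^ q ^ n) g = 0 := by
    have := minpoly.aeval k α
    rwa [← hgn, expand_aeval] at this
  have hg1 : aeval (α ^ q ^ n) (derivative g) ≠ 0 := hg.aeval_derivative_ne_zero hg0
  obtain ⟨b, hbD, hb⟩ := IsLocalization.integerNormalization_spec (nonZeroDivisors D) g
  set G := IsLocalization.integerNormalization (nonZeroDivisors D) g with hG
  have hbK : algebraMap D K b ≠ 0 := fun h =>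
    nonZeroDivisors.ne_zero hbD (Subtype.val_injective h)
  have hev : ∀ P : D[X], ∀ x : K, P.eval₂ (algebraMap D K) x = aeval x (P.map (algebraMap D k)) :=
    fun P x => by rw [aeval_map_algebraMap]; rfl
  have hG0 : G.eval₂ (algebraMap D K) (α ^ q ^ n) = 0 := by
    rw [hev, hb, ← IsScalarTower.algebraMap_smul k b g, map_smul, hg0, smul_zero]
  have hG1 : (derivative G).eval₂ (algebraMap D K) (α ^ q ^ n) ≠ 0 := by
    rw [hev, ← derivative_map, hb, derivative_smul,
      ← IsScalarTower.algebraMap_smul k b (derivative g), map_smul, Algebra.smul_def,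
      ← IsScalarTower.algebraMap_apply D k K]
    exact mul_ne_zero hbK hg1
  have hGne : G ≠ 0 := fun h => hG1 (by rw [h]; simp)
  have hdeg : 1 ≤ G.natDegree := by
    by_contra hlt
    have : G.natDegree = 0 := by omega
    rw [Polynomial.eq_C_of_natDegree_eq_zero this] at hG1
    simp at hG1
  set β := α ^ q ^ n with hβ
  -- pass to a monic polynomial by scaling the variable by the leading coefficient
  let H := G.integralNormalization
  have hHmonic : H.Monic := monic_integralNormalization hGne
  have hc0 : algebraMap D K G.leadingCoeff ≠ 0 := fun h =>
    leadingCoeff_ne_zero.2 hGne (Subtype.val_injective h)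
  have hH0 : H.eval₂ (algebraMap D K) (algebraMap D K G.leadingCoeff * β) = 0 := by
    rw [integralNormalization_eval₂_leadingCoeff_mul hdeg, hG0, mul_zero]
  have hcomp := integralNormalization_eval₂_leadingCoeff_mul hdeg
    ((C : K →+* K[X]).comp (algebraMap D K)) X
  have hH1 : (derivative H).eval₂ (algebraMap D K) (algebraMap D K G.leadingCoeff * β) ≠ 0 := by
    have h1 : (H.map (algebraMap D K)).comp (C (algebraMap D K G.leadingCoeff) * X) =
        C (algebraMap D K G.leadingCoeff) ^ (G.natDegree - 1) * G.map (algebraMap D K) := by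
      rw [Polynomial.comp, Polynomial.eval₂_map]
      exact hcomp
    have h2 := congrArg (fun P => Polynomial.eval β (derivative P)) h1
    simp only [derivative_comp, derivative_mul, derivative_C, derivative_X, ← C_pow, zero_mul,
      zero_add, mul_one, Polynomial.eval_mul, Polynomial.eval_C, Polynomial.eval_comp,
      Polynomial.eval_X, derivative_map, Polynomial.eval_map] at h2
    intro h
    rw [h, mul_zero] at h2
    exact mul_ne_zero (pow_ne_zero _ hc0) hG1 h2.symm
  have hsurj : Function.Surjective ι.rangeRestrict := ι.rangeRestrict_surjective
  obtain ⟨c, hc⟩ := hsurj G.leadingCoeff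
  obtain ⟨F, hF, -, hFm⟩ := lifts_and_natDegree_eq_and_monic (f := ι.rangeRestrict)
    ((mem_lifts H).2 (Polynomial.map_surjective _ hsurj H)) hHmonic
  have hcι : ι c = algebraMap D K G.leadingCoeff := congrArg Subtype.val hc
  have hι : ι = (algebraMap D K).comp ι.rangeRestrict := rfl
  refine ⟨n, c, F, hcι ▸ hc0, hFm, ?_, ?_⟩
  · rw [hcι, hι, ← Polynomial.eval₂_map, hF, hH0]
  · rw [hcι, hι, ← Polynomial.eval₂_map, ← derivative_map, hF]
    exact hH1

variable {R B C : Type u} [CommRing R] [CommRing B] [CommRing C] [Algebra R B] [Algebra R C]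

theorem TensorProduct.apply_eq_of_mem_range_map_val {R' K : Type u} [CommRing R'] [Algebra R R']
    [Field K] {A : Subalgebra R B} {f g : R' ⊗[R] B →+* K}
    (h : ∀ r, ∀ a ∈ A, f (r ⊗ₜ a) = g (r ⊗ₜ a)) {x : R' ⊗[R] B}
    (hx : x ∈ LinearMap.range (LinearMap.lTensor R' A.val.toLinearMap)) : f x = g x := by
  obtain ⟨y, rfl⟩ := hx
  induction y with
  | zero => simp
  | add a b ha hb => rw [map_add, map_add, map_add, ha, hb]
  | tmul r a => exact h r a a.2

/-- The idempotents of `R' ⊗ B` come from `R' ⊗ A` for every étale `R`-algebra `R'`. -/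
def Subalgebra.ContainsEtaleIdempotents (A : Subalgebra R B) : Prop :=
  ∀ (R' : Type u) [CommRing R'] [Algebra R R'] [Algebra.Etale R R'] (e : R' ⊗[R] B),
    IsIdempotentElem e → e ∈ LinearMap.range (LinearMap.lTensor R' A.val.toLinearMap)

/-- If the étale-local idempotents of a finite algebra come from a subalgebra, then homomorphisms to
a field which agree on the subalgebra have the same kernel. -/
theorem Subalgebra.ContainsEtaleIdempotents.ker_eq [Module.Finite R B] {A : Subalgebra R B}
    (hA : A.ContainsEtaleIdempotents) (R₁ : Type u) [CommRing R₁] [Algebra R R₁]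
    [Algebra.Etale R R₁] {K : Type u} [Field K] (f g : R₁ ⊗[R] B →+* K)
    (h : ∀ r, ∀ a ∈ A, f (r ⊗ₜ a) = g (r ⊗ₜ a)) : RingHom.ker f = RingHom.ker g := by
  let ι : R₁ →+* K := f.comp (algebraMap R₁ (R₁ ⊗[R] B))
  have hι : g.comp (algebraMap R₁ (R₁ ⊗[R] B)) = ι := RingHom.ext fun r => (h r 1 A.one_mem).symm
  let p := RingHom.ker ι
  have hp : p.IsPrime := RingHom.ker_isPrime ι
  obtain ⟨R₂, _, _, _, P, _, _, n, e, he, P', _, _, hbij, -, huniq⟩ :=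
    Algebra.exists_etale_completeOrthogonalIdempotents_forall_liesOver_eq (S := R₁ ⊗[R] B) p
  let ψ : p.ResidueField →+* K := Ideal.ResidueField.lift p ι le_rfl fun x hx =>
    isUnit_iff_ne_zero.2 hx
  let eqv := RingEquiv.ofBijective _ hbij
  let φ : R₂ →+* K := (ψ.comp (eqv.symm : P.ResidueField →+* p.ResidueField)).comp
    (algebraMap R₂ P.ResidueField)
  have hφ : ∀ r, φ (algebraMap R₁ R₂ r) = ι r := fun r => by
    have h1 : eqv.symm (algebraMap R₂ P.ResidueField (algebraMap R₁ R₂ r)) =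
        algebraMap R₁ p.ResidueField r := by
      rw [RingEquiv.symm_apply_eq, ← IsScalarTower.algebraMap_apply]
      exact (AlgHom.commutes (Ideal.ResidueField.mapₐ p P _ (P.over_def p)) r).symm
    change ψ (eqv.symm _) = _
    rw [h1]
    exact Ideal.ResidueField.lift_algebraMap ..
  have hφker : RingHom.ker φ = P := by
    rw [RingHom.ker_comp_of_injective _ (RingHom.injective _),
      Ideal.ker_algebraMap_residueField]
  let _ : Algebra R₁ K := ι.toAlgebra
  let φ' : R₂ →ₐ[R₁] K := { φ with commutes' := hφ }
  let f' : R₁ ⊗[R] B →ₐ[R₁] K := { f with commutes' := fun r => rfl }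
  let g' : R₁ ⊗[R] B →ₐ[R₁] K := { g with commutes' := fun r => RingHom.congr_fun hι r }
  let F : R₂ ⊗[R₁] (R₁ ⊗[R] B) →ₐ[R₁] K := Algebra.TensorProduct.lift φ' f' fun _ _ => .all _ _
  let G : R₂ ⊗[R₁] (R₁ ⊗[R] B) →ₐ[R₁] K := Algebra.TensorProduct.lift φ' g' fun _ _ => .all _ _
  let _ : Algebra R R₂ := ((algebraMap R₁ R₂).comp (algebraMap R R₁)).toAlgebra
  have : IsScalarTower R R₁ R₂ := .of_algebraMap_eq' rfl
  have : Algebra.Etale R R₂ := Algebra.Etale.comp R R₁ R₂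
  let c := Algebra.TensorProduct.cancelBaseChange R R₁ R₁ R₂ B
  have hFG : ∀ i, F (e i) = G (e i) := fun i => by
    have h1 := TensorProduct.apply_eq_of_mem_range_map_val
      (f := (F : _ →+* K).comp c.symm.toRingEquiv.toRingHom) (g := (G : _ →+* K).comp c.symm.toRingEquiv.toRingHom)
      (A := A) (fun r a ha => ?_) (hA R₂ (c (e i)) ((he.idem i).map c))
    · simpa using h1
    · simp [c, F, G, φ', f', g', h 1 a ha]
  have hlies : ∀ H : R₂ ⊗[R₁] (R₁ ⊗[R] B) →ₐ[R₁] K, (∀ r, H (r ⊗ₜ 1) = φ r) →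
      (RingHom.ker H).LiesOver P := fun H hH => ⟨by
    rw [← hφker]
    ext r
    exact (Iff.of_eq (congrArg (· = 0) (hH r))).symm⟩
  have hFl := hlies F fun r => by simp [F, φ']
  have hGl := hlies G fun r => by simp [G, φ']
  have hFp : (RingHom.ker F).IsPrime := RingHom.ker_isPrime F
  have hGp : (RingHom.ker G).IsPrime := RingHom.ker_isPrime G
  have hker : RingHom.ker F = RingHom.ker G := by
    have hsum : ∑ i, F (e i) = 1 := by rw [← map_sum, he.complete, map_one]
    obtain ⟨i, hi⟩ : ∃ i, F (e i) ≠ 0 := by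
      by_contra! hall
      simp [hall] at hsum
    obtain ⟨hlast, hF⟩ := huniq _ hFp hFl
    obtain ⟨-, hG⟩ := huniq _ hGp hGl
    induction i using Fin.lastCases with
    | last => exact absurd hlast hi
    | cast j => rw [hF j hi, hG j (by rw [RingHom.mem_ker, ← hFG]; exact hi)]
  ext x
  have hx := Ideal.ext_iff.1 hker ((1 : R₂) ⊗ₜ x)
  simpa [RingHom.mem_ker, F, G, f', g'] using hx

/-- A finite algebra whose étale-local idempotents come from a subalgebra is radicial over that
subalgebra. Equality of two homomorphisms `f` and `g` to a field at an element `b` which is a simple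
root of a monic polynomial `F` is seen after the base change to the étale algebra `R[x]_{F'}/(F)`:
the extensions of `f` and `g` with `x ↦ f b` have the same kernel, and it contains `x - b`. -/
theorem Subalgebra.ContainsEtaleIdempotents.isRadicial [Module.Finite R B] {A : Subalgebra R B}
    (hA : A.ContainsEtaleIdempotents) : A.val.toRingHom.IsRadicial := by
  intro K _ f g hfg
  have hA' : ∀ a ∈ A, f a = g a := fun a ha => RingHom.congr_fun hfg ⟨a, ha⟩
  let ι : R →+* K := f.comp (algebraMap R B)
  have hι : g.comp (algebraMap R B) = ι :=
    RingHom.ext fun r => (hA' _ (A.algebraMap_mem r)).symm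
  have key : ∀ (b : B) (F : R[X]), F.Monic → F.eval₂ ι (f b) = 0 →
      F.derivative.eval₂ ι (f b) ≠ 0 → f b = g b := by
    intro b F hF h0 h1
    let S : StandardEtalePair R := ⟨F, hF, F.derivative, 1, 0, 1, by simp⟩
    let _ : Algebra R K := ι.toAlgebra
    let θ : S.Ring →ₐ[R] K := S.lift (f b) ⟨h0, isUnit_iff_ne_zero.2 h1⟩
    have hθ : θ S.X = f b := S.lift_X _ _
    let f' : B →ₐ[R] K := { f with commutes' := fun r => rfl }
    let g' : B →ₐ[R] K := { g with commutes' := fun r => RingHom.congr_fun hι r }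
    let f₁ : S.Ring ⊗[R] B →ₐ[R] K := Algebra.TensorProduct.lift θ f' fun _ _ => .all _ _
    let g₁ : S.Ring ⊗[R] B →ₐ[R] K := Algebra.TensorProduct.lift θ g' fun _ _ => .all _ _
    have hker := hA.ker_eq S.Ring f₁.toRingHom g₁.toRingHom fun r a ha => by
      simp [f₁, g₁, f', g', hA' a ha]
    have hmem : S.X ⊗ₜ 1 - 1 ⊗ₜ b ∈ RingHom.ker f₁.toRingHom := by
      simp [RingHom.mem_ker, f₁, f', hθ]
    rw [hker] at hmem
    have : θ S.X - g b = 0 := by simpa [RingHom.mem_ker, g₁, g'] using hmem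
    rw [← hθ]
    exact sub_eq_zero.1 this
  ext b
  obtain ⟨q, hq⟩ := ExpChar.exists K
  have hint : ι.IsIntegralElem (f b) := by
    obtain ⟨P, hP, hP0⟩ := Algebra.IsIntegral.isIntegral (R := R) b
    exact ⟨P, hP, by rw [← Polynomial.hom_eval₂, hP0, map_zero]⟩
  obtain ⟨n, c, F, hc, hF, h0, h1⟩ := exists_monic_simple_root ι q hint
  have hfb : f (algebraMap R B c * b ^ q ^ n) = ι c * f b ^ q ^ n := by
    rw [map_mul, map_pow]; rfl
  have hgb : g (algebraMap R B c * b ^ q ^ n) = ι c * g b ^ q ^ n := by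
    rw [map_mul, map_pow, ← hι]; rfl
  have h2 := key _ F hF (by rwa [hfb]) (by rwa [hfb])
  rw [hfb, hgb] at h2
  exact iterateFrobenius_inj K q n (by
    simpa [iterateFrobenius_def] using mul_left_cancel₀ hc h2)

theorem exists_isIdempotentElem_map_eq_of_isHomeomorph {D E : Type*} [CommRing D] [CommRing E]
    {φ : D →+* E} (h : IsHomeomorph (PrimeSpectrum.comap φ)) {e : E} (he : IsIdempotentElem e) :
    ∃ d, IsIdempotentElem d ∧ φ d = e := by
  have he' : IsClopen (PrimeSpectrum.basicOpen e : Set (PrimeSpectrum E)) :=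
    PrimeSpectrum.isClopen_iff.2 ⟨e, he, rfl⟩
  obtain ⟨d, hd, hd'⟩ := PrimeSpectrum.exists_idempotent_basicOpen_eq_of_isClopen
    (s := PrimeSpectrum.comap φ '' PrimeSpectrum.basicOpen e)
    ⟨h.isClosedMap _ he'.1, h.isOpenMap _ he'.2⟩
  refine ⟨d, hd, PrimeSpectrum.basicOpen_injOn_isIdempotentElem (hd.map φ) he ?_⟩
  refine TopologicalSpace.Opens.ext (Set.ext fun p => ?_)
  have h1 : p ∈ (PrimeSpectrum.basicOpen (φ d) : Set _) ↔
      PrimeSpectrum.comap φ p ∈ (PrimeSpectrum.basicOpen d : Set _) := Iff.rfl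
  rw [h1, ← hd', h.injective.mem_set_image]

theorem eq_of_isIdempotentElem_of_isHomeomorph {D E : Type*} [CommRing D] [CommRing E]
    {φ : D →+* E} (h : IsHomeomorph (PrimeSpectrum.comap φ)) {d d' : D} (hd : IsIdempotentElem d)
    (hd' : IsIdempotentElem d') (hdd' : φ d = φ d') : d = d' := by
  refine PrimeSpectrum.basicOpen_injOn_isIdempotentElem hd hd' ?_
  ext p
  obtain ⟨q, rfl⟩ := h.surjective p
  change φ d ∉ q.asIdeal ↔ φ d' ∉ q.asIdeal
  rw [hdd']

/-- The situation of a cover `Spec C` of an open subset of `Spec R` over which `Spec B` is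
universally homeomorphic to the base. An idempotent of `R' ⊗ B` extends over this subset, and so
comes from the subalgebra of all elements of `B` that descend over the open subset. -/
theorem Subalgebra.containsEtaleIdempotents_of_isHomeomorph
    (H : ∀ (D : Type u) [CommRing D] [Algebra R D], (C →ₐ[R] D) →
      IsHomeomorph (PrimeSpectrum.comap (algebraMap D (D ⊗[R] B)))) (A : Subalgebra R B)
    (hA : ∀ (c : C) (b : B), c ⊗ₜ[R] (1 : C) = 1 ⊗ₜ c → c ⊗ₜ[R] (1 : B) = 1 ⊗ₜ b → b ∈ A) :
    A.ContainsEtaleIdempotents := by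
  intro R' _ _ _ e he
  have : Module.Flat R R' := inferInstance
  -- the three homomorphisms of the diagram `A ⟶ C × B ⟶ (C ⊗ C) × (C ⊗ B)`
  let i₁ : C →ₐ[R] C ⊗[R] C := Algebra.TensorProduct.includeLeft
  let i₂ : C →ₐ[R] C ⊗[R] C := Algebra.TensorProduct.includeRight
  let jC : C →ₐ[R] C ⊗[R] B := Algebra.TensorProduct.includeLeft
  let jB : B →ₐ[R] C ⊗[R] B := Algebra.TensorProduct.includeRight
  let δ : C × B →ₗ[R] (C ⊗[R] C) × (C ⊗[R] B) :=
    (LinearMap.prod ((i₁.toLinearMap - i₂.toLinearMap) ∘ₗ LinearMap.fst R C B)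
      (jC.toLinearMap ∘ₗ LinearMap.fst R C B - jB.toLinearMap ∘ₗ LinearMap.snd R C B))
  let m {S T : Type u} [CommRing S] [CommRing T] [Algebra R S] [Algebra R T] (f : S →ₐ[R] T) :
    R' ⊗[R] S →ₐ[R] R' ⊗[R] T := Algebra.TensorProduct.map (AlgHom.id R R') f
  let α : R' ⊗[R] (C ⊗[R] B) ≃ₐ[R] (R' ⊗[R] C) ⊗[R] B :=
    (Algebra.TensorProduct.assoc R R R R' C B).symm
  have hα : ∀ d : R' ⊗[R] C, α (m jC d) = d ⊗ₜ 1 := fun d => by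
    have : α.toAlgHom.comp (m jC) = Algebra.TensorProduct.includeLeft := by
      ext x <;> simp [m, α, jC]
    exact AlgHom.congr_fun this d
  obtain ⟨d, hd, hde⟩ : ∃ d : R' ⊗[R] C, IsIdempotentElem d ∧ m jC d = m jB e := by
    have he' : IsIdempotentElem (α (m jB e)) := (he.map (m jB)).map α
    obtain ⟨d, hd, hd'⟩ := exists_isIdempotentElem_map_eq_of_isHomeomorph
      (H (R' ⊗[R] C) Algebra.TensorProduct.includeRight) he'
    exact ⟨d, hd, α.injective ((hα d).trans hd')⟩
  have hd2 : m i₁ d = m i₂ d := by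
    refine eq_of_isIdempotentElem_of_isHomeomorph
      (H (R' ⊗[R] (C ⊗[R] C)) (Algebra.TensorProduct.includeRight.comp i₁)) (hd.map (m i₁))
      (hd.map (m i₂)) ?_
    let t (i : C →ₐ[R] C ⊗[R] C) : (R' ⊗[R] C) ⊗[R] B →ₐ[R] (R' ⊗[R] (C ⊗[R] C)) ⊗[R] B :=
      Algebra.TensorProduct.map (m i) (AlgHom.id R B)
    have ht : ∀ i, m i d ⊗ₜ[R] (1 : B) = t i (α (m jB e)) := fun i => by
      rw [← hde, hα d]
      exact (Algebra.TensorProduct.map_tmul (m i) (AlgHom.id R B) d 1).symm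
    have ht' : ((t i₁).comp α.toAlgHom).comp (m jB) = ((t i₂).comp α.toAlgHom).comp (m jB) := by
      ext x <;> simp [t, m, α, jB]
    exact (ht i₁).trans ((AlgHom.congr_fun ht' e).trans (ht i₂).symm)
  let z : R' ⊗[R] (C × B) := LinearMap.lTensor R' (LinearMap.inl R C B) d +
    LinearMap.lTensor R' (LinearMap.inr R C B) e
  have hz : LinearMap.lTensor R' δ z = 0 := by
    have h1 : δ ∘ₗ LinearMap.inl R C B =
        LinearMap.inl R _ _ ∘ₗ (i₁.toLinearMap - i₂.toLinearMap) +
          LinearMap.inr R _ _ ∘ₗ jC.toLinearMap := by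
      ext <;> simp [δ]
    have h2 : δ ∘ₗ LinearMap.inr R C B = - (LinearMap.inr R _ _ ∘ₗ jB.toLinearMap) := by
      ext <;> simp [δ]
    have h3 : LinearMap.lTensor R' i₁.toLinearMap d = LinearMap.lTensor R' i₂.toLinearMap d := hd2
    have h4 : LinearMap.lTensor R' jC.toLinearMap d = LinearMap.lTensor R' jB.toLinearMap e := hde
    simp only [z, map_add, ← LinearMap.comp_apply, ← LinearMap.lTensor_comp, h1, h2,
      LinearMap.lTensor_add, LinearMap.add_apply, LinearMap.lTensor_neg, LinearMap.neg_apply]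
    simp only [LinearMap.lTensor_comp, LinearMap.comp_apply, LinearMap.lTensor_sub,
      LinearMap.sub_apply, h3, h4, sub_self, map_zero, zero_add, add_neg_cancel]
  have hex : Function.Exact (LinearMap.lTensor R' (LinearMap.ker δ).subtype)
      (LinearMap.lTensor R' δ) := Module.Flat.lTensor_exact R' (LinearMap.exact_subtype_ker_map δ)
  obtain ⟨y, hy⟩ := (hex z).1 hz
  let s : LinearMap.ker δ →ₗ[R] A := LinearMap.codRestrict (Subalgebra.toSubmodule A)
    (LinearMap.snd R C B ∘ₗ (LinearMap.ker δ).subtype) fun x => by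
      obtain ⟨⟨c, b⟩, hx⟩ := x
      have hx' := Prod.ext_iff.1 (LinearMap.mem_ker.1 hx)
      exact hA c b (sub_eq_zero.1 hx'.1) (sub_eq_zero.1 hx'.2)
  refine ⟨LinearMap.lTensor R' s y, ?_⟩
  have hs : A.val.toLinearMap ∘ₗ s = LinearMap.snd R C B ∘ₗ (LinearMap.ker δ).subtype := rfl
  rw [← LinearMap.comp_apply, ← LinearMap.lTensor_comp, hs, LinearMap.lTensor_comp,
    LinearMap.comp_apply, hy]
  simp only [z, map_add, ← LinearMap.comp_apply, ← LinearMap.lTensor_comp,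
    LinearMap.snd_comp_inl, LinearMap.snd_comp_inr]
  simp

end RadicialOfIdempotents

/-! ### Gluing the spectra of a quasi-coherent algebra -/

section RelativeSpec

open Limits Scheme Scheme.AffineZariskiSite

/-- A factorization of `g` on sections over an affine open is one of the restriction of `g` over
it. -/
theorem toSpecΓ_SpecMap_fromSpec {X Y : Scheme.{u}} (g : Y ⟶ X) {V : X.Opens}
    (hV : IsAffineOpen V) {A : CommRingCat.{u}} (a : Γ(X, V) ⟶ A) (b : A ⟶ Γ(Y, g ⁻¹ᵁ V))
    (h : a ≫ b = g.app V) : (g ⁻¹ᵁ V).toSpecΓ ≫ Spec.map b ≫ Spec.map a ≫ hV.fromSpec =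
      (g ⁻¹ᵁ V).ι ≫ g := by
  rw [← Spec.map_comp_assoc, h]
  simp

/-- The relative spectrum of a quasi-coherent algebra `F`, given on affine opens and their basic
opens, together with the morphism from `Y` defined by compatible homomorphisms from `F` to the
sections of `Y`. The spectrum of `F V` is a chart over `V`. -/
theorem exists_glued_spec {X Y : Scheme.{u}} (g : Y ⟶ X)
    (F : X.AffineZariskiSiteᵒᵖ ⥤ CommRingCat.{u})
    (α : (AffineZariskiSite.toOpensFunctor X).op ⋙ X.presheaf ⟶ F) (H : α.Coequifibered)
    (β : ∀ V : X.AffineZariskiSite, F.obj (.op V) ⟶ Γ(Y, g ⁻¹ᵁ V.1))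
    (hβ : ∀ (V W : X.AffineZariskiSite) (h : V ≤ W), F.map (homOfLE h).op ≫ β V =
      β W ≫ Y.presheaf.map (homOfLE (g.preimage_mono (toOpens_mono h))).op)
    (hαβ : ∀ V : X.AffineZariskiSite, α.app (.op V) ≫ β V = g.app V.1) :
    ∃ (X' : Scheme.{u}) (g' : Y ⟶ X') (π : X' ⟶ X), g' ≫ π = g ∧
      ∀ V : X.AffineZariskiSite, ∃ (j : Spec (F.obj (.op V)) ⟶ X') (_ : IsOpenImmersion j),
        j.opensRange = π ⁻¹ᵁ V.1 ∧ j ≫ π = Spec.map (α.app (.op V)) ≫ V.2.fromSpec ∧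
        (g ⁻¹ᵁ V.1).ι ≫ g' = (g ⁻¹ᵁ V.1).toSpecΓ ≫ Spec.map (β V) ≫ j := by
  let d := relativeGluingData H
  have : (d.functor ⋙ forget).IsLocallyDirected :=
    Cover.RelativeGluingData.instIsLocallyDirectedI₀CompFunctorForgetOfIsThin ..
  obtain ⟨j, hj, hjd⟩ : ∃ (j : ∀ V : X.AffineZariskiSite, Spec (F.obj (.op V)) ⟶ d.glued)
    (_ : ∀ V, IsOpenImmersion (j V)), j = d.cover.f :=
    ⟨d.cover.f, fun V => d.cover.map_prop V, rfl⟩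
  have hbase : ∀ V : X.AffineZariskiSite, j V ≫ d.toBase =
      Spec.map (α.app (.op V)) ≫ V.2.fromSpec := by
    subst hjd
    exact fun V => colimit.ι_desc _ _
  have hw : ∀ {U V : X.AffineZariskiSite} (i : U ⟶ V), Spec.map (F.map i.op) ≫ j V = j U := by
    subst hjd
    exact fun i => colimit.w d.functor i
  have key : ∀ {U V : X.AffineZariskiSite} (i : U ⟶ V)
      (t : pullback g U.1.ι ⟶ pullback g V.1.ι),
      t ≫ pullback.fst g V.1.ι = pullback.fst g U.1.ι →
      t ≫ (pullbackRestrictIsoRestrict g V.1).hom ≫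
        (g ⁻¹ᵁ V.1).toSpecΓ ≫ Spec.map (β V) ≫ j V =
      (pullbackRestrictIsoRestrict g U.1).hom ≫ (g ⁻¹ᵁ U.1).toSpecΓ ≫ Spec.map (β U) ≫ j U := by
    intro U V i t ht
    have : t ≫ (pullbackRestrictIsoRestrict g V.1).hom =
        (pullbackRestrictIsoRestrict g U.1).hom ≫
          Y.homOfLE (g.preimage_mono (toOpens_mono i.le)) := by
      rw [← cancel_mono (Scheme.Opens.ι _)]
      simp only [Category.assoc, homOfLE_ι, pullbackRestrictIsoRestrict_hom_ι, ht]
    rw [reassoc_of% this, ← Scheme.Opens.toSpecΓ_SpecMap_presheaf_map_assoc, ← hw i,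
      ← Spec.map_comp_assoc, ← Spec.map_comp_assoc, ← hβ U V i.le]
    rfl
  have hcompat : ∀ {U V : X.AffineZariskiSite} (i : U ⟶ V),
      Cover.trans ((directedCover X).pullback₁ g) i ≫ (pullbackRestrictIsoRestrict g V.1).hom ≫
        (g ⁻¹ᵁ V.1).toSpecΓ ≫ Spec.map (β V) ≫ j V =
      (pullbackRestrictIsoRestrict g U.1).hom ≫ (g ⁻¹ᵁ U.1).toSpecΓ ≫ Spec.map (β U) ≫ j U :=
    fun i => key i _ (Cover.trans_map ((directedCover X).pullback₁ g) i)
  let g' : Y ⟶ d.glued := Scheme.OpenCover.glueMorphismsOfLocallyDirected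
    ((directedCover X).pullback₁ g)
    (fun U ↦ (pullbackRestrictIsoRestrict g U.1).hom ≫
      (g ⁻¹ᵁ U.1).toSpecΓ ≫ Spec.map (β U) ≫ j U) hcompat
  have hg' : ∀ V : X.AffineZariskiSite, (g ⁻¹ᵁ V.1).ι ≫ g' =
      (g ⁻¹ᵁ V.1).toSpecΓ ≫ Spec.map (β V) ≫ j V := by
    intro V
    rw [← cancel_epi (pullbackRestrictIsoRestrict g V.1).hom, ← Category.assoc]
    trans ((directedCover X).pullback₁ g).f V ≫ g'
    · congr 1; exact pullbackRestrictIsoRestrict_hom_ι _ _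
    exact Scheme.OpenCover.map_glueMorphismsOfLocallyDirected _ _ hcompat _
  have hgι : ∀ V : X.AffineZariskiSite, (g ⁻¹ᵁ V.1).ι ≫ g' ≫ d.toBase = (g ⁻¹ᵁ V.1).ι ≫ g := by
    intro V
    rw [← Category.assoc, hg', Category.assoc, Category.assoc, hbase]
    exact toSpecΓ_SpecMap_fromSpec g V.2 _ _ (hαβ V)
  refine ⟨d.glued, g', d.toBase, ?_, fun V => ⟨j V, hj V, ?_, hbase V, hg' V⟩⟩
  · exact Scheme.Cover.hom_ext (Y.openCoverOfIsOpenCover _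
      (.comap (iSup_affineOpens_eq_top X) g.base.1)) _ _ fun U => hgι ⟨U.1, U.2⟩
  · have := d.toBase_preimage_eq_opensRange_ι V
    rw [← show ((directedCover X).f V).opensRange = V.1 from Scheme.Opens.opensRange_ι _]
    subst hjd
    exact this.symm

end RelativeSpec

section Charts

theorem appLE_congr_hom {X Y : Scheme.{u}} {f f' : X ⟶ Y} (h : f = f') {U : Y.Opens}
    {V : X.Opens} (e : V ≤ f ⁻¹ᵁ U) : f.appLE U V e = f'.appLE U V (h ▸ e) := by
  subst h; rfl

/-- An open immersion `Spec A ⟶ X'` onto `W` identifies `A` with the ring of sections over `W`. -/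
theorem exists_iso_of_opensRange_eq {X' : Scheme.{u}} {A : CommRingCat.{u}} (j : Spec A ⟶ X')
    [IsOpenImmersion j] {W : X'.Opens} (hW : j.opensRange = W) :
    ∃ e : Γ(X', W) ≅ A, e.hom = j.appLE W ⊤ (by rw [← hW]; simp) ≫ (Scheme.ΓSpecIso A).hom := by
  subst hW
  have : IsIso (j.app j.opensRange) := j.isIso_app _ le_rfl
  have : IsIso (j.appLE j.opensRange ⊤ (by simp)) := by
    have : IsIso (homOfLE (show (⊤ : (Spec A).Opens) ≤ j ⁻¹ᵁ j.opensRange by simp)) :=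
      ⟨homOfLE le_top, Subsingleton.elim _ _, Subsingleton.elim _ _⟩
    rw [Scheme.Hom.appLE]
    infer_instance
  exact ⟨asIso (j.appLE j.opensRange ⊤ _) ≪≫ Scheme.ΓSpecIso A, rfl⟩

/-- Over the range of a chart `Spec A`, morphisms to and from `X'` are described on sections by the
homomorphisms from and to `A` that define them. -/
theorem exists_chart_iso {X X' Y : Scheme.{u}} (g' : Y ⟶ X') (π : X' ⟶ X) (V : X.Opens)
    (hV : IsAffineOpen V) (V' : Y.Opens) (hV' : g' ⁻¹ᵁ π ⁻¹ᵁ V = V') {A : CommRingCat.{u}}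
    (j : Spec A ⟶ X') [IsOpenImmersion j]
    (hj : j.opensRange = π ⁻¹ᵁ V) (a : Γ(X, V) ⟶ A) (b : A ⟶ Γ(Y, V'))
    (ha : j ≫ π = Spec.map a ≫ hV.fromSpec) (hb : V'.ι ≫ g' = V'.toSpecΓ ≫ Spec.map b ≫ j) :
    IsAffineOpen (π ⁻¹ᵁ V) ∧ ∃ e : Γ(X', π ⁻¹ᵁ V) ≅ A, π.app V ≫ e.hom = a ∧
      g'.appLE (π ⁻¹ᵁ V) V' hV'.ge = e.hom ≫ b := by
  refine ⟨hj ▸ isAffineOpen_opensRange j, ?_⟩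
  obtain ⟨e, he⟩ := exists_iso_of_opensRange_eq j hj
  refine ⟨e, ?_, ?_⟩
  · rw [he, ← Category.assoc, Scheme.Hom.app_eq_appLE, Scheme.Hom.appLE_comp_appLE,
      appLE_congr_hom ha, ← Scheme.Hom.appLE_comp_appLE (Spec.map a) hV.fromSpec V ⊤ ⊤ (by simp) (by simp)]
    have h1 : hV.fromSpec.appLE V ⊤ (by simp) = (Scheme.ΓSpecIso Γ(X, V)).inv := by
      rw [Scheme.Hom.appLE, hV.fromSpec_app_self, Category.assoc, ← Functor.map_comp]
      exact (congrArg _ ((Spec Γ(X, V)).presheaf.map_id _)).trans (Category.comp_id _)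
    have h2 : (Spec.map a).appLE ⊤ ⊤ (by simp) = (Spec.map a).appTop :=
      Scheme.Hom.appLE_eq_app _
    rw [h1, h2, Category.assoc, Scheme.ΓSpecIso_naturality, Iso.inv_hom_id_assoc]
  · have h0 : (⊤ : (V' : Scheme.{u}).Opens) ≤ V'.ι ⁻¹ᵁ V' := by simp
    have h1 := appLE_congr_hom hb (U := π ⁻¹ᵁ V) (V := ⊤) (by
      rw [← hV']; exact fun x _ => x.2)
    rw [← Scheme.Hom.appLE_comp_appLE _ _ _ V' _ hV'.ge h0,
      ← Scheme.Hom.appLE_comp_appLE _ _ _ ⊤ _ (by rw [Scheme.Hom.comp_preimage, ← hj]; simp) (by simp),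
      ← Scheme.Hom.appLE_comp_appLE _ _ _ ⊤ _ (by rw [← hj]; simp) (by simp)] at h1
    have h2 : (Spec.map b).appLE ⊤ ⊤ (by simp) = (Spec.map b).appTop :=
      Scheme.Hom.appLE_eq_app _
    have h3 : V'.toSpecΓ.appLE ⊤ ⊤ (by simp) = V'.toSpecΓ.appTop :=
      Scheme.Hom.appLE_eq_app _
    have h4 : V'.ι.appLE V' ⊤ h0 = V'.topIso.inv := by
      rw [Scheme.Opens.ι_appLE]; rfl
    rw [h2, h3, h4, Scheme.Opens.toSpecΓ_appTop, Category.assoc, Scheme.ΓSpecIso_naturality_assoc,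
      ← Category.assoc, ← he, ← Category.assoc, cancel_mono] at h1
    exact h1

end Charts

/-! ### Patching sections off a closed subset with sections of a finite algebra -/

/-- The ring homomorphism `f` exhibits its target as the localization of its source away from
`a`. -/
def RingHom.IsLocalizationAway {A A' : Type*} [CommRing A] [CommRing A'] (f : A →+* A') (a : A) :
    Prop :=
  letI := f.toAlgebra
  IsLocalization.Away a A'

theorem RingHom.isLocalizationAway_iff {A A' : Type*} [CommRing A] [CommRing A'] {f : A →+* A'}
    {a : A} : f.IsLocalizationAway a ↔ IsUnit (f a) ∧ (∀ y, ∃ (n : ℕ) (x : A), f (a ^ n) * y = f x) ∧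
      ∀ x, f x = 0 → ∃ n : ℕ, a ^ n * x = 0 := by
  let _ := f.toAlgebra
  refine ⟨fun h => ?_, fun ⟨h1, h2, h3⟩ => ?_⟩
  · have h : IsLocalization.Away a A' := h
    refine ⟨IsLocalization.Away.algebraMap_isUnit (S := A') a, fun y => ?_, fun x hx => ?_⟩
    · obtain ⟨⟨x, _, n, rfl⟩, hx⟩ := IsLocalization.surj (Submonoid.powers a) y
      exact ⟨n, x, by rw [mul_comm]; exact hx⟩
    · obtain ⟨⟨_, n, rfl⟩, hn⟩ := (IsLocalization.map_eq_zero_iff (Submonoid.powers a) A' x).1 hx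
      exact ⟨n, hn⟩
  · change IsLocalization (Submonoid.powers a) A'
    refine ⟨?_, fun y => ?_, fun {x y} hxy => ?_⟩
    · rintro ⟨_, n, rfl⟩
      change IsUnit (f (a ^ n))
      rw [map_pow]
      exact h1.pow n
    · obtain ⟨n, x, hx⟩ := h2 y
      exact ⟨⟨x, a ^ n, n, rfl⟩, by rw [mul_comm]; exact hx⟩
    · obtain ⟨n, hn⟩ := h3 (x - y) (by rw [map_sub]; exact sub_eq_zero.2 hxy)
      exact ⟨⟨a ^ n, n, rfl⟩, by rwa [mul_sub, sub_eq_zero] at hn⟩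

section Patching

variable {R T B E : Type*} [CommRing R] [CommRing T] [CommRing B] [CommRing E]

/-- The pairs `(t, b)` that agree over `E` and whose first component is multiplied by `J` into the
image of `R`. -/
def patchGenerators (ρ : R →+* T) (φ : T →+* E) (ψ : B →+* E) (J : Ideal R) : Set (T × B) :=
  {s | φ s.1 = ψ s.2 ∧ ∀ i ∈ J, ρ i * s.1 ∈ ρ.range}

/-- The subring of `T × B` generated by the image of `R` and by the pairs `(t, b)` that agree over
`E` and for which `J` multiplies `t` into the image of `R`. In the application `T` and `E` are the
sections over the complement of a closed subset, and the condition on `t`, with `J` a power of the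
ideal of this subset, makes the subring finite over `R`. -/
def patchSubring (ρ : R →+* T) (β : R →+* B) (φ : T →+* E) (ψ : B →+* E) (J : Ideal R) :
    Subring (T × B) :=
  Subring.closure (Set.range (ρ.prod β) ∪ patchGenerators ρ φ ψ J)

variable {ρ : R →+* T} {β : R →+* B} {φ : T →+* E} {ψ : B →+* E} {J : Ideal R}

theorem prod_mem_patchSubring (r : R) : (ρ.prod β) r ∈ patchSubring ρ β φ ψ J :=
  Subring.subset_closure (.inl ⟨r, rfl⟩)

theorem mem_patchSubring_of_mem {s : T × B} (hs : s ∈ patchGenerators ρ φ ψ J) :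
    s ∈ patchSubring ρ β φ ψ J :=
  Subring.subset_closure (.inr hs)

theorem apply_eq_of_mem_patchSubring (h : φ.comp ρ = ψ.comp β) {s : T × B}
    (hs : s ∈ patchSubring ρ β φ ψ J) : φ s.1 = ψ s.2 := by
  have hle : patchSubring ρ β φ ψ J ≤
      (φ.comp (RingHom.fst T B)).eqLocus (ψ.comp (RingHom.snd T B)) := by
    refine Subring.closure_le.2 ?_
    rintro _ (⟨r, rfl⟩ | hs)
    exacts [RingHom.congr_fun h r, hs.1]
  exact hle hs

/-- The ideal of elements of `R` that multiply `t` into the image of `R`. -/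
def denominatorIdeal (ρ : R →+* T) (t : T) : Ideal R where
  carrier := {r | ρ r * t ∈ ρ.range}
  add_mem' {a b} ha hb := by
    simpa [add_mul] using ρ.range.add_mem ha hb
  zero_mem' := ⟨0, by simp⟩
  smul_mem' c x hx := by
    have := ρ.range.mul_mem ⟨c, rfl⟩ hx
    simpa [mul_assoc] using this

theorem exists_pow_le_denominatorIdeal [IsNoetherianRing R] {I : Ideal R} {t : T}
    (h : ∀ f ∈ I, ∃ n : ℕ, ρ (f ^ n) * t ∈ ρ.range) : ∃ N, I ^ N ≤ denominatorIdeal ρ t :=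
  Ideal.exists_pow_le_of_le_radical_of_fg (fun f hf => h f hf) (IsNoetherian.noetherian I)

/-- All elements of `B` agreeing over `E` with an element of `T` occur in the subring, as soon as
the power of `I` is large. -/
theorem exists_forall_exists_mem_patchSubring [IsNoetherianRing R] (hβ : β.Finite)
    (h : φ.comp ρ = ψ.comp β) {I : Ideal R}
    (hI : ∀ t : T, ∀ f ∈ I, ∃ n : ℕ, ρ (f ^ n) * t ∈ ρ.range) :
    ∃ N, ∀ n ≥ N, ∀ t b, φ t = ψ b → ∃ t', (t', b) ∈ patchSubring ρ β φ ψ (I ^ n) := by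
  algebraize [β]
  let A : Submodule R B :=
    { carrier := {b | ∃ t, φ t = ψ b}
      add_mem' := by
        rintro a b ⟨s, hs⟩ ⟨t, ht⟩
        exact ⟨s + t, by simp [hs, ht]⟩
      zero_mem' := ⟨0, by simp⟩
      smul_mem' := by
        rintro r b ⟨t, ht⟩
        refine ⟨ρ r * t, ?_⟩
        have := RingHom.congr_fun h r
        simp only [RingHom.comp_apply] at this
        rw [Algebra.smul_def, map_mul, map_mul, ht, this]
        rfl }
  have : Module.Finite R B := hβ
  obtain ⟨s, hs⟩ := IsNoetherian.noetherian A
  have hsA : ∀ b ∈ s, b ∈ A := fun b hb => hs ▸ Submodule.subset_span hb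
  have : ∀ b, ∃ N, b ∈ s → ∃ t, φ t = ψ b ∧ I ^ N ≤ denominatorIdeal ρ t := by
    intro b
    by_cases hb : b ∈ s
    · obtain ⟨t, ht⟩ := hsA b hb
      obtain ⟨N, hN⟩ := exists_pow_le_denominatorIdeal (hI t)
      exact ⟨N, fun _ => ⟨t, ht, hN⟩⟩
    · exact ⟨0, fun h => (hb h).elim⟩
  choose N hN using this
  refine ⟨s.sup N, fun n hn t b htb => ?_⟩
  have hb : b ∈ Submodule.span R (s : Set B) := hs ▸ (show b ∈ A from ⟨t, htb⟩)
  induction hb using Submodule.span_induction generalizing t with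
  | mem b hb =>
    obtain ⟨t', ht', hle⟩ := hN b hb
    exact ⟨t', mem_patchSubring_of_mem
      ⟨ht', fun i hi => hle (Ideal.pow_le_pow_right ((Finset.le_sup hb).trans hn) hi)⟩⟩
  | zero => exact ⟨0, Subring.zero_mem _⟩
  | add a b ha hb iha ihb =>
    obtain ⟨t₁, h₁⟩ := (hs ▸ ha : a ∈ A)
    obtain ⟨t₂, h₂⟩ := (hs ▸ hb : b ∈ A)
    obtain ⟨u₁, h₁⟩ := iha t₁ h₁
    obtain ⟨u₂, h₂⟩ := ihb t₂ h₂
    exact ⟨u₁ + u₂, Subring.add_mem _ h₁ h₂⟩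
  | smul r a ha iha =>
    obtain ⟨t₁, h₁⟩ := (hs ▸ ha : a ∈ A)
    obtain ⟨u₁, h₁⟩ := iha t₁ h₁
    exact ⟨ρ r * u₁, Subring.mul_mem _ (prod_mem_patchSubring r) h₁⟩

/-- The projection of the subring to `B` has nil kernel if `T → E` has. -/
theorem isNilpotent_of_mem_patchSubring (h : φ.comp ρ = ψ.comp β)
    (hφ : ∀ t, φ t = 0 → IsNilpotent t) {s : T × B} (hs : s ∈ patchSubring ρ β φ ψ J)
    (h0 : s.2 = 0) : IsNilpotent s := by
  obtain ⟨n, hn⟩ := hφ s.1 (by rw [apply_eq_of_mem_patchSubring h hs, h0, map_zero])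
  exact ⟨n + 1, Prod.ext (by simp [pow_succ, hn]) (by simp [h0])⟩

/-- An equation of integral dependence of `b` becomes one of `(t, b)` after taking a power, since
its value at `t` lies in the nil kernel of `T → E`. -/
theorem isIntegral_of_apply_eq (h : φ.comp ρ = ψ.comp β) (hβ : β.IsIntegral)
    (hφ : ∀ t, φ t = 0 → IsNilpotent t) {s : T × B} (hs : φ s.1 = ψ s.2) :
    (ρ.prod β).IsIntegralElem s := by
  obtain ⟨p, hp, hpb⟩ := hβ s.2
  have h1 : φ (p.eval₂ ρ s.1) = 0 := by
    rw [Polynomial.hom_eval₂, h, hs, ← Polynomial.hom_eval₂, hpb, map_zero]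
  obtain ⟨n, hn⟩ := hφ _ h1
  refine ⟨p ^ (n + 1), hp.pow _, ?_⟩
  have h2 : p.eval₂ (ρ.prod β) s = (p.eval₂ ρ s.1, p.eval₂ β s.2) := by
    refine Prod.ext ?_ ?_
    · exact Polynomial.hom_eval₂ p (ρ.prod β) (RingHom.fst T B) s
    · exact Polynomial.hom_eval₂ p (ρ.prod β) (RingHom.snd T B) s
  rw [Polynomial.eval₂_pow, h2, hpb]
  exact Prod.ext (by simp [pow_succ, hn]) (by simp)

/-- The generators are integral, and they form a finitely generated module, since multiplication by
generators of `J` embeds the first components into a power of the image of `R`. -/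
theorem finite_patchSubring [IsNoetherianRing R] (h : φ.comp ρ = ψ.comp β) (hβ : β.Finite)
    (hφ : ∀ t, φ t = 0 → IsNilpotent t) (hJ : ∀ t : T, (∀ i ∈ J, ρ i * t = 0) → t = 0) :
    ((ρ.prod β).codRestrict (patchSubring ρ β φ ψ J) prod_mem_patchSubring).Finite := by
  algebraize [ρ, β]
  have : Module.Finite R B := hβ
  -- the generators form a finitely generated submodule
  let P : Submodule R (T × B) :=
    { carrier := patchGenerators ρ φ ψ J
      add_mem' := by
        rintro a b ha hb
        refine ⟨by simp [ha.1, hb.1], fun i hi => ?_⟩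
        have := ρ.range.add_mem (ha.2 i hi) (hb.2 i hi)
        rwa [← mul_add] at this
      zero_mem' := ⟨by simp, fun i _ => by simp⟩
      smul_mem' := by
        rintro r a ha
        refine ⟨?_, fun i hi => ?_⟩
        · have := RingHom.congr_fun h r
          simp only [RingHom.comp_apply] at this
          rw [Prod.smul_fst, Prod.smul_snd, Algebra.smul_def, Algebra.smul_def, map_mul, map_mul,
            ha.1]
          exact congrArg (· * _) this
        · rw [Prod.smul_fst, mul_smul_comm, Algebra.smul_def]
          exact ρ.range.mul_mem ⟨r, rfl⟩ (ha.2 i hi) }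
  obtain ⟨G, hG⟩ := IsNoetherian.noetherian J
  let Rbar : Submodule R T := LinearMap.range (Algebra.linearMap R T)
  have hGJ : ∀ g ∈ G, g ∈ J := fun g hg => hG ▸ Submodule.subset_span hg
  let L : P →ₗ[R] (G → Rbar) × B := LinearMap.prod
    (LinearMap.pi fun g => (((LinearMap.mulLeft R (algebraMap R T g.1)).comp
      ((LinearMap.fst R T B).comp P.subtype)).codRestrict Rbar fun s => by
        obtain ⟨r, hr⟩ := s.2.2 g.1 (hGJ _ g.2)
        exact ⟨r, hr⟩))
    ((LinearMap.snd R T B).comp P.subtype)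
  have hL : Function.Injective L := by
    rw [← LinearMap.ker_eq_bot, LinearMap.ker_eq_bot']
    intro s hs
    have hs2 : s.1.2 = 0 := congrArg Prod.snd hs
    have hs1 : s.1.1 = 0 := by
      refine hJ _ fun i hi => ?_
      have : J ≤ Ideal.comap ρ (Module.annihilator T (T ∙ s.1.1)) := by
        rw [← hG, Ideal.span_le]
        intro g hg
        have h1 : algebraMap R T g * s.1.1 = 0 :=
          congrArg Subtype.val (congrFun (congrArg Prod.fst hs) ⟨g, hg⟩)
        simpa [Submodule.mem_annihilator_span_singleton] using! h1
      have := this hi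
      simpa [Submodule.mem_annihilator_span_singleton] using! this
    exact Subtype.ext (Prod.ext hs1 hs2)
  have : IsNoetherian R P := isNoetherian_of_injective L hL
  obtain ⟨S, hS⟩ : P.FG := (Submodule.fg_top P).1 (IsNoetherian.noetherian _)
  let A : Subalgebra R (T × B) := Algebra.adjoin R (S : Set (T × B))
  have hA : A.toSubring = patchSubring ρ β φ ψ J := by
    have : A = Algebra.adjoin R (P : Set (T × B)) := by
      rw [← hS, Algebra.adjoin_span]
    rw [this, Algebra.adjoin_eq_ring_closure]
    rfl
  have hAfin : (Subalgebra.toSubmodule A).FG := by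
    refine fg_adjoin_of_finite S.finite_toSet fun s hs => ?_
    have : s ∈ P := hS ▸ Submodule.subset_span hs
    exact isIntegral_of_apply_eq h (RingHom.Finite.to_isIntegral hβ) hφ this.1
  have hfin : Module.Finite R A := Module.Finite.iff_fg.2 hAfin
  let e : A ≃+* patchSubring ρ β φ ψ J := RingEquiv.subringCongr hA
  exact (RingHom.Finite.of_surjective e.toRingHom e.surjective).comp
    (RingHom.finite_algebraMap.2 hfin)

/-- Over an open subset disjoint from the closed subset, patching changes nothing. -/
theorem bijective_codRestrict_patchSubring (h : φ.comp ρ = ψ.comp β)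
    (hρ : Function.Bijective ρ) (hψ : Function.Bijective ψ) :
    Function.Bijective
      ((ρ.prod β).codRestrict (patchSubring ρ β φ ψ J) prod_mem_patchSubring) := by
  refine ⟨fun a b hab => hρ.1 (congrArg (fun s => s.1.1) hab), fun s => ?_⟩
  obtain ⟨r, hr⟩ := hρ.2 s.1.1
  refine ⟨r, Subtype.ext (Prod.ext hr (hψ.1 ?_))⟩
  rw [← apply_eq_of_mem_patchSubring h s.2, ← hr]
  exact (RingHom.congr_fun h r).symm

section Map

variable {R' T' B' E' : Type*} [CommRing R'] [CommRing T'] [CommRing B'] [CommRing E']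
  {ρ' : R' →+* T'} {β' : R' →+* B'} {φ' : T' →+* E'} {ψ' : B' →+* E'} {J' : Ideal R'}
  {r : R →+* R'} {t : T →+* T'} {b : B →+* B'} {e : E →+* E'}

theorem patchSubring_le_comap (hρ : t.comp ρ = ρ'.comp r) (hβ : b.comp β = β'.comp r)
    (hφ : e.comp φ = φ'.comp t) (hψ : e.comp ψ = ψ'.comp b) (hJ : J.map r = J') :
    patchSubring ρ β φ ψ J ≤ (patchSubring ρ' β' φ' ψ' J').comap (t.prodMap b) := by
  refine Subring.closure_le.2 ?_
  rintro _ (⟨x, rfl⟩ | hs)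
  · have : (t.prodMap b) ((ρ.prod β) x) = (ρ'.prod β') (r x) :=
      Prod.ext (RingHom.congr_fun hρ x) (RingHom.congr_fun hβ x)
    change _ ∈ patchSubring ρ' β' φ' ψ' J'
    rw [this]
    exact prod_mem_patchSubring _
  · rename_i s
    refine mem_patchSubring_of_mem ⟨?_, ?_⟩
    · change φ' (t s.1) = ψ' (b s.2)
      rw [← RingHom.comp_apply, ← hφ, ← RingHom.comp_apply, ← hψ, RingHom.comp_apply, hs.1]
      rfl
    · have : J' ≤ denominatorIdeal ρ' (t s.1) := by
        rw [← hJ, Ideal.map_le_iff_le_comap]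
        intro i hi
        obtain ⟨x, hx⟩ := hs.2 i hi
        refine ⟨r x, ?_⟩
        rw [← RingHom.comp_apply, ← hρ, RingHom.comp_apply, hx, map_mul, ← RingHom.comp_apply, hρ]
        rfl
      exact fun i hi => this hi

/-- After multiplication by a power of `f`, a generator over the localization away from `f` comes
from a generator. -/
theorem exists_pow_mul_mem_patchGenerators [IsNoetherianRing R] (h : φ.comp ρ = ψ.comp β)
    (h' : φ'.comp ρ' = ψ'.comp β') (hρ : t.comp ρ = ρ'.comp r) (hβ : b.comp β = β'.comp r)
    (hφ : e.comp φ = φ'.comp t) (hψ : e.comp ψ = ψ'.comp b) (hJ : J.map r = J') {f : R}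
    (hr : r.IsLocalizationAway f) (ht : t.IsLocalizationAway (ρ f))
    (hb : b.IsLocalizationAway (β f)) (he : e.IsLocalizationAway (φ (ρ f))) {s' : T' × B'}
    (hs' : s' ∈ patchGenerators ρ' φ' ψ' J') :
    ∃ n : ℕ, ∃ s ∈ patchGenerators ρ φ ψ J,
      (ρ'.prod β') (r (f ^ n)) * s' = (t.prodMap b) s := by
  rw [RingHom.isLocalizationAway_iff] at hr ht hb he
  have hρ : ∀ x, t (ρ x) = ρ' (r x) := RingHom.congr_fun hρ
  have hβ : ∀ x, b (β x) = β' (r x) := RingHom.congr_fun hβ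
  have hφ : ∀ x, e (φ x) = φ' (t x) := RingHom.congr_fun hφ
  have hψ : ∀ x, e (ψ x) = ψ' (b x) := RingHom.congr_fun hψ
  have h : ∀ x, φ (ρ x) = ψ (β x) := RingHom.congr_fun h
  have h' : ∀ x, φ' (ρ' x) = ψ' (β' x) := RingHom.congr_fun h'
  obtain ⟨n₁, x₁, h₁⟩ := ht.2.1 s'.1
  obtain ⟨n₂, x₂, h₂⟩ := hb.2.1 s'.2
  -- clear denominators in both components at once
  obtain ⟨n, x, y, hx, hy⟩ : ∃ (n : ℕ) (x : T) (y : B), ρ' (r (f ^ n)) * s'.1 = t x ∧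
      β' (r (f ^ n)) * s'.2 = b y := by
    refine ⟨n₁ + n₂, ρ (f ^ n₂) * x₁, β (f ^ n₁) * x₂, ?_, ?_⟩
    · rw [map_mul, ← h₁, hρ, ← map_pow, hρ, pow_add, map_mul, map_mul]; ring
    · rw [map_mul, ← h₂, hβ, ← map_pow, hβ, pow_add, map_mul, map_mul]; ring
  -- make the two components agree
  obtain ⟨m, hm⟩ : ∃ m : ℕ, φ (ρ f) ^ m * (φ x - ψ y) = 0 := by
    refine he.2.2 _ ?_
    rw [map_sub, hφ, hψ, ← hx, ← hy, map_mul, map_mul, h', hs'.1, sub_self]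
  -- move the products with generators of `J` into the image of `R`
  have key : ∀ g ∈ J, ∃ k : ℕ, ρ (f ^ k) * (ρ g * x) ∈ ρ.range := by
    intro g hg
    obtain ⟨c, hc⟩ := hs'.2 (r g) (hJ ▸ Ideal.mem_map_of_mem _ hg)
    obtain ⟨k, a, ha⟩ := hr.2.1 c
    have h0 : t (ρ (f ^ k) * (ρ g * x) - ρ (f ^ n * a)) = 0 := by
      rw [map_sub, map_mul, map_mul, ← hx, hρ, hρ, hρ, map_mul r, map_mul ρ', ← ha, map_mul ρ', hc]
      ring
    obtain ⟨l, hl⟩ := ht.2.2 _ h0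
    refine ⟨l + k, f ^ l * (f ^ n * a), ?_⟩
    rw [mul_sub, sub_eq_zero, ← map_pow] at hl
    rw [map_mul, ← hl, pow_add, map_mul]
    ring
  obtain ⟨k, hk⟩ : ∃ k : ℕ, J ≤ denominatorIdeal ρ (ρ (f ^ k) * x) := by
    obtain ⟨G, hG⟩ := IsNoetherian.noetherian J
    have : ∀ g, ∃ k : ℕ, g ∈ J → ρ (f ^ k) * (ρ g * x) ∈ ρ.range := fun g => by
      by_cases hg : g ∈ J
      · obtain ⟨k, hk⟩ := key g hg
        exact ⟨k, fun _ => hk⟩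
      · exact ⟨0, fun h => (hg h).elim⟩
    choose k hk using this
    refine ⟨G.sup k, ?_⟩
    conv_lhs => rw [← hG]
    refine Submodule.span_le.2 fun g hg => ?_
    have h1 := hk g (hG ▸ Submodule.subset_span hg)
    have h2 := ρ.range.mul_mem ⟨f ^ (G.sup k - k g), rfl⟩ h1
    change ρ g * (ρ (f ^ G.sup k) * x) ∈ ρ.range
    rwa [← mul_assoc, ← map_mul, ← pow_add, Nat.sub_add_cancel (Finset.le_sup hg),
      mul_left_comm] at h2
  refine ⟨m + k + n, (ρ (f ^ (m + k)) * x, β (f ^ (m + k)) * y), ⟨?_, fun i hi => ?_⟩, ?_⟩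
  · rw [← map_pow, ← map_pow, mul_sub, sub_eq_zero] at hm
    simp only [map_mul, pow_add, ← h]
    rw [mul_assoc, mul_left_comm, hm]
    simp only [← mul_assoc, mul_comm]
  · have := ρ.range.mul_mem ⟨f ^ m, rfl⟩ (hk hi)
    simp only [pow_add, map_mul]
    convert this using 1
    ring
  · refine Prod.ext ?_ ?_
    · change ρ' (r (f ^ (m + k + n))) * s'.1 = t (ρ (f ^ (m + k)) * x)
      rw [map_mul, ← hx, hρ, pow_add f (m + k) n, map_mul, map_mul, mul_assoc]
    · change β' (r (f ^ (m + k + n))) * s'.2 = b (β (f ^ (m + k)) * y)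
      rw [map_mul, ← hy, hβ, pow_add f (m + k) n, map_mul, map_mul, mul_assoc]

/-- Patching commutes with localization. -/
theorem isLocalizationAway_patchSubring [IsNoetherianRing R] (h : φ.comp ρ = ψ.comp β)
    (h' : φ'.comp ρ' = ψ'.comp β') (hρ : t.comp ρ = ρ'.comp r) (hβ : b.comp β = β'.comp r)
    (hφ : e.comp φ = φ'.comp t) (hψ : e.comp ψ = ψ'.comp b) (hJ : J.map r = J') {f : R}
    (hr : r.IsLocalizationAway f) (ht : t.IsLocalizationAway (ρ f))
    (hb : b.IsLocalizationAway (β f)) (he : e.IsLocalizationAway (φ (ρ f))) :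
    ((t.prodMap b).restrict (patchSubring ρ β φ ψ J) (patchSubring ρ' β' φ' ψ' J')
      (patchSubring_le_comap hρ hβ hφ hψ hJ)).IsLocalizationAway
      ⟨(ρ.prod β) f, prod_mem_patchSubring f⟩ := by
  have hcomm : ∀ x, (t.prodMap b) ((ρ.prod β) x) = (ρ'.prod β') (r x) := fun x =>
    Prod.ext (RingHom.congr_fun hρ x) (RingHom.congr_fun hβ x)
  have hgen := fun s' => exists_pow_mul_mem_patchGenerators (s' := s') h h' hρ hβ hφ hψ hJ hr ht hb he
  rw [RingHom.isLocalizationAway_iff] at hr ht hb ⊢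
  refine ⟨?_, fun y => ?_, fun x hx => ?_⟩
  · have := hr.1.map ((ρ'.prod β').codRestrict (patchSubring ρ' β' φ' ψ' J') prod_mem_patchSubring)
    convert this using 1
    exact Subtype.ext (hcomm f)
  · suffices ∃ n : ℕ, ∃ x ∈ patchSubring ρ β φ ψ J,
        (ρ'.prod β') (r (f ^ n)) * y.1 = (t.prodMap b) x by
      obtain ⟨n, x, hx, hxy⟩ := this
      refine ⟨n, ⟨x, hx⟩, Subtype.ext ?_⟩
      rw [← hcomm, map_pow, map_pow] at hxy
      rw [map_pow]
      exact hxy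
    obtain ⟨y, hy⟩ := y
    dsimp only
    induction hy using Subring.closure_induction with
    | mem y hy =>
      obtain ⟨x', rfl⟩ | hy := hy
      · obtain ⟨n, x, hx⟩ := hr.2.1 x'
        exact ⟨n, _, prod_mem_patchSubring x, by rw [hcomm, ← hx, map_mul]⟩
      · obtain ⟨n, s, hs, h⟩ := hgen y hy
        exact ⟨n, s, mem_patchSubring_of_mem hs, h⟩
    | zero => exact ⟨0, 0, Subring.zero_mem _, by rw [map_zero, mul_zero]⟩
    | one => exact ⟨0, 1, Subring.one_mem _, by rw [pow_zero]; simp only [map_one, mul_one]⟩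
    | add y₁ y₂ _ _ h₁ h₂ =>
      obtain ⟨n₁, x₁, hx₁, h₁⟩ := h₁
      obtain ⟨n₂, x₂, hx₂, h₂⟩ := h₂
      refine ⟨n₁ + n₂, (ρ.prod β) (f ^ n₂) * x₁ + (ρ.prod β) (f ^ n₁) * x₂,
        Subring.add_mem _ (Subring.mul_mem _ (prod_mem_patchSubring _) hx₁)
          (Subring.mul_mem _ (prod_mem_patchSubring _) hx₂), ?_⟩
      rw [map_add, map_mul, map_mul, ← h₁, ← h₂, hcomm, hcomm, pow_add, map_mul, map_mul]
      ring
    | neg y _ h =>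
      obtain ⟨n, x, hx, h⟩ := h
      exact ⟨n, -x, Subring.neg_mem _ hx, by rw [mul_neg, h, map_neg]⟩
    | mul y₁ y₂ _ _ h₁ h₂ =>
      obtain ⟨n₁, x₁, hx₁, h₁⟩ := h₁
      obtain ⟨n₂, x₂, hx₂, h₂⟩ := h₂
      refine ⟨n₁ + n₂, x₁ * x₂, Subring.mul_mem _ hx₁ hx₂, ?_⟩
      rw [map_mul, ← h₁, ← h₂, pow_add, map_mul, map_mul]
      ring
  · have hx : (t.prodMap b) x.1 = 0 := congrArg Subtype.val hx
    obtain ⟨n₁, h₁⟩ := ht.2.2 x.1.1 (congrArg Prod.fst hx)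
    obtain ⟨n₂, h₂⟩ := hb.2.2 x.1.2 (congrArg Prod.snd hx)
    refine ⟨n₁ + n₂, Subtype.ext (Prod.ext ?_ ?_)⟩
    · change ρ f ^ (n₁ + n₂) * x.1.1 = 0
      rw [pow_add, mul_right_comm, h₁, zero_mul]
    · change β f ^ (n₁ + n₂) * x.1.2 = 0
      rw [pow_add, mul_assoc, h₂, mul_zero]

end Map

end Patching

/-! ### The patched algebra of a morphism over the complement of a closed subset -/

section PatchSheaf

open Scheme Scheme.AffineZariskiSite Opposite

variable {X Y : Scheme.{u}}

theorem isLocalizationAway_presheaf_map {W W' : X.Opens} (hW : IsCompact W.1)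
    (hW' : IsQuasiSeparated W.1) (f : Γ(X, W)) (h : W' = X.basicOpen f) (hle : W' ≤ W) :
    (X.presheaf.map (homOfLE hle).op).hom.IsLocalizationAway f := by
  subst h
  exact isLocalization_basicOpen_of_qcqs hW hW' f

/-- The sections over the affine open `V` of the patched algebra: it is generated over the sections
of `X` by the pairs `(t, b)`, where `t` is a section of `X` over `V ∖ Z` and `b` a section of `Y`
over `V`, such that `b` extends the pullback of `t` and the `N`-th power of the ideal of `Z`
multiplies `t` into the sections over `V`. -/
def patchSections (g : Y ⟶ X) (Z : X.IdealSheafData) (N : ℕ) (V : X.AffineZariskiSite) :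
    Subring (Γ(X, Z.support.compl ⊓ V.1) × Γ(Y, g ⁻¹ᵁ V.1)) :=
  patchSubring (X.presheaf.map (homOfLE (inf_le_right : Z.support.compl ⊓ V.1 ≤ V.1)).op).hom
    (g.app V.1).hom (g.app (Z.support.compl ⊓ V.1)).hom
    (Y.presheaf.map (homOfLE (g.preimage_mono
      (inf_le_right : Z.support.compl ⊓ V.1 ≤ V.1))).op).hom
    (Z.ideal ⟨V.1, V.2⟩ ^ N)

variable (g : Y ⟶ X) (Z : X.IdealSheafData) (N : ℕ)

theorem app_comp_map (U V : X.Opens) (h : U ≤ V) :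
    (g.app U).hom.comp (X.presheaf.map (homOfLE h).op).hom =
      (Y.presheaf.map (homOfLE (g.preimage_mono h)).op).hom.comp (g.app V).hom := by
  rw [← CommRingCat.hom_comp, ← CommRingCat.hom_comp]
  exact congrArg CommRingCat.Hom.hom (g.naturality (homOfLE h).op)

theorem map_comp_map {U V W W' : X.Opens} (h : U ≤ V) (h' : V ≤ W) (k : U ≤ W') (k' : W' ≤ W) :
    (X.presheaf.map (homOfLE h).op).hom.comp (X.presheaf.map (homOfLE h').op).hom =
      (X.presheaf.map (homOfLE k).op).hom.comp (X.presheaf.map (homOfLE k').op).hom := by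
  rw [← CommRingCat.hom_comp, ← CommRingCat.hom_comp, ← Functor.map_comp, ← Functor.map_comp]
  rfl

theorem patchSections_le_comap {V' V : X.AffineZariskiSite} (h : V' ≤ V) :
    patchSections g Z N V ≤ (patchSections g Z N V').comap
      ((X.presheaf.map (homOfLE (inf_le_inf_left Z.support.compl (toOpens_mono h))).op).hom.prodMap
        (Y.presheaf.map (homOfLE (g.preimage_mono (toOpens_mono h))).op).hom) :=
  patchSubring_le_comap (r := (X.presheaf.map (homOfLE (toOpens_mono h)).op).hom)
    (e := (Y.presheaf.map (homOfLE (g.preimage_mono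
      (inf_le_inf_left Z.support.compl (toOpens_mono h)))).op).hom)
    (map_comp_map _ _ _ _) (app_comp_map g _ _ _).symm (app_comp_map g _ _ _).symm
    (map_comp_map _ _ _ _)
    (by rw [Ideal.map_pow]; exact congrArg (· ^ N) (Z.map_ideal (U := ⟨V'.1, V'.2⟩) (V := ⟨V.1, V.2⟩) (toOpens_mono h)))

/-- The homomorphism from the sections of `X` to the sections of the patched algebra. -/
def toPatchSections (V : X.AffineZariskiSite) : Γ(X, V.1) →+* patchSections g Z N V :=
  RingHom.codRestrict
    ((X.presheaf.map (homOfLE (inf_le_right : Z.support.compl ⊓ V.1 ≤ V.1)).op).hom.prod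
      (g.app V.1).hom) (patchSections g Z N V) prod_mem_patchSubring

/-- The patched algebra as a functor on affine opens, with basic opens as morphisms. -/
def patchFunctor : X.AffineZariskiSiteᵒᵖ ⥤ CommRingCat.{u} where
  obj V := .of (patchSections g Z N V.unop)
  map i := CommRingCat.ofHom (RingHom.restrict _ _ _ (patchSections_le_comap g Z N i.unop.le))
  map_id V := by
    ext s
    · exact RingHom.congr_fun (congrArg CommRingCat.Hom.hom (X.presheaf.map_id _)) s.1.1
    · exact RingHom.congr_fun (congrArg CommRingCat.Hom.hom (Y.presheaf.map_id _)) s.1.2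
  map_comp i j := by
    ext s
    · exact RingHom.congr_fun (congrArg CommRingCat.Hom.hom (X.presheaf.map_comp
        (homOfLE (inf_le_inf_left Z.support.compl (toOpens_mono i.unop.le))).op
        (homOfLE (inf_le_inf_left Z.support.compl (toOpens_mono j.unop.le))).op)) s.1.1
    · exact RingHom.congr_fun (congrArg CommRingCat.Hom.hom (Y.presheaf.map_comp
        (homOfLE (g.preimage_mono (toOpens_mono i.unop.le))).op
        (homOfLE (g.preimage_mono (toOpens_mono j.unop.le))).op)) s.1.2

/-- The structure homomorphism of the patched algebra. -/
def toPatchFunctor :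
    (AffineZariskiSite.toOpensFunctor X).op ⋙ X.presheaf ⟶ patchFunctor g Z N where
  app V := CommRingCat.ofHom (toPatchSections g Z N V.unop)
  naturality V W i := by
    ext s
    refine Subtype.ext (Prod.ext ?_ ?_)
    · exact (RingHom.congr_fun (map_comp_map (X := X) _ _ _ _) s)
    · exact (RingHom.congr_fun (app_comp_map g _ _ _) s)

/-- The patched algebra is quasi-coherent. -/
theorem coequifibered_toPatchFunctor [IsNoetherian X] [IsAffineHom g] :
    (toPatchFunctor g Z N).Coequifibered := by
  refine coequifibered_iff_forall_isLocalizationAway.mpr fun V f ↦ ?_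
  have : IsNoetherianRing Γ(X, V.1) := IsLocallyNoetherian.component_noetherian ⟨V.1, V.2⟩
  have hc : IsCompact (Z.support.compl ⊓ V.1 : X.Opens).1 := NoetherianSpace.isCompact _
  have hq : IsQuasiSeparated (Z.support.compl ⊓ V.1 : X.Opens).1 := .of_quasiSeparatedSpace _
  have hV : IsAffineOpen (g ⁻¹ᵁ V.1) := V.2.preimage g
  refine isLocalizationAway_patchSubring (r := (X.presheaf.map (homOfLE (X.basicOpen_le f)).op).hom)
    (e := (Y.presheaf.map (homOfLE (g.preimage_mono
      (inf_le_inf_left Z.support.compl (X.basicOpen_le f)))).op).hom) (f := f)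
    (app_comp_map g _ _ _) (app_comp_map g _ _ _)
    (map_comp_map _ _ _ _) (app_comp_map g _ _ _).symm (app_comp_map g _ _ _).symm
    (map_comp_map _ _ _ _)
    (by rw [Ideal.map_pow]; exact congrArg (· ^ N) (Z.map_ideal (U := ⟨_, V.2.basicOpen f⟩) (V := ⟨V.1, V.2⟩) (X.basicOpen_le f)))
    (isLocalizationAway_presheaf_map V.2.isCompact V.2.isQuasiSeparated _ rfl _)
    (isLocalizationAway_presheaf_map hc hq _ ?_ _)
    (isLocalizationAway_presheaf_map hV.isCompact hV.isQuasiSeparated _ ?_ _)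
    (isLocalizationAway_presheaf_map (g.isCompact_preimage hc) (g.isQuasiSeparated_preimage hq)
      _ ?_ _)
  · refine Eq.trans ?_ (X.basicOpen_res f _).symm
    change Z.support.compl ⊓ X.basicOpen f = _
    rw [inf_assoc, inf_eq_right.2 (X.basicOpen_le f)]
  · exact g.preimage_basicOpen f
  · rw [← g.preimage_basicOpen]
    refine congrArg (g ⁻¹ᵁ ·) (Eq.trans ?_ (X.basicOpen_res f _).symm)
    change Z.support.compl ⊓ X.basicOpen f = _
    rw [inf_assoc, inf_eq_right.2 (X.basicOpen_le f)]

end PatchSheaf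

/-! ### Sections over the complement of a closed subset -/

section LocalProperties

variable {X Y : Scheme.{u}} {g : Y ⟶ X} {Z : X.IdealSheafData}

theorem IsFiniteTopologicalModification.exists_apply_eq {Z : Closeds X}
    (hg : IsFiniteTopologicalModification g Z) {x : X} (hx : x ∈ Z.compl) : ∃ y, g y = x := by
  obtain ⟨y, hy⟩ := hg.universalHomeomorphism_compl.isHomeomorph.surjective ⟨x, hx⟩
  refine ⟨y.1, ?_⟩
  have := congrArg Subtype.val hy
  rwa [morphismRestrict_base_coe] at this

/-- Pulling back sections along a morphism that is surjective over `U` has nil kernel. -/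
theorem isNilpotent_of_app_eq_zero [IsNoetherian X] {U : X.Opens}
    (hU : ∀ x ∈ U, ∃ y, g y = x) {t : Γ(X, U)} (ht : (g.app U).hom t = 0) : IsNilpotent t := by
  rw [Scheme.isNilpotent_iff_basicOpen_eq_bot_of_isCompact (NoetherianSpace.isCompact _)]
  refine le_bot_iff.1 fun x hx => ?_
  obtain ⟨y, rfl⟩ := hU x (X.basicOpen_le t hx)
  have h : y ∈ g ⁻¹ᵁ X.basicOpen t := hx
  rw [g.preimage_basicOpen] at h
  change y ∈ Y.basicOpen ((g.app U).hom t) at h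
  rwa [ht, Scheme.basicOpen_zero] at h

theorem presheaf_map_map_apply {U V W : X.Opens} (h : U ≤ V) (h' : V ≤ W) (s : Γ(X, W)) :
    (X.presheaf.map (homOfLE h).op).hom ((X.presheaf.map (homOfLE h').op).hom s) =
      (X.presheaf.map (homOfLE (h.trans h')).op).hom s := by
  rw [← RingHom.comp_apply, ← CommRingCat.hom_comp, ← Functor.map_comp]
  rfl

theorem exists_mem_ideal_mem_basicOpen (V : X.affineOpens) {x : X} (hx : x ∈ V.1)
    (hxZ : x ∉ Z.support) : ∃ f ∈ Z.ideal V, x ∈ X.basicOpen f := by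
  rw [Scheme.IdealSheafData.mem_support_iff_of_mem hx, Scheme.mem_zeroLocus_iff] at hxZ
  push Not at hxZ
  exact hxZ

theorem basicOpen_le_compl_inf (V : X.affineOpens) {f : Γ(X, V)} (hf : f ∈ Z.ideal V) :
    X.basicOpen f ≤ Z.support.compl ⊓ V.1 := by
  refine le_inf (fun x hx hxZ => ?_) (X.basicOpen_le f)
  have hxZ : x ∈ Z.support := hxZ
  rw [Scheme.IdealSheafData.mem_support_iff_of_mem (U := V) (X.basicOpen_le f hx),
    Scheme.mem_zeroLocus_iff] at hxZ
  exact hxZ f hf hx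

/-- A section over the complement of `Z` that is killed by a power of the ideal of `Z` vanishes,
since this ideal generates the unit ideal locally on the complement. -/
theorem eq_zero_of_forall_pow_mul_eq_zero (V : X.affineOpens) (N : ℕ)
    (t : Γ(X, Z.support.compl ⊓ V.1))
    (h : ∀ i ∈ Z.ideal V ^ N,
      (X.presheaf.map (homOfLE (inf_le_right : Z.support.compl ⊓ V.1 ≤ V.1)).op).hom i * t = 0) :
    t = 0 := by
  refine TopCat.Presheaf.IsSheaf.section_ext X.sheaf.2 fun x hx => ?_
  obtain ⟨f, hf, hxf⟩ := exists_mem_ideal_mem_basicOpen V hx.2 hx.1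
  have hle := basicOpen_le_compl_inf V hf
  refine ⟨X.basicOpen f, hle, hxf, ?_⟩
  have hunit : IsUnit ((X.presheaf.map (homOfLE hle).op).hom ((X.presheaf.map
      (homOfLE (inf_le_right : Z.support.compl ⊓ V.1 ≤ V.1)).op).hom f)) := by
    rw [presheaf_map_map_apply]
    exact RingedSpace.isUnit_res_basicOpen X.toRingedSpace f
  have h0 := congrArg (X.presheaf.map (homOfLE hle).op).hom (h _ (Ideal.pow_mem_pow hf N))
  rw [map_mul, map_pow, map_pow, map_zero] at h0
  have h1 := ((hunit.pow N).mul_right_eq_zero).1 h0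
  exact h1.trans (map_zero (X.presheaf.map (homOfLE hle).op).hom).symm

/-- A section over the complement of `Z` extends after multiplication by a power of any element of
the ideal of `Z`. -/
theorem exists_pow_mul_mem_range [IsNoetherian X] (V : X.affineOpens)
    (t : Γ(X, Z.support.compl ⊓ V.1)) (f : Γ(X, V.1)) (hf : f ∈ Z.ideal V) : ∃ n : ℕ,
      (X.presheaf.map (homOfLE (inf_le_right : Z.support.compl ⊓ V.1 ≤ V.1)).op).hom (f ^ n) * t ∈
        (X.presheaf.map
          (homOfLE (inf_le_right : Z.support.compl ⊓ V.1 ≤ V.1)).op).hom.range := by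
  have hle := basicOpen_le_compl_inf V hf
  have h1 := isLocalizationAway_presheaf_map V.2.isCompact V.2.isQuasiSeparated f rfl
    (X.basicOpen_le f)
  have h2 := isLocalizationAway_presheaf_map (NoetherianSpace.isCompact _)
    (.of_quasiSeparatedSpace _) ((X.presheaf.map
      (homOfLE (inf_le_right : Z.support.compl ⊓ V.1 ≤ V.1)).op).hom f)
    (W' := X.basicOpen f) (by
      rw [X.basicOpen_res]
      exact (inf_eq_right.2 hle).symm) hle
  rw [RingHom.isLocalizationAway_iff] at h1 h2
  set ρ := (X.presheaf.map (homOfLE (inf_le_right : Z.support.compl ⊓ V.1 ≤ V.1)).op).hom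
  have hcomp : ∀ x, (X.presheaf.map (homOfLE hle).op).hom (ρ x) =
      (X.presheaf.map (homOfLE (X.basicOpen_le f)).op).hom x :=
    presheaf_map_map_apply hle inf_le_right
  obtain ⟨n, r, hr⟩ := h1.2.1 ((X.presheaf.map (homOfLE hle).op).hom t)
  obtain ⟨m, hm⟩ := h2.2.2 (ρ (f ^ n) * t - ρ r) (by
    rw [map_sub, map_mul, hcomp, hcomp, hr, sub_self])
  rw [mul_sub, sub_eq_zero, ← map_pow] at hm
  exact ⟨m + n, f ^ m * r, by rw [map_mul, ← hm, pow_add, map_mul, mul_assoc]⟩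

theorem bijective_presheaf_map {U V : X.Opens} (h : U ≤ V) (h' : V ≤ U) :
    Function.Bijective (X.presheaf.map (homOfLE h).op).hom := by
  have : IsIso (homOfLE h) := ⟨homOfLE h', Subsingleton.elim _ _, Subsingleton.elim _ _⟩
  exact ConcreteCategory.bijective_of_isIso (X.presheaf.map (homOfLE h).op)

end LocalProperties

/-! ### Radiciality over the patched algebra -/

section RadicialPatch

open Limits
open scoped TensorProduct

variable {X Y : Scheme.{u}}

theorem isPullback_fromSpec (g : Y ⟶ X) {V : X.Opens} (hV : IsAffineOpen V)
    (hV' : IsAffineOpen (g ⁻¹ᵁ V)) :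
    IsPullback hV'.fromSpec (Spec.map (g.app V)) g hV.fromSpec := by
  refine (IsOpenImmersion.isPullback _ _ _ _ ?_ ?_).flip
  · rw [← hV.SpecMap_appLE_fromSpec g hV' le_rfl, Scheme.Hom.appLE_eq_app]
  · simp

/-- An algebra in which the ideal of `Z` generates the unit ideal maps to `X ∖ Z`, over which `g` is
a universal homeomorphism. -/
theorem isHomeomorph_comap_tensorProduct {g : Y ⟶ X} {Z : X.IdealSheafData}
    (hg : IsFiniteTopologicalModification g Z.support) (V : X.affineOpens) (D : Type u)
    [CommRing D] [Algebra Γ(X, V.1) D] [Algebra Γ(X, V.1) Γ(Y, g ⁻¹ᵁ V.1)]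
    (hB : algebraMap Γ(X, V.1) Γ(Y, g ⁻¹ᵁ V.1) = (g.app V.1).hom)
    (hD : (Z.ideal V).map (algebraMap Γ(X, V.1) D) = ⊤) :
    IsHomeomorph (PrimeSpectrum.comap (algebraMap D (D ⊗[Γ(X, V.1)] Γ(Y, g ⁻¹ᵁ V.1)))) := by
  have := hg.isFinite
  let δ : CommRingCat.of Γ(X, V.1) ⟶ .of D := CommRingCat.ofHom (algebraMap Γ(X, V.1) D)
  let d : Spec (.of D) ⟶ X := Spec.map δ ≫ V.2.fromSpec
  let U : X.Opens := Z.support.compl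
  have hd : Set.range d ⊆ Set.range U.ι := by
    rintro _ ⟨P, rfl⟩
    rw [Scheme.Opens.range_ι]
    intro hP
    have hPV : d P ∈ V.1 := by
      have : V.2.fromSpec (Spec.map δ P) ∈ Set.range V.2.fromSpec := ⟨_, rfl⟩
      rw [V.2.range_fromSpec] at this
      simpa [d] using this
    have hP : d P ∈ Z.support := hP
    rw [Scheme.IdealSheafData.mem_support_iff_of_mem hPV, Scheme.mem_zeroLocus_iff] at hP
    have hle : (Z.ideal V).map (algebraMap Γ(X, V.1) D) ≤ (show PrimeSpectrum D from P).asIdeal := by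
      rw [Ideal.map_le_iff_le_comap]
      intro f hf
      by_contra hfP
      refine hP f hf ?_
      have : Spec.map δ P ∈ V.2.fromSpec ⁻¹ᵁ X.basicOpen f := by
        rw [V.2.fromSpec_preimage_basicOpen]
        exact hfP
      exact this
    exact (show PrimeSpectrum D from P).2.ne_top (top_le_iff.1 (hD ▸ hle))
  have sq1 := isPullback_SpecMap_of_isPushout _ _ _ _
    (CommRingCat.isPushout_tensorProduct Γ(X, V.1) D Γ(Y, g ⁻¹ᵁ V.1))
  have sq2 := isPullback_fromSpec g V.2 (V.2.preimage g)
  have e : CommRingCat.ofHom (algebraMap Γ(X, V.1) Γ(Y, g ⁻¹ᵁ V.1)) = g.app V.1 := by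
    rw [hB]; rfl
  rw [e] at sq1
  have sq3 := sq1.flip.paste_horiz sq2
  have sq4 : IsPullback _ _ _ (IsOpenImmersion.lift U.ι d hd) :=
    IsPullback.of_right' (by
      rw [IsOpenImmersion.lift_fac]
      exact sq3) (isPullback_morphismRestrict g U).flip
  exact (hg.universalHomeomorphism_compl.of_isPullback sq4).isHomeomorph

/-- If every section of `Y` that descends over the complement of `Z` occurs in the patched algebra,
then `Y` is radicial over its spectrum. Basic opens cover the complement, and a section that descends
to their disjoint union compatibly descends to the complement by gluing. -/
theorem isRadicial_snd_patchSections [IsNoetherian X] {g : Y ⟶ X} {Z : X.IdealSheafData}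
    (hg : IsFiniteTopologicalModification g Z.support) (N : ℕ) (V : X.AffineZariskiSite)
    (hN : ∀ (t : Γ(X, Z.support.compl ⊓ V.1)) (b : Γ(Y, g ⁻¹ᵁ V.1)),
      (g.app (Z.support.compl ⊓ V.1)).hom t = (Y.presheaf.map (homOfLE (g.preimage_mono
        (inf_le_right : Z.support.compl ⊓ V.1 ≤ V.1))).op).hom b →
      ∃ t', (t', b) ∈ patchSections g Z N V) :
    ((RingHom.snd _ _).comp (patchSections g Z N V).subtype).IsRadicial := by
  have := hg.isFinite
  have : IsNoetherianRing Γ(X, V.1) := IsLocallyNoetherian.component_noetherian ⟨V.1, V.2⟩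
  let U : X.Opens := Z.support.compl
  let I : Ideal Γ(X, V.1) := Z.ideal ⟨V.1, V.2⟩
  let _ : Algebra Γ(X, V.1) Γ(Y, g ⁻¹ᵁ V.1) := (g.app V.1).hom.toAlgebra
  have : Module.Finite Γ(X, V.1) Γ(Y, g ⁻¹ᵁ V.1) := IsFinite.finite_app (f := g) V.1 V.2
  let A : Subalgebra Γ(X, V.1) Γ(Y, g ⁻¹ᵁ V.1) :=
    { (g.app (U ⊓ V.1)).hom.range.comap
        (Y.presheaf.map (homOfLE (g.preimage_mono (inf_le_right : U ⊓ V.1 ≤ V.1))).op).hom with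
      algebraMap_mem' := fun r => ⟨_, RingHom.congr_fun (app_comp_map g _ _ inf_le_right) r⟩ }
  obtain ⟨G, hG⟩ := IsNoetherian.noetherian I
  have hGI : ∀ f : G, f.1 ∈ I := fun f => hG ▸ Submodule.subset_span f.2
  have hle : ∀ f : G, X.basicOpen f.1 ≤ U ⊓ V.1 := fun f => basicOpen_le_compl_inf _ (hGI f)
  have hcover : U ⊓ V.1 ≤ ⨆ f : G, X.basicOpen f.1 := by
    intro x hx
    by_contra hx'
    refine hx.1 ((Scheme.IdealSheafData.mem_support_iff_of_mem (U := ⟨V.1, V.2⟩) hx.2).2 ?_)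
    change x ∈ X.zeroLocus (U := V.1) (I : Set Γ(X, V.1))
    rw [← hG, ← Ideal.span, X.zeroLocus_span, Scheme.mem_zeroLocus_iff]
    intro f hf hxf
    exact hx' (Opens.mem_iSup.2 ⟨⟨f, hf⟩, hxf⟩)
  let _ : ∀ f : G, Algebra Γ(X, V.1) Γ(X, X.basicOpen f.1) := fun f =>
    (X.presheaf.map (homOfLE (X.basicOpen_le f.1)).op).hom.toAlgebra
  have hA : A.ContainsEtaleIdempotents := by
    refine Subalgebra.containsEtaleIdempotents_of_isHomeomorph
      (C := ∀ f : G, Γ(X, X.basicOpen f.1)) (fun D _ _ c => ?_) A fun c b hcc hcb => ?_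
    · refine isHomeomorph_comap_tensorProduct hg ⟨V.1, V.2⟩ D rfl ?_
      have hC : I.map (algebraMap Γ(X, V.1) (∀ f : G, Γ(X, X.basicOpen f.1))) = ⊤ := by
        classical
        rw [Ideal.eq_top_iff_one,
          ← Finset.univ_sum_single (1 : ∀ f : G, Γ(X, X.basicOpen f.1))]
        refine Ideal.sum_mem _ fun f _ => ?_
        have hu : IsUnit (algebraMap Γ(X, V.1) Γ(X, X.basicOpen f.1) f.1) :=
          RingedSpace.isUnit_res_basicOpen X.toRingedSpace f.1
        obtain ⟨v, hv⟩ := hu.exists_left_inv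
        have : (Pi.single f ((1 : ∀ f : G, Γ(X, X.basicOpen f.1)) f) :
            ∀ f : G, Γ(X, X.basicOpen f.1)) =
            Pi.single f v * algebraMap Γ(X, V.1) (∀ f : G, Γ(X, X.basicOpen f.1)) f.1 := by
          rw [← Pi.single_mul_left, Pi.algebraMap_apply, hv]
          rfl
        rw [this]
        exact Ideal.mul_mem_left _ _ (Ideal.mem_map_of_mem _ (hGI f))
      have := congrArg (Ideal.map (c : _ →+* D)) hC
      rwa [Ideal.map_map, AlgHom.comp_algebraMap, Ideal.map_top] at this
    · -- the components of `c` glue to a section over `U ⊓ V`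
      have hc : TopCat.Presheaf.IsCompatible X.sheaf.1 (fun f : G => X.basicOpen f.1) c := by
        intro f h
        let W : X.Opens := X.basicOpen f.1 ⊓ X.basicOpen h.1
        let _ : Algebra Γ(X, V.1) Γ(X, W) :=
          (X.presheaf.map (homOfLE (inf_le_left.trans (X.basicOpen_le f.1) : W ≤ V.1)).op).hom.toAlgebra
        let p : (∀ f : G, Γ(X, X.basicOpen f.1)) →ₐ[Γ(X, V.1)] Γ(X, W) :=
          AlgHom.comp { (X.presheaf.map (homOfLE (inf_le_left : W ≤ X.basicOpen f.1)).op).hom with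
            commutes' := presheaf_map_map_apply _ _ } (Pi.evalAlgHom _ _ f)
        let q : (∀ f : G, Γ(X, X.basicOpen f.1)) →ₐ[Γ(X, V.1)] Γ(X, W) :=
          AlgHom.comp { (X.presheaf.map (homOfLE (inf_le_right : W ≤ X.basicOpen h.1)).op).hom with
            commutes' := presheaf_map_map_apply _ _ } (Pi.evalAlgHom _ _ h)
        have := congrArg (Algebra.TensorProduct.lift p q fun _ _ => .all _ _) hcc
        simp only [Algebra.TensorProduct.lift_tmul, map_one, mul_one, one_mul] at this
        exact this
      obtain ⟨t, ht, -⟩ := X.sheaf.existsUnique_gluing' _ (U ⊓ V.1) (fun f => homOfLE (hle f))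
        hcover c hc
      refine ⟨t, ?_⟩
      refine Y.sheaf.eq_of_locally_eq' (fun f : G => g ⁻¹ᵁ X.basicOpen f.1) _
        (fun f => homOfLE (g.preimage_mono (hle f))) (fun y hy => ?_) _ _ fun f => ?_
      · obtain ⟨f, hf⟩ := Opens.mem_iSup.1 (hcover (show g y ∈ U ⊓ V.1 from hy))
        exact Opens.mem_iSup.2 ⟨f, hf⟩
      · let W : Y.Opens := g ⁻¹ᵁ X.basicOpen f.1
        let _ : Algebra Γ(X, V.1) Γ(Y, W) := ((g.app (X.basicOpen f.1)).hom.comp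
          (algebraMap Γ(X, V.1) Γ(X, X.basicOpen f.1))).toAlgebra
        let p : (∀ f : G, Γ(X, X.basicOpen f.1)) →ₐ[Γ(X, V.1)] Γ(Y, W) :=
          AlgHom.comp { (g.app (X.basicOpen f.1)).hom with commutes' := fun r => rfl }
            (Pi.evalAlgHom _ _ f)
        let q : Γ(Y, g ⁻¹ᵁ V.1) →ₐ[Γ(X, V.1)] Γ(Y, W) :=
          { (Y.presheaf.map (homOfLE (g.preimage_mono (X.basicOpen_le f.1))).op).hom with
            commutes' := fun r =>
              (RingHom.congr_fun (app_comp_map g _ _ (X.basicOpen_le f.1)) r).symm }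
        have h1 := congrArg (Algebra.TensorProduct.lift p q fun _ _ => .all _ _) hcb
        simp only [Algebra.TensorProduct.lift_tmul, map_one, mul_one, one_mul] at h1
        have h2 : (g.app (X.basicOpen f.1)).hom (c f) =
            (Y.presheaf.map (homOfLE (g.preimage_mono (X.basicOpen_le f.1))).op).hom b := h1
        rw [← ht f] at h2
        exact (RingHom.congr_fun (app_comp_map g _ _ (hle f)) t).symm.trans
          (h2.trans (presheaf_map_map_apply _ _ b).symm)
  have hrad := hA.isRadicial
  intro K _ k₁ k₂ h
  refine hrad K k₁ k₂ (RingHom.ext fun a => ?_)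
  obtain ⟨t, ht⟩ := a.2
  obtain ⟨t', ht'⟩ := hN t a.1 ht
  exact RingHom.congr_fun h ⟨_, ht'⟩

end RadicialPatch

/-! ### Factorization of finite topological modifications -/

section Factorization

open Scheme Scheme.AffineZariskiSite Opposite

variable {X Y : Scheme.{u}}

/-- The restriction of a morphism over an affine open with affine preimage, as the spectrum of the
homomorphism on sections. -/
noncomputable def arrowMorphismRestrictIso (p : Y ⟶ X) {V : X.Opens} (hV : IsAffineOpen V)
    (hV' : IsAffineOpen (p ⁻¹ᵁ V)) : Arrow.mk (p ∣_ V) ≅ Arrow.mk (Spec.map (p.app V)) :=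
  Arrow.isoMk hV'.isoSpec hV.isoSpec (by
    change hV'.isoSpec.hom ≫ Spec.map (p.app V) = p ∣_ V ≫ hV.isoSpec.hom
    rw [← cancel_mono hV.fromSpec, Category.assoc, Category.assoc,
      hV.isoSpec_hom_fromSpec, morphismRestrict_ι, ← (isPullback_fromSpec p hV hV').w,
      ← Category.assoc, hV'.isoSpec_hom_fromSpec])

/-- An integral homomorphism with nil kernel has closed and dense image on spectra. -/
theorem surjective_comap_of_isIntegral {R S : Type*} [CommRing R] [CommRing S] (f : R →+* S)
    (hf : f.IsIntegral) (hker : ∀ x, f x = 0 → IsNilpotent x) :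
    Function.Surjective (PrimeSpectrum.comap f) := by
  rw [← Set.range_eq_univ, ← (PrimeSpectrum.isClosedMap_comap_of_isIntegral f hf).isClosed_range.closure_eq]
  exact ((PrimeSpectrum.denseRange_comap_iff_ker_le_nilRadical f).2 hker).closure_range

/-- A criterion over an affine open, where the preimage is given only up to equality of opens. -/
theorem universallyInjective_and_surjective_morphismRestrict (p : Y ⟶ X) [IsAffineHom p]
    {V : X.Opens} (hV : IsAffineOpen V) {W : Y.Opens} (hW : p ⁻¹ᵁ V = W)
    (hint : (p.appLE V W hW.ge).hom.IsIntegral) (hrad : (p.appLE V W hW.ge).hom.IsRadicial)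
    (hker : ∀ x, (p.appLE V W hW.ge).hom x = 0 → IsNilpotent x) :
    UniversallyInjective (p ∣_ V) ∧ Surjective (p ∣_ V) := by
  subst hW
  rw [Scheme.Hom.appLE_eq_app] at hint hrad hker
  have := UniversallyInjective.respectsIso
  let e := arrowMorphismRestrictIso p hV (hV.preimage p)
  refine ⟨(MorphismProperty.arrow_mk_iso_iff @UniversallyInjective e).2
    ((universallyInjective_SpecMap_iff _).2 hrad), ?_⟩
  exact (MorphismProperty.arrow_mk_iso_iff @Surjective e).2
    ⟨surjective_comap_of_isIntegral _ hint hker⟩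

/-- On an affine open, every section of `Y` that descends over the complement of `Z` occurs in the
patched algebra for all large powers of the ideal of `Z`. -/
theorem exists_forall_exists_mem_patchSections [IsNoetherian X] (g : Y ⟶ X) [IsFinite g]
    (Z : X.IdealSheafData) (V : X.AffineZariskiSite) :
    ∃ N, ∀ n ≥ N, ∀ (t : Γ(X, Z.support.compl ⊓ V.1)) (b : Γ(Y, g ⁻¹ᵁ V.1)),
      (g.app (Z.support.compl ⊓ V.1)).hom t = (Y.presheaf.map (homOfLE (g.preimage_mono
        (inf_le_right : Z.support.compl ⊓ V.1 ≤ V.1))).op).hom b →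
      ∃ t', (t', b) ∈ patchSections g Z n V := by
  have : IsNoetherianRing Γ(X, V.1) := IsLocallyNoetherian.component_noetherian ⟨V.1, V.2⟩
  exact exists_forall_exists_mem_patchSubring (IsFinite.finite_app (f := g) V.1 V.2)
    (app_comp_map g _ _ _) fun t f hf => exists_pow_mul_mem_range ⟨V.1, V.2⟩ t f hf

/-- The spectrum `X'` of the patched algebra over `X`, with its morphism from `Y`. -/
theorem exists_patchScheme [IsNoetherian X] (g : Y ⟶ X) [IsAffineHom g]
    (Z : X.IdealSheafData) (N : ℕ) :
    ∃ (X' : Scheme.{u}) (g' : Y ⟶ X') (π : X' ⟶ X), g' ≫ π = g ∧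
      ∀ V : X.AffineZariskiSite, IsAffineOpen (π ⁻¹ᵁ V.1) ∧
        ∃ (e : Γ(X', π ⁻¹ᵁ V.1) ≃+* patchSections g Z N V) (h : g' ⁻¹ᵁ π ⁻¹ᵁ V.1 = g ⁻¹ᵁ V.1),
          (π.app V.1).hom = (e.symm : _ →+* _).comp (toPatchSections g Z N V) ∧
          (g'.appLE (π ⁻¹ᵁ V.1) (g ⁻¹ᵁ V.1) h.ge).hom =
            ((RingHom.snd _ _).comp (patchSections g Z N V).subtype).comp (e : _ →+* _) := by
  let β : ∀ V : X.AffineZariskiSite, (patchFunctor g Z N).obj (op V) ⟶ Γ(Y, g ⁻¹ᵁ V.1) := fun V =>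
    CommRingCat.ofHom ((RingHom.snd _ _).comp (patchSections g Z N V).subtype)
  obtain ⟨X', g', π, hcomp, hglue⟩ := exists_glued_spec g (patchFunctor g Z N)
    (toPatchFunctor g Z N) (coequifibered_toPatchFunctor g Z N) β (fun V W h => rfl) fun V => rfl
  have h : ∀ V : X.AffineZariskiSite, g' ⁻¹ᵁ π ⁻¹ᵁ V.1 = g ⁻¹ᵁ V.1 := by subst hcomp; exact fun V => rfl
  refine ⟨X', g', π, hcomp, fun V => ?_⟩
  obtain ⟨j, _, hj, ha, hb⟩ := hglue V
  obtain ⟨hV, e, he, heβ⟩ := exists_chart_iso g' π V.1 V.2 (g ⁻¹ᵁ V.1) (h V) j hj _ _ ha hb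
  refine ⟨hV, e.commRingCatIsoToRingEquiv, h V, ?_, congrArg CommRingCat.Hom.hom heβ⟩
  have := congrArg CommRingCat.Hom.hom ((Iso.eq_comp_inv e).2 he)
  exact this

/-- A finite topological modification is a finite universal homeomorphism to the spectrum of the
patched algebra, followed by a finite modification. -/
theorem exists_finite_universalHomeomorphism_comp_modification [IsNoetherian X]
    (Z : X.IdealSheafData) (g : Y ⟶ X) (hg : IsFiniteTopologicalModification g Z.support) :
    ∃ (X' : Scheme.{u}) (g' : Y ⟶ X') (π : X' ⟶ X), g' ≫ π = g ∧ IsFinite g' ∧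
      IsUniversalHomeomorphism g' ∧ IsFiniteModification π Z.support := by
  have := hg.isFinite
  have hnoeth : ∀ V : X.AffineZariskiSite, IsNoetherianRing Γ(X, V.1) := fun V =>
    IsLocallyNoetherian.component_noetherian ⟨V.1, V.2⟩
  have hgfin : ∀ V : X.AffineZariskiSite, (g.app V.1).hom.Finite := fun V =>
    IsFinite.finite_app (f := g) V.1 V.2
  -- a power of the ideal that is large enough on a finite affine cover
  choose n hn using exists_forall_exists_mem_patchSections g Z
  obtain ⟨S, hS⟩ : ∃ S : Finset X.AffineZariskiSite, ∀ x : X, ∃ V ∈ S, x ∈ V.1 := by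
    obtain ⟨S, hS⟩ := isCompact_univ.elim_finite_subcover
      (fun V : X.AffineZariskiSite => (V.1 : Set X)) (fun V => V.1.2) fun x _ => by
        obtain ⟨V, hV⟩ := Opens.mem_iSup.1 ((iSup_affineOpens_eq_top X).ge (Set.mem_univ x))
        exact Set.mem_iUnion.2 ⟨⟨V.1, V.2⟩, hV⟩
    refine ⟨S, fun x => ?_⟩
    obtain ⟨V, hV, hx⟩ := Set.mem_iUnion₂.1 (hS (Set.mem_univ x))
    exact ⟨V, hV, hx⟩
  let N := S.sup n
  have hker : ∀ (V : X.AffineZariskiSite) (t : Γ(X, Z.support.compl ⊓ V.1)),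
      (g.app (Z.support.compl ⊓ V.1)).hom t = 0 → IsNilpotent t := fun V t =>
    isNilpotent_of_app_eq_zero (U := Z.support.compl ⊓ V.1) fun x hx => hg.exists_apply_eq hx.1
  obtain ⟨X', g', π, hcomp, hchart⟩ := exists_patchScheme g Z N
  have haff : IsAffineHom π := ⟨fun V hV => (hchart ⟨V, hV⟩).1⟩
  have hfin : ∀ V : X.AffineZariskiSite, (toPatchSections g Z N V).Finite := fun V =>
    finite_patchSubring (app_comp_map g _ _ _) (hgfin V) (hker V)
      (eq_zero_of_forall_pow_mul_eq_zero ⟨V.1, V.2⟩ N)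
  have hπ : ∀ V : X.AffineZariskiSite, (π.app V.1).hom.Finite := fun V => by
    obtain ⟨-, e, -, he, -⟩ := hchart V
    rw [he]
    exact (RingHom.Finite.of_surjective _ e.symm.surjective).comp (hfin V)
  have hπfin : IsFinite π := ⟨fun V hV => hπ ⟨V, hV⟩⟩
  have hg'fin : IsFinite g' := by
    have : IsFinite (g' ≫ π) := by rwa [hcomp]
    exact .of_comp g' π
  refine ⟨X', g', π, hcomp, hg'fin, ?_, hπfin, ?_, ?_⟩
  · have hloc : ∀ V ∈ S, UniversallyInjective (g' ∣_ π ⁻¹ᵁ V.1) ∧ Surjective (g' ∣_ π ⁻¹ᵁ V.1) := by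
      intro V hV
      obtain ⟨hVaff, e, hV', he, heβ⟩ := hchart V
      refine universallyInjective_and_surjective_morphismRestrict g' hVaff hV' ?_ ?_ ?_
      all_goals rw [heβ]
      · have : (g.app V.1).hom = ((RingHom.snd _ _).comp (patchSections g Z N V).subtype).comp
            (toPatchSections g Z N V) := rfl
        refine RingHom.IsIntegral.trans _ _ (RingHom.isIntegral_of_surjective _ e.surjective)
          (RingHom.IsIntegral.tower_top (toPatchSections g Z N V) _ ?_)
        rw [← this]
        exact (hgfin V).to_isIntegral
      · intro K _ k₁ k₂ h
        refine isRadicial_snd_patchSections hg N V (hn V N (Finset.le_sup hV)) K k₁ k₂ ?_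
        refine RingHom.ext fun s => ?_
        have := RingHom.congr_fun h (e.symm s)
        simpa using this
      · intro x hx
        obtain ⟨k, hk⟩ := isNilpotent_of_mem_patchSubring
          (app_comp_map g _ _ _) (hker V) (e x).2 hx
        exact ⟨k, e.injective (Subtype.ext (by rw [map_pow, map_zero]; exact hk))⟩
    have hsup : ⨆ V : S, π ⁻¹ᵁ V.1.1 = ⊤ := by
      refine top_le_iff.1 fun x _ => ?_
      obtain ⟨V, hV, hx⟩ := hS (π x)
      exact Opens.mem_iSup.2 ⟨⟨V, hV⟩, hx⟩
    have := (IsZariskiLocalAtTarget.iff_of_iSup_eq_top (P := @UniversallyInjective) _ hsup).2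
      fun V => (hloc V.1 V.2).1
    have := (IsZariskiLocalAtTarget.iff_of_iSup_eq_top (P := @Surjective) _ hsup).2
      fun V => (hloc V.1 V.2).2
    exact .of_isIntegralHom g'
  · intro y hy hyZ
    obtain ⟨V, hV⟩ := Opens.mem_iSup.1 ((iSup_affineOpens_eq_top X).ge (Set.mem_univ (π y)))
    obtain ⟨hVaff, e, -, he, -⟩ := hchart ⟨V.1, V.2⟩
    have : IsNoetherianRing Γ(X', π ⁻¹ᵁ V.1) := by
      have := hnoeth ⟨V.1, V.2⟩
      have h := hπ ⟨V.1, V.2⟩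
      algebraize [(π.app V.1).hom]
      have : Module.Finite Γ(X, V.1) Γ(X', π ⁻¹ᵁ V.1) := h
      exact IsNoetherianRing.of_finite Γ(X, V.1) _
    have : IsNoetherianRing Γ(Y, g ⁻¹ᵁ V.1) := by
      have := hnoeth ⟨V.1, V.2⟩
      have h := hgfin ⟨V.1, V.2⟩
      algebraize [(g.app V.1).hom]
      have : Module.Finite Γ(X, V.1) Γ(Y, g ⁻¹ᵁ V.1) := h
      exact IsNoetherianRing.of_finite Γ(X, V.1) _
    have hY := (forall_associatedPoints_apply_notMem_iff g V.2 (Z.ideal V)).1 fun z hz hzV hzZ =>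
      hg.not_mem_of_associated z hz ((Scheme.IdealSheafData.mem_support_iff_of_mem hzV).2 hzZ)
    refine (forall_associatedPoints_apply_notMem_iff π V.2 (Z.ideal V)).2 (fun s hs => ?_) y hy hV
      ((Scheme.IdealSheafData.mem_support_iff_of_mem hV).1 hyZ)
    have hs' : ∀ i ∈ Z.ideal V, toPatchSections g Z N ⟨V.1, V.2⟩ i * e s = 0 := fun i hi => by
      have h := hs i hi
      rw [he] at h
      have h := congrArg e h
      simpa using h
    have h1 : (e s).1.1 = 0 := eq_zero_of_forall_pow_mul_eq_zero V 1 _ fun i hi =>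
      congrArg (fun x => x.1.1) (hs' i (by simpa using hi))
    have h2 : (e s).1.2 = 0 := hY _ fun i hi => congrArg (fun x => x.1.2) (hs' i hi)
    exact (map_eq_zero_iff e e.injective).1 (Subtype.ext (Prod.ext h1 h2))
  · refine isIso_morphismRestrict_of_forall π fun x hx => ?_
    obtain ⟨_, ⟨V, hV, rfl⟩, hxV, hVU⟩ := X.isBasis_affineOpens.exists_subset_of_mem_open hx Z.support.compl.2
    refine ⟨V, hxV, hVU, ?_⟩
    have hV : IsAffineOpen V := hV
    obtain ⟨hVaff, e, -, he, -⟩ := hchart ⟨V, hV⟩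
    rw [isIso_morphismRestrict_iff_of_isAffineOpen π hV, he]
    have hle : V ≤ Z.support.compl ⊓ V := le_inf hVU le_rfl
    exact e.symm.bijective.comp (bijective_codRestrict_patchSubring (app_comp_map g _ _ _)
      (bijective_presheaf_map _ hle) (bijective_presheaf_map _ (g.preimage_mono hle)))

end Factorization

theorem mainTheorem5 :
    (∀ (X : Scheme.{u}) [IsNoetherian X] (Z : X.IdealSheafData),
      IsNowhereDense (Z.support : Set X) →
      ∀ (Y : Scheme.{u}) (g : Y ⟶ X), IsFiniteTopologicalModification g Z.support →
      ∃ (X' : Scheme.{u}) (g' : Y ⟶ X') (π : X' ⟶ X),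
        g' ≫ π = g ∧ IsFinite g' ∧ IsUniversalHomeomorphism g' ∧
        IsFiniteModification π Z.support) ∧
    (∀ (X : Scheme.{u}) [IsNoetherian X] (hX : IsSemilocalScheme X),
      IsNowhereDense (hX.center : Set X) →
      ∃ (X' : Scheme.{u}) (π : X' ⟶ X),
        (FormallyUnramified π ∧ IsSmallestTopologicallyNormalPunctualModification hX π) ∧
        ∀ (X'' : Scheme.{u}) (π' : X'' ⟶ X),
          (FormallyUnramified π' ∧ IsSmallestTopologicallyNormalPunctualModification hX π') →
          ∃! e : X'' ≅ X', e.hom ≫ π = π') := by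
  refine ⟨fun X _ Z _ Y g hg => exists_finite_universalHomeomorphism_comp_modification Z g hg,
    fun X _ hX _ => ?_⟩
  obtain ⟨X', π, hu, hπ⟩ := exists_isSmallestTopologicallyNormalPunctualModification hX
  exact ⟨X', π, ⟨hu, hπ⟩, fun X'' π' h => hπ.existsUnique_iso h.2⟩
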